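/- **Setting.** Let $\mathfrak g$ be a finite-dimensional simple complex Lie algebra with a nondegenerate symmetric invariant bilinear form $\langle\cdot,\cdot\rangle$, let $\mathfrak h$ be a Cartan subalgebra with Chevalley generators $e_i,f_i$, and let $\pi$ be an automorphism of $\mathfrak g$ that permutes the $e_i$ and the $f_i$ by an automorphism of the Dynkin diagram. Let $K$ be the order of $\pi$, $\varepsilon$ a primitive $K$-th root of unity and $\mathfrak g_{[p]}=\{x:\pi x=\varepsilon^p x\}$ for $p\in\mathbb Z$. Put $\mathfrak t=\mathfrak h\cap\mathfrak g_{[0]}$ (a Cartan subalgebra of $\mathfrak g_{[0]}$). Let $H_j,E_j,F_j$ ($1\le j\le\ell$) be canonical generators of $\mathfrak g_{[0]}$ with respect to $\mathfrak t$, with simple roots $\psi_1,\dots,\psi_\ell$; let $E_0$ be a lowest weight vector, of weight $\psi_0$, of the $\mathfrak g_{[0]}$-module $\mathfrak g_{[1]}$, and $F_0$ a highest weight vector of $\mathfrak g_{[-1]}$, normalised so that $H_0=[E_0,F_0]$ satisfies $[H_0,E_0]=2E_0$. Let $A=(\psi_j(H_i))_{0\le i,j\le\ell}$, let $a_0,\dots,a_\ell$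 be positive integers with greatest common divisor $1$ and $A(a_0,\dots,a_\ell)^T=0$, and put $m=K\sum_{j=0}^{\ell}a_j$. Let $w$ be a primitive $m$-th root of unity. For integers $M\ge 1$ and $N\ge 0$ let $\tau_M^{(N)}=\mathfrak g\otimes\mathbb C[t^{\pm1},t_1^{\pm1},\dots,t_N^{\pm1}]\oplus\mathcal Z$, where $\mathcal Z$ is central, spanned by the symbols $t^{r_0}t^{\underline r}k_i$ ($r_0\in\mathbb Z$, $\underline r\in\mathbb Z^N$, $0\le i\le N$) subject only to the linear relations $\frac{r_0}{M}t^{r_0}t^{\underline r}k_0+\sum_{i=1}^N r_i\,t^{r_0}t^{\underline r}k_i=0$, and $$[x t^{r_0}t^{\underline r},\,y t^{s_0}t^{\underline s}]=[x,y]t^{r_0+s_0}t^{\underline r+\underline s}+\langle x,y\rangle\Big(\tfrac{r_0}{M}t^{r_0+s_0}t^{\underline r+\underline s}k_0+\sum_{i=1}^N r_i\,t^{r_0+s_0}t^{\underline r+\underline s}k_i\Big).$$ For an automorphism $\sigma$ of order $M$ and a primitive $M$-th root of unity $\zeta$ let $\overline L_N(\mathfrak g,\sigma)\subset\tau_M^{(N)}$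 be the subalgebra spanned by the $xt^{r_0}t^{\underline r}$ with $\sigma x=\zeta^{r_0}x$ and the $t^{r_0}t^{\underline r}k_i$ with $M\mid r_0$ (with $\zeta=\varepsilon$ for $\sigma=\pi$, and $\zeta=w$ for the automorphism $\sigma=\theta$ of order $m$ below). For $N=0$ write $C=k_0$; let $G\subset\tau_K^{(0)}$ be the subalgebra generated by $E_i,F_i,H_i$ ($1\le i\le\ell$), $E_0t$, $F_0t^{-1}$, $H_0$, $C$, and let $\widehat{\mathfrak g}=\overline L_0(\mathfrak g,\theta)$. Call $x\neq0$ a real root vector of type $(\alpha,p)$, where $\alpha\in\mathfrak t^*\setminus\{0\}$ and $p\in\mathbb Z$, if $x\in\mathfrak g_{[p]}$ and $[h,x]=\alpha(h)x$ for all $h\in\mathfrak t$. **Statement.** There is a unique automorphism $\theta$ of $\mathfrak g$ with $\theta H_j=H_j$ and $\theta E_j=wE_j$ for $0\le j\le\ell$, and it has order $m$. There is a function $N(\cdot):\mathfrak t^*\to\mathbb Z$ such that $N(\alpha)+N(\beta)=0$ whenever $x_\alpha,x_\beta$ are real root vectors of types $(\alpha,p),(\beta,q)$ with $\langle x_\alpha,x_\beta\rangle\ne0$,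 and such that the following hold. (A) There is an isomorphism of Lie algebras $\varphi:G\to\widehat{\mathfrak g}$ with $\varphi(E_i)=E_it$, $\varphi(F_i)=F_it^{-1}$, $\varphi(H_i)=H_i+\frac{2}{m\langle\psi_i,\psi_i\rangle}C$ for $1\le i\le\ell$, $\varphi(E_0t)=E_0t$, $\varphi(F_0t^{-1})=F_0t^{-1}$, $\varphi\big(H_0+\frac{\langle E_0,F_0\rangle}{K}C\big)=H_0+\frac{2}{m\langle\psi_0,\psi_0\rangle}C$ (the form on $\mathfrak t^*$ being the one induced from $\mathfrak t$, with $\langle\psi_j,\psi_j\rangle\neq 0$ for $0\le j\le\ell$), and moreover (the elements on the left lying in $G$): 1. $\varphi(C)=C$; 2. $\varphi(x_\alpha t^{r_0})=x_\alpha t^{r_0m/K+N(\alpha)}$ for every real root vector $x_\alpha$ of type $(\alpha,r_0)$; 3. for every automorphism $\omega$ of $\mathfrak g$ acting as $-1$ on $\mathfrak t$ (such as the Chevalley involution), every real root vector $x_\alpha$ of type $(\alpha,p)$, $h_\alpha=[x_\alpha,\omega(x_\alpha)]$ and every $r_0$ with $h_\alpha\in\mathfrak g_{[r_0]}$: $\varphi(h_\alpha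 t^{r_0})=h_\alpha t^{r_0m/K}+\langle x_\alpha,\omega(x_\alpha)\rangle\frac{N(\alpha)}{m}\delta_{r_0,0}C$; 4. $\varphi([x_\alpha,x_\beta]t^{r_0+s_0})=[x_\alpha,x_\beta]t^{(r_0+s_0)m/K+N(\alpha)+N(\beta)}$ for real root vectors $x_\alpha,x_\beta$ of types $(\alpha,r_0),(\beta,s_0)$ with $\langle x_\alpha,x_\beta\rangle=0$. (B) For every $N\ge0$ there is an isomorphism of Lie algebras $\Phi:\overline L_N(\mathfrak g,\pi)\to\overline L_N(\mathfrak g,\theta)$ such that, for all $\underline r\in\mathbb Z^N$ and with the same function $N(\cdot)$ (the elements on the left lying in $\overline L_N(\mathfrak g,\pi)$): 1. $\Phi(x_\alpha t^{r_0}t^{\underline r})=x_\alpha t^{r_0m/K+N(\alpha)}t^{\underline r}$ for real root vectors of type $(\alpha,r_0)$; 2. $\Phi(h_\alpha t^{r_0}t^{\underline r})=h_\alpha t^{r_0m/K}t^{\underline r}+\langle x_\alpha,\omega(x_\alpha)\rangle\frac{N(\alpha)}{m}t^{r_0m/K}t^{\underline r}k_0$ with $\omega$, $x_\alpha$, $h_\alpha$,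 $r_0$ as in (A)3; 3. $\Phi(t^{r_0}t^{\underline r}k_i)=t^{r_0m/K}t^{\underline r}k_i$ for $K\mid r_0$ and $0\le i\le N$; 4. $\Phi([x_\alpha,x_\beta]t^{r_0+s_0}t^{\underline r})=[x_\alpha,x_\beta]t^{(r_0+s_0)m/K+N(\alpha)+N(\beta)}t^{\underline r}$ for real root vectors $x_\alpha,x_\beta$ of types $(\alpha,r_0),(\beta,s_0)$ with $\langle x_\alpha,x_\beta\rangle=0$. -/

import Mathlib

open scoped TensorProduct

noncomputable section

namespace Toroidal

/-! ### Toroidal Lie algebras -/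

/-- Exponents `(r₀, r)` of the monomials `t^{r₀} t^r` in the variables `t, t₁, …, t_N`. -/
abbrev Expo (N : ℕ) := ℤ × (Fin N → ℤ)

/-- The ring `A = ℂ[t^{±1}, t₁^{±1}, …, t_N^{±1}]`. -/
abbrev LaurentRing (N : ℕ) := AddMonoidAlgebra ℂ (Expo N)

/-- The monomial `t^{r₀} t^r`. -/
abbrev mono {N : ℕ} (r : Expo N) : LaurentRing N := AddMonoidAlgebra.single r 1

/-- The free `A`-module `Ω_A` with basis `k₀, …, k_N`. -/
abbrev Omega (N : ℕ) := Fin (N + 1) → LaurentRing N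

/-- The coefficients `(r₀ / m, r₁, …, r_N)`. -/
def weight (m : ℕ) {N : ℕ} (r : Expo N) : Fin (N + 1) → ℂ :=
  Fin.cons ((r.1 : ℂ) / m) (fun i => (r.2 i : ℂ))

/-- The linear map `A → Ω_A` with
`t^{r₀} t^r ↦ (r₀ / m) t^{r₀} t^r k₀ + r₁ t^{r₀} t^r k₁ + ⋯ + r_N t^{r₀} t^r k_N`. -/
def diff (m N : ℕ) : LaurentRing N →ₗ[ℂ] Omega N :=
  (AddMonoidAlgebra.basis (Expo N) ℂ).constr ℂ fun r i => weight m r i • mono r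

/-- The subspace `d_A` of `Ω_A`, spanned by the elements
`(r₀ / m) t^{r₀} t^r k₀ + r₁ t^{r₀} t^r k₁ + ⋯ + r_N t^{r₀} t^r k_N`. -/
def exactForms (m N : ℕ) : Submodule ℂ (Omega N) :=
  Submodule.span ℂ (Set.range fun r : Expo N => fun i => weight m r i • mono r)

/-- The quotient `Ω_A / d_A`. -/
abbrev Center (m N : ℕ) := Omega N ⧸ exactForms m N

lemma diff_mono (m N : ℕ) (r : Expo N) :
    diff m N (mono r) = fun i => weight m r i • mono r := by
  have := (AddMonoidAlgebra.basis (Expo N) ℂ).constr_basis ℂ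
    (fun (r : Expo N) (i : Fin (N + 1)) => weight m r i • mono r) r
  simpa [AddMonoidAlgebra.basis_apply, diff] using this

lemma weight_add (m : ℕ) {N : ℕ} (r s : Expo N) (i : Fin (N + 1)) :
    weight m (r + s) i = weight m r i + weight m s i := by
  refine Fin.cases ?_ (fun j => ?_) i
  · simp [weight, add_div]
  · simp [weight]


/-- The bilinear map `(a, b) ↦ b · d a` from `A × A` to `Ω_A / d_A`. -/
def diffPairing (m N : ℕ) : LinearMap.BilinMap ℂ (LaurentRing N) (Center m N) :=
  LinearMap.mk₂ ℂ (fun a b => (exactForms m N).mkQ (b • diff m N a))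
    (fun a a' b => by simp only [map_add, smul_add])
    (fun c a b => by simp only [map_smul, smul_comm b c])
    (fun a b b' => by simp only [map_add, add_smul])
    (fun c a b => by simp only [smul_assoc, map_smul])

lemma diffPairing_mono (m N : ℕ) (r s : Expo N) :
    diffPairing m N (mono r) (mono s) =
      (exactForms m N).mkQ (fun i => weight m r i • mono (r + s)) := by
  simp only [diffPairing, LinearMap.mk₂_apply, diff_mono]
  congr 1
  ext1 i
  simp [AddMonoidAlgebra.single_mul_single, add_comm]

/-- Two bilinear maps on `A` agree if they agree on monomials. -/
lemma bilin_ext {N : ℕ} {M : Type*} [AddCommGroup M] [Module ℂ M]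
    {f g : LaurentRing N →ₗ[ℂ] LaurentRing N →ₗ[ℂ] M}
    (h : ∀ r s, f (mono r) (mono s) = g (mono r) (mono s)) : f = g := by
  refine (AddMonoidAlgebra.basis (Expo N) ℂ).ext fun r => ?_
  refine (AddMonoidAlgebra.basis (Expo N) ℂ).ext fun s => ?_
  simpa [AddMonoidAlgebra.basis_apply] using h r s

lemma diffPairing_skew (m N : ℕ) (a b : LaurentRing N) :
    diffPairing m N a b = -diffPairing m N b a := by
  have : diffPairing m N = -(diffPairing m N).flip := by
    refine bilin_ext fun r s => ?_
    rw [LinearMap.neg_apply, LinearMap.neg_apply, LinearMap.flip_apply, diffPairing_mono,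
      diffPairing_mono, ← add_eq_zero_iff_eq_neg, ← map_add, Submodule.mkQ_apply,
      Submodule.Quotient.mk_eq_zero]
    refine Submodule.subset_span ⟨r + s, ?_⟩
    ext1 i
    simp only [Pi.add_apply, weight_add, add_smul, add_comm s r]
  exact congrArg (fun f => f a b) this

lemma diffPairing_leibniz (m N : ℕ) (a b c : LaurentRing N) :
    diffPairing m N (a * b) c = diffPairing m N a (b * c) + diffPairing m N b (a * c) := by
  induction a using AddMonoidAlgebra.induction_linear with
  | zero => simp
  | add a a' ha ha' => simp only [add_mul, map_add, LinearMap.add_apply, ha, ha']; abel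
  | single r x =>
  induction b using AddMonoidAlgebra.induction_linear with
  | zero => simp
  | add a a' ha ha' => simp only [add_mul, mul_add, map_add, LinearMap.add_apply, ha, ha']; abel
  | single s y =>
  induction c using AddMonoidAlgebra.induction_linear with
  | zero => simp
  | add a a' ha ha' => simp only [mul_add, map_add, ha, ha']; abel
  | single u z =>
  have key (r : Expo N) (x : ℂ) :
      (AddMonoidAlgebra.single r x : LaurentRing N) = x • mono r := by simp
  have hm (r s : Expo N) : (mono r * mono s : LaurentRing N) = mono (r + s) := by
    simp [AddMonoidAlgebra.single_mul_single]
  rw [key r, key s, key u]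
  simp only [smul_mul_assoc, mul_smul_comm, map_smul, LinearMap.smul_apply, hm, diffPairing_mono]
  simp only [← map_smul, ← map_add]
  congr 1
  ext1 i
  simp only [Pi.add_apply, Pi.smul_apply, weight_add, add_smul, smul_add]
  rw [add_assoc r s u, add_left_comm s r u]
  simp only [smul_smul]
  ring_nf

section Algebra

variable {𝔤 : Type*} [LieRing 𝔤] [LieAlgebra ℂ 𝔤]

/-- The bilinear map on `A ⊗ 𝔤` with values in `Ω_A / d_A` that sends
`(a ⊗ x, b ⊗ y)` to `⟨x, y⟩ · (b · d a)`. -/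
def cocycleMap (m N : ℕ) (B : LinearMap.BilinForm ℂ 𝔤) :
    LinearMap.BilinMap ℂ (LaurentRing N ⊗[ℂ] 𝔤) (Center m N) :=
  ((diffPairing m N).tmul B).compr₂ (TensorProduct.rid ℂ (Center m N)).toLinearMap

lemma cocycleMap_tmul (m N : ℕ) (B : LinearMap.BilinForm ℂ 𝔤) (a b : LaurentRing N) (x y : 𝔤) :
    cocycleMap m N B (a ⊗ₜ x) (b ⊗ₜ y) = B x y • diffPairing m N a b := rfl

lemma cocycleMap_skew (m N : ℕ) {B : LinearMap.BilinForm ℂ 𝔤} (hS : B.IsSymm)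
    (u v : LaurentRing N ⊗[ℂ] 𝔤) : cocycleMap m N B u v = -cocycleMap m N B v u := by
  induction u using TensorProduct.induction_on with
  | zero => simp
  | add u u' hu hu' => simp only [map_add, LinearMap.add_apply, hu, hu', neg_add]
  | tmul a x =>
  induction v using TensorProduct.induction_on with
  | zero => simp
  | add v v' hv hv' => simp only [map_add, LinearMap.add_apply, hv, hv', neg_add]
  | tmul b y =>
  rw [cocycleMap_tmul, cocycleMap_tmul, diffPairing_skew, smul_neg, hS.eq]

lemma cocycleMap_lie (m N : ℕ) {B : LinearMap.BilinForm ℂ 𝔤} (hI : B.lieInvariant 𝔤)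
    (u v z : LaurentRing N ⊗[ℂ] 𝔤) :
    cocycleMap m N B u ⁅v, z⁆ = cocycleMap m N B ⁅u, v⁆ z + cocycleMap m N B v ⁅u, z⁆ := by
  have al (u u' v : LaurentRing N ⊗[ℂ] 𝔤) : ⁅u + u', v⁆ = ⁅u, v⁆ + ⁅u', v⁆ := add_lie u u' v
  have la (u v v' : LaurentRing N ⊗[ℂ] 𝔤) : ⁅u, v + v'⁆ = ⁅u, v⁆ + ⁅u, v'⁆ := lie_add u v v'
  have zl (v : LaurentRing N ⊗[ℂ] 𝔤) : ⁅(0 : LaurentRing N ⊗[ℂ] 𝔤), v⁆ = 0 := zero_lie v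
  have lz (v : LaurentRing N ⊗[ℂ] 𝔤) : ⁅v, (0 : LaurentRing N ⊗[ℂ] 𝔤)⁆ = 0 := lie_zero v
  induction u using TensorProduct.induction_on with
  | zero => simp only [zl, map_zero, LinearMap.zero_apply, add_zero]
  | add u u' hu hu' => simp only [map_add, al, LinearMap.add_apply, hu, hu']; abel
  | tmul a x =>
  induction v using TensorProduct.induction_on with
  | zero => simp only [zl, lz, map_zero, LinearMap.zero_apply, add_zero]
  | add v v' hv hv' => simp only [map_add, al, la, LinearMap.add_apply, hv, hv']; abel
  | tmul b y =>
  induction z using TensorProduct.induction_on with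
  | zero => simp only [lz, map_zero, add_zero]
  | add z z' hz hz' => simp only [map_add, la, hz, hz']; abel
  | tmul c z =>
  have h1 : B x ⁅y, z⁆ = B ⁅x, y⁆ z := by
    have := hI y x z
    rw [← lie_skew x y] at *
    simp only [map_neg, LinearMap.neg_apply] at *
    rw [this, neg_neg]
  have h2 : B y ⁅x, z⁆ = -B ⁅x, y⁆ z := by rw [hI x y z, neg_neg]
  change cocycleMap m N B (a ⊗ₜ x) ((b * c) ⊗ₜ ⁅y, z⁆) =
    cocycleMap m N B ((a * b) ⊗ₜ ⁅x, y⁆) (c ⊗ₜ z) + cocycleMap m N B (b ⊗ₜ y) ((a * c) ⊗ₜ ⁅x, z⁆)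
  simp only [cocycleMap_tmul, diffPairing_leibniz, h1, h2, smul_add, neg_smul]
  abel

lemma cocycleMap_self (m N : ℕ) {B : LinearMap.BilinForm ℂ 𝔤} (hS : B.IsSymm)
    (u : LaurentRing N ⊗[ℂ] 𝔤) : cocycleMap m N B u u = 0 := by
  have h := cocycleMap_skew m N hS u u
  rw [← add_eq_zero_iff_eq_neg, ← two_smul ℂ] at h
  exact (smul_eq_zero.mp h).resolve_left two_ne_zero

set_option linter.unusedVariables false in
/-- The toroidal Lie algebra `τ = 𝔤 ⊗ A ⊕ Ω_A / d_A` in `N + 1` variables, with central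
`Ω_A / d_A` and the bracket
`[x t^{r₀} t^r, y t^{s₀} t^s] = [x, y] t^{r₀+s₀} t^{r+s}
  + ⟨x, y⟩ ((r₀ / m) t^{r₀+s₀} t^{r+s} k₀ + ∑ i, r_i t^{r₀+s₀} t^{r+s} k_i)`,
where `⟨x, y⟩ = B x y` is a symmetric invariant bilinear form. If `m ≠ 0`, then for `N = 0` the space
`Ω_A / d_A` is the line spanned by `C = k₀`, and `τ` is the affine algebra
`𝔤 ⊗ ℂ[t, t⁻¹] ⊕ ℂ C`, `[x t^r, y t^s] = [x, y] t^{r+s} + (r / m) ⟨x, y⟩ δ_{r+s,0} C`. -/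
@[ext]
structure Tor (m N : ℕ) (B : LinearMap.BilinForm ℂ 𝔤) (hI : B.lieInvariant 𝔤) (hS : B.IsSymm) where
  /-- The component in `𝔤 ⊗ A`. -/
  loop : LaurentRing N ⊗[ℂ] 𝔤
  /-- The component in `Ω_A / d_A`. -/
  central : Center m N

namespace Tor

variable {m N : ℕ} {B : LinearMap.BilinForm ℂ 𝔤} {hI : B.lieInvariant 𝔤} {hS : B.IsSymm}

/-- The underlying pair of an element. -/
def toProd : Tor m N B hI hS ≃ (LaurentRing N ⊗[ℂ] 𝔤) × Center m N where
  toFun u := (u.loop, u.central)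
  invFun p := ⟨p.1, p.2⟩

instance : AddCommGroup (Tor m N B hI hS) := toProd.addCommGroup
instance : Module ℂ (Tor m N B hI hS) := toProd.module ℂ

@[simp] lemma loop_add (u v : Tor m N B hI hS) : (u + v).loop = u.loop + v.loop := rfl
@[simp] lemma central_add (u v : Tor m N B hI hS) :
    (u + v).central = u.central + v.central := rfl
@[simp] lemma loop_zero : (0 : Tor m N B hI hS).loop = 0 := rfl
@[simp] lemma central_zero : (0 : Tor m N B hI hS).central = 0 := rfl
@[simp] lemma loop_smul (c : ℂ) (u : Tor m N B hI hS) : (c • u).loop = c • u.loop := rfl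
@[simp] lemma central_smul (c : ℂ) (u : Tor m N B hI hS) :
    (c • u).central = c • u.central := rfl

instance : Bracket (Tor m N B hI hS) (Tor m N B hI hS) where
  bracket u v := ⟨⁅u.loop, v.loop⁆, cocycleMap m N B u.loop v.loop⟩

@[simp] lemma loop_lie (u v : Tor m N B hI hS) : ⁅u, v⁆.loop = ⁅u.loop, v.loop⁆ := rfl
@[simp] lemma central_lie (u v : Tor m N B hI hS) :
    ⁅u, v⁆.central = cocycleMap m N B u.loop v.loop := rfl

instance : LieRing (Tor m N B hI hS) where
  add_lie u v z := Tor.ext (add_lie u.loop v.loop z.loop) (by simp)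
  lie_add u v z := Tor.ext (lie_add u.loop v.loop z.loop) (by simp)
  lie_self u := Tor.ext (lie_self u.loop) (cocycleMap_self m N hS u.loop)
  leibniz_lie u v z := Tor.ext (LieRing.leibniz_lie u.loop v.loop z.loop)
    (cocycleMap_lie m N hI u.loop v.loop z.loop)

instance : LieAlgebra ℂ (Tor m N B hI hS) where
  lie_smul c u v := Tor.ext (lie_smul c u.loop v.loop) (by simp)

end Tor

/-- The element `x t^{r₀} t^r` of the toroidal Lie algebra. -/
def root (m : ℕ) {N : ℕ} {B : LinearMap.BilinForm ℂ 𝔤} {hI : B.lieInvariant 𝔤} {hS : B.IsSymm}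
    (x : 𝔤) (r₀ : ℤ) (r : Fin N → ℤ) : Tor m N B hI hS :=
  ⟨mono (r₀, r) ⊗ₜ x, 0⟩

/-- The element `t^{r₀} t^r k_i` of the toroidal Lie algebra. -/
def cen (m : ℕ) {N : ℕ} {B : LinearMap.BilinForm ℂ 𝔤} {hI : B.lieInvariant 𝔤} {hS : B.IsSymm}
    (r₀ : ℤ) (r : Fin N → ℤ) (i : Fin (N + 1)) : Tor m N B hI hS :=
  ⟨0, (exactForms m N).mkQ (Pi.single i (mono (r₀, r)))⟩

lemma root_lie_root (m : ℕ) {N : ℕ} {B : LinearMap.BilinForm ℂ 𝔤} {hI : B.lieInvariant 𝔤}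
    {hS : B.IsSymm} (x y : 𝔤) (r₀ s₀ : ℤ) (r s : Fin N → ℤ) :
    ⁅(root m x r₀ r : Tor m N B hI hS), (root m y s₀ s : Tor m N B hI hS)⁆ =
      root m ⁅x, y⁆ (r₀ + s₀) (r + s) +
        B x y • ∑ i, weight m (r₀, r) i • cen m (r₀ + s₀) (r + s) i := by
  let f : Omega N →ₗ[ℂ] Tor m N B hI hS :=
    { toFun := fun v => ⟨0, (exactForms m N).mkQ v⟩
      map_add' := fun u v => Tor.ext (by simp) (by simp)
      map_smul' := fun c v => Tor.ext (by simp) (by simp) }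
  have h1 : ∑ i, weight m (r₀, r) i • (cen m (r₀ + s₀) (r + s) i : Tor m N B hI hS) =
      f (fun i => weight m (r₀, r) i • mono (r₀ + s₀, r + s)) := by
    have (i : Fin (N + 1)) : (cen m (r₀ + s₀) (r + s) i : Tor m N B hI hS) =
      f (Pi.single i (mono (r₀ + s₀, r + s))) := rfl
    simp only [this, ← map_smul, ← map_sum]
    congr 1
    ext1 i
    simp only [Finset.sum_apply, Pi.smul_apply]
    rw [Finset.sum_eq_single i]
    · simp
    · intro j _ hj
      simp [Pi.single_eq_of_ne hj.symm]
    · simp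
  rw [h1]
  refine Tor.ext ?_ ?_
  · simp [root, f, AddMonoidAlgebra.single_mul_single]
  · simp only [Tor.central_lie, root, cocycleMap_tmul, diffPairing_mono, Tor.central_add,
      Tor.central_smul, zero_add]
    rfl

/-- The subalgebra `L̄(𝔤, θ)` of the toroidal Lie algebra attached to an automorphism `θ` of `𝔤` of
order `m` and a primitive `m`-th root of unity `w`: the elements `x t^{r₀} t^r` with
`θ x = w^{r₀} x`, together with the `t^{r₀} t^r k_i` with `m ∣ r₀`. (If `B` is `θ`-invariant, these
elements span a subspace closed under the bracket, which is `twisted_toSubmodule` below.) -/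
def twisted (m N : ℕ) (B : LinearMap.BilinForm ℂ 𝔤) (hI : B.lieInvariant 𝔤) (hS : B.IsSymm)
    (θ : 𝔤 ≃ₗ⁅ℂ⁆ 𝔤) (w : ℂ) : LieSubalgebra ℂ (Tor m N B hI hS) :=
  LieSubalgebra.lieSpan ℂ _
    ({z | ∃ x r₀ r, θ x = w ^ r₀ • x ∧ z = root m x r₀ r} ∪
      {z | ∃ r₀ r i, (m : ℤ) ∣ r₀ ∧ z = cen m r₀ r i})

lemma twisted_toSubmodule {m N : ℕ} {B : LinearMap.BilinForm ℂ 𝔤} {hI : B.lieInvariant 𝔤}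
    {hS : B.IsSymm} {θ : 𝔤 ≃ₗ⁅ℂ⁆ 𝔤} {w : ℂ} (hm : m ≠ 0) (hw : IsPrimitiveRoot w m)
    (hθ : ∀ x y, B (θ x) (θ y) = B x y) :
    (twisted m N B hI hS θ w).toSubmodule = Submodule.span ℂ
      ({z | ∃ x r₀ r, θ x = w ^ r₀ • x ∧ z = root m x r₀ r} ∪
        {z | ∃ r₀ r i, (m : ℤ) ∣ r₀ ∧ z = cen m r₀ r i}) := by
  set S : Set (Tor m N B hI hS) := {z | ∃ x r₀ r, θ x = w ^ r₀ • x ∧ z = root m x r₀ r} ∪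
    {z | ∃ r₀ r i, (m : ℤ) ∣ r₀ ∧ z = cen m r₀ r i} with hS'
  have hw0 : w ≠ 0 := hw.ne_zero hm
  have gen : ∀ u ∈ S, ∀ v ∈ S, ⁅u, v⁆ ∈ Submodule.span ℂ S := by
    rintro u (⟨x, r₀, r, hx, rfl⟩ | ⟨r₀, r, i, hr, rfl⟩) v hv
    · rcases hv with ⟨y, s₀, s, hy, rfl⟩ | ⟨s₀, s, j, hs, rfl⟩
      · rw [root_lie_root]
        refine add_mem (Submodule.subset_span (Or.inl ⟨_, _, _, ?_, rfl⟩)) ?_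
        · rw [LieEquiv.map_lie, hx, hy, smul_lie, lie_smul, smul_smul, zpow_add₀ hw0]
        · by_cases hd : (m : ℤ) ∣ r₀ + s₀
          · exact Submodule.smul_mem _ _ (Submodule.sum_mem _ fun i _ =>
              Submodule.smul_mem _ _ (Submodule.subset_span (Or.inr ⟨_, _, i, hd, rfl⟩)))
          · have h := hθ x y
            rw [hx, hy, map_smul, map_smul, LinearMap.smul_apply, smul_smul,
              ← zpow_add₀ hw0, smul_eq_mul] at h
            have h0 : B x y = 0 := by
              by_contra hne
              apply hd
              rw [← hw.zpow_eq_one_iff_dvd, add_comm]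
              exact mul_right_cancel₀ hne (by rw [h, one_mul])
            rw [h0, zero_smul]
            exact zero_mem _
      · have : ⁅(root m x r₀ r : Tor m N B hI hS), (cen m s₀ s j : Tor m N B hI hS)⁆ = 0 :=
          Tor.ext (lie_zero (L := LaurentRing N ⊗[ℂ] 𝔤) (mono (r₀, r) ⊗ₜ x))
            (by simp [root, cen])
        rw [this]
        exact zero_mem _
    · have : ⁅(cen m r₀ r i : Tor m N B hI hS), v⁆ = 0 :=
        Tor.ext (zero_lie (L := LaurentRing N ⊗[ℂ] 𝔤) v.loop) (by simp [cen])
      rw [this]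
      exact zero_mem _
  have closed : ∀ u ∈ Submodule.span ℂ S, ∀ v ∈ Submodule.span ℂ S,
      ⁅u, v⁆ ∈ Submodule.span ℂ S := by
    intro u hu v hv
    induction hu using Submodule.span_induction with
    | zero => rw [zero_lie]; exact zero_mem _
    | add u u' _ _ h h' => rw [add_lie]; exact add_mem h h'
    | smul c u _ h => rw [smul_lie]; exact Submodule.smul_mem _ c h
    | mem u hu =>
      induction hv using Submodule.span_induction with
      | zero => rw [lie_zero]; exact zero_mem _
      | add v v' _ _ h h' => rw [lie_add]; exact add_mem h h'
      | smul c v _ h => rw [lie_smul]; exact Submodule.smul_mem _ c h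
      | mem v hv => exact gen u hu v hv
  refine le_antisymm ?_ LieSubalgebra.submodule_span_le_lieSpan
  let S' : LieSubalgebra ℂ (Tor m N B hI hS) :=
    { Submodule.span ℂ S with lie_mem' := fun {u v} hu hv => closed u hu v hv }
  exact LieSubalgebra.lieSpan_le (K := S').mpr Submodule.subset_span

end Algebra

/-- `φ` is defined at `a` and sends it to `b`: the element `a` of `L` lies in the subalgebra `S`, and
its image under `φ : S ≃ S'` is the element `b` of `L'`. -/
def Sends {L L' : Type*} [LieRing L] [LieAlgebra ℂ L] [LieRing L'] [LieAlgebra ℂ L']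
    {S : LieSubalgebra ℂ L} {S' : LieSubalgebra ℂ L'} (φ : S ≃ₗ⁅ℂ⁆ S') (a : L) (b : L') : Prop :=
  ∃ h : a ∈ S, (φ ⟨a, h⟩ : L') = b

/-! ### Diagram automorphisms and the principal automorphism -/

section Principal

variable {𝔤 : Type*} [LieRing 𝔤] [LieAlgebra ℂ 𝔤]

/-- `π` is induced by an automorphism of the Dynkin diagram: it permutes the Chevalley generators
`e_i, f_i` attached to the Cartan subalgebra `H` by a symmetry `σ` of the Cartan matrix. -/
def IsDiagramAutomorphism {ι : Type*} [Finite ι] {H : LieSubalgebra ℂ 𝔤}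
    (b : LieAlgebra.Basis ι H) (π : 𝔤 ≃ₗ⁅ℂ⁆ 𝔤) : Prop :=
  ∃ σ : Equiv.Perm ι, (∀ i j, b.A (σ i) (σ j) = b.A i j) ∧
    ∀ i, π (b.e i) = b.e (σ i) ∧ π (b.f i) = b.f (σ i)

/-- The subalgebra `𝔤_[0]` of fixed points of `π`. -/
def fixedSub (π : 𝔤 ≃ₗ⁅ℂ⁆ 𝔤) : LieSubalgebra ℂ 𝔤 where
  carrier := {x | π x = x}
  add_mem' {x y} hx hy := by
    change π (x + y) = x + y
    rw [map_add, hx, hy]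
  zero_mem' := map_zero π
  smul_mem' c x hx := by
    change π (c • x) = c • x
    rw [map_smul, hx]
  lie_mem' {x y} hx hy := by
    change π ⁅x, y⁆ = ⁅x, y⁆
    rw [LieEquiv.map_lie, hx, hy]

/-- The Cartan subalgebra `𝔱 = 𝔥 ∩ 𝔤_[0]` of `𝔤_[0]`. -/
def fixedCartan (π : 𝔤 ≃ₗ⁅ℂ⁆ 𝔤) (H : LieSubalgebra ℂ 𝔤) : LieSubalgebra ℂ (fixedSub π) :=
  H.comap (fixedSub π).incl

/-- An element of `𝔱` as an element of `𝔤`. -/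
abbrev toAlg {π : 𝔤 ≃ₗ⁅ℂ⁆ 𝔤} {H : LieSubalgebra ℂ 𝔤} (h : fixedCartan π H) : 𝔤 :=
  ((h : fixedSub π) : 𝔤)

/-- The elements `H_j, E_j, F_j`, `0 ≤ j ≤ ℓ`, attached to `π` and a primitive root of unity `ε` of
the order of `π`. For `1 ≤ j ≤ ℓ` they are canonical generators of `𝔤_[0]` with respect to `𝔱`;
`E₀` is a lowest weight vector, of weight `ψ₀`, of the `𝔤_[0]`-module
`𝔤_[1] = {x | π x = ε x}`, and `F₀` is a highest weight vector of
`𝔤_[-1] = {x | π x = ε⁻¹ x}`, normalised so that `H₀ = [E₀, F₀]` satisfies `[H₀, E₀] = 2 E₀`. -/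
structure Generators (π : 𝔤 ≃ₗ⁅ℂ⁆ 𝔤) (ε : ℂ) (H : LieSubalgebra ℂ 𝔤) (ℓ : ℕ) where
  /-- The canonical generators of `𝔤_[0]`. -/
  gen : LieAlgebra.Basis (Fin ℓ) (fixedCartan π H)
  /-- The lowest weight vector of `𝔤_[1]`. -/
  E₀ : 𝔤
  /-- The highest weight vector of `𝔤_[-1]`. -/
  F₀ : 𝔤
  /-- The element `[E₀, F₀]` of `𝔱`. -/
  H₀ : fixedCartan π H
  /-- The lowest weight of `𝔤_[1]`. -/
  ψ₀ : Module.Dual ℂ (fixedCartan π H)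
  E₀_ne_zero : E₀ ≠ 0
  map_E₀ : π E₀ = ε • E₀
  lie_E₀ : ∀ h : fixedCartan π H, ⁅toAlg h, E₀⁆ = ψ₀ h • E₀
  lie_f_E₀ : ∀ j, ⁅(gen.f j : 𝔤), E₀⁆ = 0
  map_F₀ : π F₀ = ε⁻¹ • F₀
  lie_e_F₀ : ∀ j, ⁅(gen.e j : 𝔤), F₀⁆ = 0
  lie_E₀_F₀ : ⁅E₀, F₀⁆ = toAlg H₀
  lie_H₀_E₀ : ⁅toAlg H₀, E₀⁆ = (2 : ℂ) • E₀

namespace Generators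

variable {π : 𝔤 ≃ₗ⁅ℂ⁆ 𝔤} {ε : ℂ} {H : LieSubalgebra ℂ 𝔤} {ℓ : ℕ} (D : Generators π ε H ℓ)

/-- The elements `E₀, E₁, …, E_ℓ`. -/
def E : Fin (ℓ + 1) → 𝔤 := Fin.cons D.E₀ fun j => (D.gen.e j : 𝔤)

/-- The elements `F₀, F₁, …, F_ℓ`. -/
def F : Fin (ℓ + 1) → 𝔤 := Fin.cons D.F₀ fun j => (D.gen.f j : 𝔤)

/-- The elements `H₀, H₁, …, H_ℓ`. -/
def h : Fin (ℓ + 1) → fixedCartan π H := Fin.cons D.H₀ D.gen.h'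

/-- The weights `ψ₀, ψ₁, …, ψ_ℓ`; for `1 ≤ j ≤ ℓ` these are the simple roots of `𝔤_[0]`. -/
def ψ : Fin (ℓ + 1) → Module.Dual ℂ (fixedCartan π H) := Fin.cons D.ψ₀ D.gen.baseSupp

/-- The affine Cartan matrix `A i j = ψ_j(H_i)`. -/
def cartan : Matrix (Fin (ℓ + 1)) (Fin (ℓ + 1)) ℂ := fun i j => D.ψ j (D.h i)

/-- The numerical labels `a₀, …, a_ℓ` of the Dynkin diagram of `A`: positive integers with greatest
common divisor `1` and `A (a₀, …, a_ℓ)ᵀ = 0`. -/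
def IsLabels (a : Fin (ℓ + 1) → ℕ) : Prop :=
  (∀ j, 0 < a j) ∧ D.cartan.mulVec (fun j => (a j : ℂ)) = 0 ∧ Finset.univ.gcd a = 1

/-- The condition `θ H_j = H_j`, `θ E_j = w E_j` for all `j`. -/
def IsPrincipal (w : ℂ) (θ : 𝔤 ≃ₗ⁅ℂ⁆ 𝔤) : Prop :=
  ∀ j, θ (toAlg (D.h j)) = toAlg (D.h j) ∧ θ (D.E j) = w • D.E j

/-- `x` is a nonzero element of `𝔤_[p] = {x | π x = ε^p x}` of nonzero weight `α` under `𝔱`;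
equivalently, `x t^{r₀}` is a real root vector of the affine algebra for `r₀ ≡ p` modulo the order
of `π`. -/
def IsRealRootVector (_D : Generators π ε H ℓ) (α : Module.Dual ℂ (fixedCartan π H)) (p : ℤ)
    (x : 𝔤) : Prop :=
  α ≠ 0 ∧ x ≠ 0 ∧ π x = ε ^ p • x ∧ ∀ h : fixedCartan π H, ⁅toAlg h, x⁆ = α h • x

/-- The affine Lie algebra `G`: the subalgebra of `𝔤 ⊗ ℂ[t, t⁻¹] ⊕ ℂ C` (with cocycle `1 / K`
times the form) generated by `E_i, F_i, H_i` (`1 ≤ i ≤ ℓ`), `E₀ t, F₀ t⁻¹, H₀` and `C`. -/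
def affine (K : ℕ) (B : LinearMap.BilinForm ℂ 𝔤) (hI : B.lieInvariant 𝔤) (hS : B.IsSymm) :
    LieSubalgebra ℂ (Tor K 0 B hI hS) :=
  LieSubalgebra.lieSpan ℂ _
    (Set.range (fun i : Fin ℓ => root K (D.E i.succ) 0 0) ∪
      Set.range (fun i : Fin ℓ => root K (D.F i.succ) 0 0) ∪
      Set.range (fun i : Fin ℓ => root K (toAlg (D.h i.succ)) 0 0) ∪
      {root K (D.E 0) 1 0, root K (D.F 0) (-1) 0, root K (toAlg (D.h 0)) 0 0, cen K 0 0 0})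

end Generators

end Principal

end Toroidal
end

/-! Everything comes from one element `ρ` of `𝔱` with `ψ_j(ρ) = 1` for `1 ≤ j ≤ ℓ`. Its adjoint
action on `𝔤` is diagonalizable with integral eigenvalues (`Generators.isIntegral`) and commutes
with `π`, so `𝔤` is bigraded by the degree `p` mod `K` for `π` and the degree `n` for `ad ρ`. The
relation `∑ a_j ψ_j = 0` and the equality `a₀ = 1` (`label_zero`) give `ψ₀(ρ) = 1 - M`, where `M = ∑
a_j` and `m = K M`. Let `θ` act by `w ^ (p M + n)` in bidegree `(p, n)`. This depends only on `p`
mod `K`, and `E₀`, of bidegree `(1, 1 - M)`, is multiplied by `w`, like the other `E_j`, of bidegree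
`(0, 1)`.

The same bigrading gives the isomorphisms. For `x` of `ad ρ`-degree `n`, send `x t^{r₀} t^r` to `x
t^{r₀ M + n} t^r` and correct by `(⟨ρ, x⟩ / m) t^{r₀ M} t^r k₀`. Since `(r₀ M + n) / m = r₀ / K + n
/ m`, the two cocycles differ by the term `(n / m) ⟨x, y⟩ = ⟨ρ, [x, y]⟩ / m`, which is a coboundary,
and the correction absorbs it (`exists_toroidalHom`). This injective homomorphism of full toroidal
algebras maps one twisted subalgebra onto the other (`map_twisted`). The shift is `N(α) = α(ρ)`; the
correction vanishes on real root vectors, because these are orthogonal to `𝔱`.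

It remains to show that `θ` is unique and that `G` is the whole twisted algebra, and both rest on a
rigidity statement: a vector `y` of `𝔤` killed by `E₀, …, E_ℓ` is zero
(`eq_zero_of_forall_lie_E_eq_zero`). One may take `y` to be a weight vector. By `sl₂`-theory each
`H_j` then acts on it by a nonnegative integer, but a combination of the `H_j` with positive
coefficients is zero, so all these integers vanish. Hence `y` is centralized by `𝔤_[0]`, whose
centralizer is trivial. Dualizing through the Killing form shows that the `E_j` and `F_j`, placed in
degrees `0` and `±1`, generate the `ℤ`-graded algebra with components `𝔤_[j]` (`mem_of_graded`). -/

noncomputable section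

namespace Toroidal

/-! ### Spans of eigenvectors and independent functionals. -/

section LinearAlgebra

variable {V : Type*} [AddCommGroup V] [Module ℂ V]

/-- An eigenvector of `f` in the span of a set of eigenvectors is a combination of those members of
the set which have the same eigenvalue. -/
lemma mem_span_of_apply_eq_smul {f : V →ₗ[ℂ] V} {s : Set V} (hf : ∀ v ∈ s, ∃ c : ℂ, f v = c • v)
    {y : V} (hys : y ∈ Submodule.span ℂ s) {c : ℂ} (hy : f y = c • y) :
    y ∈ Submodule.span ℂ {v ∈ s | f v = c • v} := by
  -- Over a linearly independent spanning subset of `s`, applying `f - c` multiplies each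
  -- coefficient by a scalar, so a member with another eigenvalue cannot occur.
  obtain ⟨t, hts, hspan, hli⟩ := exists_linearIndependent ℂ s
  choose χ hχ using fun k : t => hf k (hts k.2)
  rw [← hspan, Finsupp.mem_span_iff_linearCombination] at hys
  obtain ⟨l, rfl⟩ := hys
  rw [Finsupp.linearCombination_apply, Finsupp.sum] at hy ⊢
  have h0 : ∑ k ∈ l.support, (l k * (χ k - c)) • (k : V) = 0 := by
    simp only [mul_sub, sub_smul, Finset.sum_sub_distrib, sub_eq_zero]
    rw [map_sum, Finset.smul_sum] at hy
    simpa only [map_smul, hχ, smul_smul, mul_comm c] using hy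
  refine Submodule.sum_mem _ fun k hk =>
    Submodule.smul_mem _ _ (Submodule.subset_span ⟨hts k.2, ?_⟩)
  have := linearIndependent_iff'.mp hli l.support _ h0 k hk
  rw [hχ k, sub_eq_zero.mp ((mul_eq_zero.mp this).resolve_left (Finsupp.mem_support_iff.mp hk))]

/-- The operators `f` with `f ^ K = 1` are diagonalizable on each stable subspace. -/
lemma mem_span_of_pow_eq_one {f : V →ₗ[ℂ] V} {K : ℕ} (hK : K ≠ 0) (hf : f ^ K = 1) {ε : ℂ}
    (hε : IsPrimitiveRoot ε K) {U : Submodule ℂ V} (hU : ∀ x ∈ U, f x ∈ U) {x : V} (hx : x ∈ U) :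
    x ∈ Submodule.span ℂ {y ∈ U | ∃ p : ℤ, f y = ε ^ p • y} := by
  have hε0 : ε ≠ 0 := hε.ne_zero hK
  have hpow (k : ℕ) : (f ^ k) x ∈ U := by
    induction k with
    | zero => simpa
    | succ k ih => rw [pow_succ']; exact hU _ ih
  -- Up to the factor `K`, the projection of `x` to the `ε ^ p`-eigenspace; the sum over `p` gives
  -- back `K x`.
  let y (p : ℕ) : V := ∑ k ∈ Finset.range K, (ε⁻¹) ^ (p * k) • (f ^ k) x
  have hy (p : ℕ) : f (y p) = ε ^ p • y p := by
    have h1 : f (y p) = ε ^ p • ∑ k ∈ Finset.range K, (ε⁻¹) ^ (p * (k + 1)) • (f ^ (k + 1)) x := by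
      rw [map_sum, Finset.smul_sum]
      refine Finset.sum_congr rfl fun k _ => ?_
      rw [map_smul, smul_smul, pow_succ' f, Module.End.mul_apply, mul_add, mul_one, pow_add,
        mul_left_comm, ← mul_pow, mul_inv_cancel₀ hε0, one_pow, mul_one]
    rw [h1]
    congr 1
    have h2 := Finset.sum_range_succ (fun k => (ε⁻¹) ^ (p * k) • (f ^ k) x) K
    rw [Finset.sum_range_succ'] at h2
    have h3 : (ε⁻¹) ^ (p * K) = 1 := by
      rw [mul_comm, pow_mul, hε.inv.pow_eq_one, one_pow]
    rw [h3, hf] at h2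
    simpa [y] using h2
  have hsum : ∑ p ∈ Finset.range K, y p = (K : ℂ) • x := by
    simp only [y]
    rw [Finset.sum_comm]
    simp only [← Finset.sum_smul]
    rw [Finset.sum_eq_single 0]
    · simp
    · intro k hk hk0
      have h1 : (ε⁻¹) ^ k ≠ 1 :=
        hε.inv.pow_ne_one_of_pos_of_lt hk0 (Finset.mem_range.mp hk)
      have h2 : ∑ p ∈ Finset.range K, (ε⁻¹) ^ (p * k) = 0 := by
        simp only [mul_comm _ k, pow_mul]
        have := geom_sum_mul ((ε⁻¹) ^ k) K
        rw [← pow_mul, mul_comm k K, pow_mul, hε.inv.pow_eq_one, one_pow, sub_self] at this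
        exact (mul_eq_zero.mp this).resolve_right (sub_ne_zero.mpr h1)
      rw [h2, zero_smul]
    · intro h; simp at h; exact absurd h hK
  have hx' : x = (K : ℂ)⁻¹ • ∑ p ∈ Finset.range K, y p := by
    rw [hsum, smul_smul, inv_mul_cancel₀ (by exact_mod_cast hK), one_smul]
  rw [hx']
  refine Submodule.smul_mem _ _ (Submodule.sum_mem _ fun p _ => Submodule.subset_span ⟨?_, p, ?_⟩)
  · exact Submodule.sum_mem _ fun k _ => Submodule.smul_mem _ _ (hpow k)
  · rw [hy, zpow_natCast]

/-- Linearly independent functionals take arbitrary values. -/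
lemma exists_forall_apply_eq_of_linearIndependent {ι : Type*} [Finite ι]
    {f : ι → Module.Dual ℂ V} (hf : LinearIndependent ℂ f) (c : ι → ℂ) : ∃ v, ∀ i, f i v = c i := by
  have := Fintype.ofFinite ι
  -- Surjectivity is injectivity of the transpose, which is the linear independence of the family.
  have hsurj : Function.Surjective (LinearMap.pi f : V →ₗ[ℂ] ι → ℂ) := by
    rw [← LinearMap.dualMap_injective_iff, ← LinearMap.ker_eq_bot, LinearMap.ker_eq_bot']
    intro φ hφ
    have h0 : ∑ i, φ (Pi.basisFun ℂ ι i) • f i = 0 := by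
      ext v
      have h := congrArg (fun g => g v) hφ
      simp only [LinearMap.dualMap_apply, LinearMap.zero_apply] at h
      rw [LinearMap.zero_apply, ← h, ← (Pi.basisFun ℂ ι).sum_repr (LinearMap.pi f v), map_sum]
      simp [mul_comm]
    refine (Pi.basisFun ℂ ι).ext fun i => ?_
    exact Fintype.linearIndependent_iff.mp hf _ h0 i
  obtain ⟨v, hv⟩ := hsurj c
  exact ⟨v, fun i => congrFun hv i⟩

end LinearAlgebra

/-! ### Integral elements, `sl₂`-triples and invariant forms. -/

section Lie

variable {𝔤 : Type*} [LieRing 𝔤] [LieAlgebra ℂ 𝔤]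

/-- When brackets of members of `t` stay in its span, that span is a subalgebra. Applied to sets `t`
of homogeneous vectors, this extends gradings from generators to everything they generate. -/
lemma mem_span_of_mem_lieSpan {s t : Set 𝔤} (hst : s ⊆ Submodule.span ℂ t)
    (ht : ∀ x ∈ t, ∀ y ∈ t, ⁅x, y⁆ ∈ Submodule.span ℂ t) {x : 𝔤}
    (hx : x ∈ LieSubalgebra.lieSpan ℂ 𝔤 s) : x ∈ Submodule.span ℂ t := by
  have closed : ∀ u ∈ Submodule.span ℂ t, ∀ v ∈ Submodule.span ℂ t,
      ⁅u, v⁆ ∈ Submodule.span ℂ t := by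
    intro u hu v hv
    induction hu using Submodule.span_induction with
    | zero => rw [zero_lie]; exact zero_mem _
    | add u u' _ _ h h' => rw [add_lie]; exact add_mem h h'
    | smul c u _ h => rw [smul_lie]; exact Submodule.smul_mem _ c h
    | mem u hu =>
      induction hv using Submodule.span_induction with
      | zero => rw [lie_zero]; exact zero_mem _
      | add v v' _ _ h h' => rw [lie_add]; exact add_mem h h'
      | smul c v _ h => rw [lie_smul]; exact Submodule.smul_mem _ c h
      | mem v hv => exact ht u hu v hv
  let S : LieSubalgebra ℂ 𝔤 :=
    { Submodule.span ℂ t with lie_mem' := fun {u v} hu hv => closed u hu v hv }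
  exact LieSubalgebra.lieSpan_le (K := S).mpr hst hx

lemma span_eq_top_of_lieSpan_eq_top {s t : Set 𝔤} (hs : LieSubalgebra.lieSpan ℂ 𝔤 s = ⊤)
    (hst : s ⊆ Submodule.span ℂ t) (ht : ∀ x ∈ t, ∀ y ∈ t, ⁅x, y⁆ ∈ Submodule.span ℂ t) :
    Submodule.span ℂ t = ⊤ :=
  eq_top_iff.mpr fun x _ => mem_span_of_mem_lieSpan hst ht (hs ▸ LieSubalgebra.mem_top x)

/-- `ad h` is diagonalizable with integral eigenvalues. -/
def IsIntegral (h : 𝔤) : Prop :=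
  Submodule.span ℂ {x : 𝔤 | ∃ n : ℤ, ⁅h, x⁆ = (n : ℂ) • x} = ⊤

lemma lie_lie_eq_smul {h x y : 𝔤} {c d : ℂ} (hx : ⁅h, x⁆ = c • x) (hy : ⁅h, y⁆ = d • y) :
    ⁅h, ⁅x, y⁆⁆ = (c + d) • ⁅x, y⁆ := by
  rw [leibniz_lie, hx, hy, smul_lie, lie_smul, add_smul]

lemma IsIntegral.of_lieSpan {h : 𝔤} {s : Set 𝔤} (hs : LieSubalgebra.lieSpan ℂ 𝔤 s = ⊤)
    (hint : ∀ x ∈ s, ∃ n : ℤ, ⁅h, x⁆ = (n : ℂ) • x) : IsIntegral h := by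
  refine span_eq_top_of_lieSpan_eq_top hs (fun x hx => Submodule.subset_span (hint x hx)) ?_
  rintro x ⟨n, hn⟩ y ⟨k, hk⟩
  exact Submodule.subset_span ⟨n + k, by rw [lie_lie_eq_smul hn hk]; push_cast; rfl⟩

lemma IsIntegral.exists_int {h : 𝔤} (hh : IsIntegral h) {x : 𝔤} (hx : x ≠ 0) {c : ℂ}
    (hc : ⁅h, x⁆ = c • x) : ∃ n : ℤ, c = n := by
  by_contra! hne
  have := mem_span_of_apply_eq_smul (f := (LieAlgebra.ad ℂ 𝔤 h : 𝔤 →ₗ[ℂ] 𝔤))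
    (s := {x : 𝔤 | ∃ n : ℤ, ⁅h, x⁆ = (n : ℂ) • x}) (fun v ⟨n, hn⟩ => ⟨n, hn⟩) (y := x) (c := c)
    (hh ▸ Submodule.mem_top) hc
  refine hx ?_
  rw [← Submodule.mem_bot (R := ℂ), ← Submodule.span_zero_singleton ℂ]
  refine Submodule.span_mono ?_ this
  rintro v ⟨⟨n, hn⟩, hv⟩
  by_contra hv0
  have h1 : ⁅h, v⁆ = c • v := hv
  rw [hn] at h1
  exact hne n (smul_left_injective ℂ hv0 h1).symm

/-- Given `[h, e] = 2 e` and `[e, f] = h` with `ad h` diagonalizable, `f` may be modified so as to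
complete `h, e` to an `sl₂`-triple. -/
lemma exists_isSl2Triple {h e f : 𝔤}
    (hh : Submodule.span ℂ {x : 𝔤 | ∃ c : ℂ, ⁅h, x⁆ = c • x} = ⊤) (he : e ≠ 0)
    (hhe : ⁅h, e⁆ = (2 : ℂ) • e) (hef : ⁅e, f⁆ = h) : ∃ f', IsSl2Triple h e f' := by
  -- The new `f'` plays the part of the component of `f` of `ad h`-eigenvalue `-2`. As `h` has
  -- eigenvalue `0` and `ad e` raises eigenvalues by `2`, only that component contributes to `[e, f]
  -- = h`.
  let W : Submodule ℂ 𝔤 :=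
    Submodule.map (LieAlgebra.ad ℂ 𝔤 e : 𝔤 →ₗ[ℂ] 𝔤)
      (Module.End.eigenspace (LieAlgebra.ad ℂ 𝔤 h) (-2))
  let s : Set 𝔤 := (LieAlgebra.ad ℂ 𝔤 e : 𝔤 →ₗ[ℂ] 𝔤) '' {x : 𝔤 | ∃ c : ℂ, ⁅h, x⁆ = c • x}
  have hs : h ∈ Submodule.span ℂ s := by
    rw [Submodule.span_image, hh]
    exact ⟨f, Submodule.mem_top, hef⟩
  have hmem := mem_span_of_apply_eq_smul (f := (LieAlgebra.ad ℂ 𝔤 h : 𝔤 →ₗ[ℂ] 𝔤)) (s := s)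
    (by rintro - ⟨x, ⟨c, hc⟩, rfl⟩; exact ⟨2 + c, lie_lie_eq_smul hhe hc⟩) hs (c := 0) (by simp)
  have hW : h ∈ W := by
    refine Submodule.span_le.mpr ?_ hmem
    rintro - ⟨⟨x, ⟨c, hc⟩, rfl⟩, h0⟩
    have h1 : ⁅h, ⁅e, x⁆⁆ = (0 : ℂ) • ⁅e, x⁆ := h0
    rw [lie_lie_eq_smul hhe hc, zero_smul] at h1
    rcases smul_eq_zero.mp h1 with h2 | h2
    · refine ⟨x, Module.End.mem_eigenspace_iff.mpr ?_, rfl⟩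
      rw [LieAlgebra.ad_apply, hc, ← eq_neg_of_add_eq_zero_right h2]
    · change ⁅e, x⁆ ∈ W
      rw [h2]; exact zero_mem _
  obtain ⟨f', hf', hf⟩ := hW
  have hf'' : ⁅h, f'⁆ = (-2 : ℂ) • f' := Module.End.mem_eigenspace_iff.mp hf'
  refine ⟨f', ?_, hf, ?_, ?_⟩
  · rintro rfl
    rw [zero_lie] at hhe
    exact he ((smul_eq_zero.mp hhe.symm).resolve_left two_ne_zero)
  · rw [hhe, two_smul, two_nsmul]
  · rw [hf'', neg_smul, two_smul, two_nsmul]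

/-- An element commuting with generators is central, and a simple Lie algebra has no centre. -/
lemma eq_zero_of_forall_lie_eq_zero [LieAlgebra.IsSimple ℂ 𝔤] {s : Set 𝔤}
    (hs : LieSubalgebra.lieSpan ℂ 𝔤 s = ⊤) {y : 𝔤}
    (hy : ∀ x ∈ s, ⁅x, y⁆ = 0) : y = 0 := by
  have h : y ∈ LieAlgebra.center ℂ 𝔤 := by
    rw [LieModule.mem_maxTrivSubmodule]
    intro x
    have hx : x ∈ LieSubalgebra.lieSpan ℂ 𝔤 s := hs ▸ LieSubalgebra.mem_top x
    induction hx using LieSubalgebra.lieSpan_induction with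
    | mem x hx => exact hy x hx
    | zero => simp
    | add u v _ _ hu hv => rw [add_lie, hu, hv, add_zero]
    | smul c u _ hu => rw [smul_lie, hu, smul_zero]
    | lie u v _ _ hu hv => rw [lie_lie, hu, hv, lie_zero, lie_zero, sub_zero]
  rwa [LieAlgebra.center_eq_bot, LieSubmodule.mem_bot] at h

variable [FiniteDimensional ℂ 𝔤]

/-- In an eigenbasis of `ad h` the trace of `(ad h)²` is a sum of squares of integers, not all zero
since `2` is an eigenvalue. -/
lemma IsIntegral.killingForm_self_pos {h : 𝔤} (hh : IsIntegral h) {x : 𝔤} (hx : x ≠ 0)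
    (h2 : ⁅h, x⁆ = (2 : ℂ) • x) : ∃ r : ℝ, 0 < r ∧ killingForm ℂ 𝔤 h h = r := by
  obtain ⟨t, hts, hspan, hli⟩ := exists_linearIndependent ℂ {x : 𝔤 | ∃ n : ℤ, ⁅h, x⁆ = (n : ℂ) • x}
  let v : Module.Basis t ℂ 𝔤 := Module.Basis.mk hli (by rw [Subtype.range_coe, hspan, hh])
  have hv (k : t) : v k = k := by simp [v]
  choose n hn using fun k : t => hts k.2
  have : Fintype t := FiniteDimensional.fintypeBasisIndex v
  have had (k : t) : LieAlgebra.ad ℂ 𝔤 h (v k) = (n k : ℂ) • v k := by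
    rw [hv, LieAlgebra.ad_apply, hn]
  have htr : killingForm ℂ 𝔤 h h = ∑ k, (n k : ℂ) ^ 2 := by
    classical
    rw [killingForm_apply_apply, LinearMap.trace_eq_matrix_trace ℂ v]
    refine Finset.sum_congr rfl fun k _ => ?_
    rw [Matrix.diag_apply, LinearMap.toMatrix_apply, LinearMap.comp_apply, had, map_smul, had]
    simp [sq]
  refine ⟨∑ k, (n k : ℝ) ^ 2, ?_, by rw [htr]; push_cast; rfl⟩
  refine lt_of_le_of_ne (Finset.sum_nonneg fun k _ => sq_nonneg _) fun h0 => ?_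
  have hz := (Finset.sum_eq_zero_iff_of_nonneg (fun k _ => sq_nonneg ((n k : ℝ)))).mp h0.symm
  have had0 : LieAlgebra.ad ℂ 𝔤 h = 0 := by
    refine v.ext fun k => ?_
    rw [had]
    have := hz k (Finset.mem_univ k)
    simp_all
  have : (2 : ℂ) • x = 0 := by rw [← h2, ← LieAlgebra.ad_apply ℂ, had0]; rfl
  exact hx ((smul_eq_zero.mp this).resolve_left two_ne_zero)

variable [LieAlgebra.IsSimple ℂ 𝔤]

/-- On a simple Lie algebra every invariant form is a multiple of the Killing form. -/
lemma exists_eq_smul_killingForm {B : LinearMap.BilinForm ℂ 𝔤} (hI : B.lieInvariant 𝔤) :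
    ∃ c : ℂ, B = c • killingForm ℂ 𝔤 := by
  have hκ := LieAlgebra.IsKilling.killingForm_nondegenerate ℂ 𝔤
  let e := (killingForm ℂ 𝔤).toDual hκ
  -- Schur's lemma: `T` compares `B` with the Killing form and commutes with the adjoint action, so
  -- one of its eigenspaces is a nonzero ideal.
  let T : 𝔤 →ₗ[ℂ] 𝔤 := e.symm.toLinearMap ∘ₗ B
  have hT (x y : 𝔤) : killingForm ℂ 𝔤 (T x) y = B x y := by
    have : e (T x) = B x := e.apply_symm_apply (B x)
    rw [← this]; rfl
  have hTlie (z x : 𝔤) : T ⁅z, x⁆ = ⁅z, T x⁆ := by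
    refine e.injective ?_
    ext y
    change killingForm ℂ 𝔤 (T ⁅z, x⁆) y = killingForm ℂ 𝔤 ⁅z, T x⁆ y
    rw [hT, hI, ← hT, LieModule.traceForm_apply_lie_apply']
  have : Nontrivial 𝔤 := LieAlgebra.IsSimple.nontrivial ℂ 𝔤
  obtain ⟨c, hc⟩ := Module.End.exists_eigenvalue T
  let I : LieIdeal ℂ 𝔤 :=
    { Module.End.eigenspace T c with
      lie_mem := fun {z x} hx => by
        have hx' : T x = c • x := Module.End.mem_eigenspace_iff.mp hx
        exact Module.End.mem_eigenspace_iff.mpr (by rw [hTlie, hx', lie_smul]) }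
  have hI : I = ⊤ := by
    refine (LieAlgebra.IsSimple.eq_bot_or_eq_top I).resolve_left fun h => hc ?_
    have : I.toSubmodule = ⊥ := by rw [h]; rfl
    exact this
  refine ⟨c, LinearMap.ext fun x => LinearMap.ext fun y => ?_⟩
  have hx : x ∈ I := hI ▸ LieSubmodule.mem_top x
  rw [← hT x y, show T x = c • x from Module.End.mem_eigenspace_iff.mp hx]
  simp

/-- Invariance under automorphisms is inherited from the Killing form, of which `B` is a multiple.
-/
lemma bilinForm_map_map {B : LinearMap.BilinForm ℂ 𝔤} (hI : B.lieInvariant 𝔤) (θ : 𝔤 ≃ₗ⁅ℂ⁆ 𝔤)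
    (x y : 𝔤) : B (θ x) (θ y) = B x y := by
  obtain ⟨c, rfl⟩ := exists_eq_smul_killingForm hI
  simp [LieAlgebra.killingForm_of_equiv_apply]

end Lie

end Toroidal
end

noncomputable section

namespace Toroidal

/-! ### Diagram automorphisms and the centralizer of their fixed points. -/

section Diagram

variable {𝔤 : Type*} [LieRing 𝔤] [LieAlgebra ℂ 𝔤]

lemma iterate_lie (π : 𝔤 ≃ₗ⁅ℂ⁆ 𝔤) (k : ℕ) (x y : 𝔤) : π^[k] ⁅x, y⁆ = ⁅π^[k] x, π^[k] y⁆ := by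
  induction k generalizing x y with
  | zero => rfl
  | succ k ih => simp only [Function.iterate_succ_apply, LieEquiv.map_lie, ih]

lemma toLinearEquiv_pow_apply (π : 𝔤 ≃ₗ⁅ℂ⁆ 𝔤) (k : ℕ) (x : 𝔤) :
    (π.toLinearEquiv ^ k) x = π^[k] x := by
  rw [LinearEquiv.coe_pow]; rfl

lemma iterate_eq_self {π : 𝔤 ≃ₗ⁅ℂ⁆ 𝔤} {K : ℕ} (hK : orderOf π.toLinearEquiv = K) (x : 𝔤) :
    π^[K] x = x := by
  rw [← toLinearEquiv_pow_apply, ← hK, pow_orderOf_eq_one]; rfl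

lemma iterate_eq_smul {π : 𝔤 ≃ₗ⁅ℂ⁆ 𝔤} {h x : 𝔤} (hh : π h = h) {c : ℂ} (hx : ⁅h, x⁆ = c • x)
    (k : ℕ) : ⁅h, π^[k] x⁆ = c • π^[k] x := by
  induction k with
  | zero => exact hx
  | succ k ih =>
    rw [Function.iterate_succ_apply', ← map_smul, ← ih, LieEquiv.map_lie, hh]

lemma exists_zpow_smul_of_pow_eq_one {π : 𝔤 ≃ₗ⁅ℂ⁆ 𝔤} {K : ℕ} (hK0 : K ≠ 0)
    (hK : orderOf π.toLinearEquiv = K) {ε : ℂ} (hε : IsPrimitiveRoot ε K) {U : Submodule ℂ 𝔤}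
    (hU : ∀ x ∈ U, π x ∈ U) {x : 𝔤} (hx : x ∈ U) :
    x ∈ Submodule.span ℂ {y ∈ U | ∃ p : ℤ, π y = ε ^ p • y} := by
  refine mem_span_of_pow_eq_one (f := (π.toLinearEquiv : 𝔤 →ₗ[ℂ] 𝔤)) hK0 ?_ hε hU hx
  ext y
  rw [Module.End.pow_apply]
  exact iterate_eq_self hK y

section

variable {ι : Type*} [Finite ι] {H : LieSubalgebra ℂ 𝔤} {b : LieAlgebra.Basis ι H}
  {π : 𝔤 ≃ₗ⁅ℂ⁆ 𝔤}

lemma eq_of_eqOn_lieSpan {s : Set 𝔤} (hs : LieSubalgebra.lieSpan ℂ 𝔤 s = ⊤) {f g : 𝔤 → 𝔤}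
    (hadd : ∀ x y, f (x + y) = f x + f y) (hadd' : ∀ x y, g (x + y) = g x + g y)
    (hsmul : ∀ (c : ℂ) x, f (c • x) = c • f x) (hsmul' : ∀ (c : ℂ) x, g (c • x) = c • g x)
    (hlie : ∀ x y, f ⁅x, y⁆ = ⁅f x, f y⁆) (hlie' : ∀ x y, g ⁅x, y⁆ = ⁅g x, g y⁆)
    (hfg : ∀ x ∈ s, f x = g x) (x : 𝔤) : f x = g x := by
  have hx : x ∈ LieSubalgebra.lieSpan ℂ 𝔤 s := hs ▸ LieSubalgebra.mem_top x
  induction hx using LieSubalgebra.lieSpan_induction with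
  | mem x hx => exact hfg x hx
  | zero => rw [← zero_smul ℂ (0 : 𝔤), hsmul, hsmul', zero_smul, zero_smul]
  | add u v _ _ hu hv => rw [hadd, hadd', hu, hv]
  | smul c u _ hu => rw [hsmul, hsmul', hu]
  | lie u v _ _ hu hv => rw [hlie, hlie', hu, hv]

lemma IsDiagramAutomorphism.exists_perm (hπ : IsDiagramAutomorphism b π) :
    ∃ σ : Equiv.Perm ι, ∀ (k : ℕ) (i : ι),
      π^[k] (b.e i) = b.e ((σ ^ k) i) ∧ π^[k] (b.f i) = b.f ((σ ^ k) i) := by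
  obtain ⟨σ, -, hσ⟩ := hπ
  refine ⟨σ, fun k i => ?_⟩
  induction k generalizing i with
  | zero => exact ⟨rfl, rfl⟩
  | succ k ih =>
    simp only [Function.iterate_succ_apply, hσ, ih, pow_succ, Equiv.Perm.mul_apply, and_self]

lemma IsDiagramAutomorphism.orderOf_ne_zero (hπ : IsDiagramAutomorphism b π) :
    orderOf π.toLinearEquiv ≠ 0 := by
  obtain ⟨σ, he⟩ := hπ.exists_perm
  have : Finite (Equiv.Perm ι) := inferInstance
  rw [orderOf_ne_zero_iff]
  refine isOfFinOrder_iff_pow_eq_one.mpr ⟨orderOf σ, orderOf_pos σ, LinearEquiv.ext fun x => ?_⟩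
  have hone : (σ ^ orderOf σ) = 1 := pow_orderOf_eq_one σ
  refine eq_of_eqOn_lieSpan b.span_ef (f := ⇑(π.toLinearEquiv ^ orderOf σ))
    (g := id) (map_add _) (fun _ _ => rfl) (map_smul _) (fun _ _ => rfl) ?_ (fun _ _ => rfl) ?_ x
  · intro x y
    simp only [toLinearEquiv_pow_apply, iterate_lie]
  · rintro - (⟨i, rfl⟩ | ⟨i, rfl⟩)
    · rw [toLinearEquiv_pow_apply, (he _ i).1, hone]; rfl
    · rw [toLinearEquiv_pow_apply, (he _ i).2, hone]; rfl

/-- The sum of the simple root vectors along an orbit of the diagram automorphism. -/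
def orbitSum (b : LieAlgebra.Basis ι H) (π : 𝔤 ≃ₗ⁅ℂ⁆ 𝔤) (K : ℕ) (i : ι) : 𝔤 :=
  ∑ k ∈ Finset.range K, π^[k] (b.e i)

lemma map_orbitSum {K : ℕ} (hK : orderOf π.toLinearEquiv = K) (i : ι) :
    π (orbitSum b π K i) = orbitSum b π K i := by
  have h := Finset.sum_range_succ (fun k => π^[k] (b.e i)) K
  rw [Finset.sum_range_succ', iterate_eq_self hK] at h
  rw [orbitSum, map_sum]
  simpa only [Function.iterate_succ_apply', Function.iterate_zero, id, add_left_inj] using h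

/-- Bracketing with `f i` kills the terms with `(σ ^ k) i ≠ i` and leaves `d i • h i` times the
number of remaining `k`. That number is positive because `k = 0` counts, so it does not matter that
the sum may run through the orbit several times. -/
lemma eq_zero_of_sum_perm_eq_zero (b : LieAlgebra.Basis ι H) {K : ℕ} (hK : K ≠ 0)
    {σ : Equiv.Perm ι} {d : ι → ℂ} {i : ι}
    (h : ∑ k ∈ Finset.range K, d ((σ ^ k) i) • b.e ((σ ^ k) i) = 0) : d i = 0 := by
  classical
  have h1 (k : ℕ) : ⁅d ((σ ^ k) i) • b.e ((σ ^ k) i), b.f i⁆ =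
      if (σ ^ k) i = i then d i • b.h i else 0 := by
    split_ifs with hk
    · rw [hk, smul_lie, (b.sl2 i).lie_e_f]
    · rw [smul_lie, b.lie_e_f_ne _ _ hk, smul_zero]
  have h2 := congrArg (fun x => ⁅x, b.f i⁆) h
  simp only [zero_lie, sum_lie] at h2
  rw [Finset.sum_congr rfl fun k _ => h1 k, ← Finset.sum_filter, Finset.sum_const,
    ← Nat.cast_smul_eq_nsmul ℂ, smul_smul] at h2
  have h3 := (smul_eq_zero.mp h2).resolve_right (b.sl2 i).h_ne_zero
  refine (mul_eq_zero.mp h3).resolve_left ?_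
  rw [← ne_eq, Nat.cast_ne_zero, ← Nat.pos_iff_ne_zero, Finset.card_pos]
  exact ⟨0, Finset.mem_filter.mpr ⟨Finset.mem_range.mpr (Nat.pos_of_ne_zero hK), rfl⟩⟩

lemma IsDiagramAutomorphism.orbitSum_ne_zero (hπ : IsDiagramAutomorphism b π) {K : ℕ} (hK : K ≠ 0)
    (i : ι) : orbitSum b π K i ≠ 0 := by
  obtain ⟨σ, hσ⟩ := hπ.exists_perm
  intro h
  refine one_ne_zero (α := ℂ) (eq_zero_of_sum_perm_eq_zero b hK (σ := σ)
    (d := fun _ => 1) (i := i) ?_)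
  simpa only [one_smul, orbitSum, (hσ _ _).1] using h

/-- For `y` not assumed fixed by `π`, the bracket weights the terms of the orbit sum by the possibly
different values `b.baseSupp j y`; the preceding cancellation argument still isolates the one at
`i`. -/
lemma IsDiagramAutomorphism.baseSupp_eq_zero [Fintype ι] (hπ : IsDiagramAutomorphism b π) {K : ℕ}
    (hK : K ≠ 0) {y : H} {i : ι} (hy : ⁅(y : 𝔤), orbitSum b π K i⁆ = 0) : b.baseSupp i y = 0 := by
  obtain ⟨σ, hσ⟩ := hπ.exists_perm
  refine eq_zero_of_sum_perm_eq_zero b hK (σ := σ) (d := fun j => b.baseSupp j y) ?_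
  simp only [orbitSum, (hσ _ _).1, lie_sum] at hy
  rw [← hy]
  exact Finset.sum_congr rfl fun k _ => b.baseSupp_apply_smul_e _ y

lemma eq_zero_of_baseSupp_eq_zero [Fintype ι] [LieAlgebra.IsSimple ℂ 𝔤]
    (b : LieAlgebra.Basis ι H) {y : H} (hy : ∀ i, b.baseSupp i y = 0) : (y : 𝔤) = 0 := by
  refine eq_zero_of_forall_lie_eq_zero b.span_ef ?_
  rintro - (⟨i, rfl⟩ | ⟨i, rfl⟩)
  · rw [← lie_skew, neg_eq_zero]
    exact (b.baseSupp_apply_smul_e i y).symm.trans (by rw [hy, zero_smul])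
  · rw [← lie_skew]
    exact (b.baseSupp_apply_smul_f i y).symm.trans (by rw [hy, zero_smul])

/-- Two functionals on the Cartan subalgebra agree if they agree on the basis `h i`. -/
lemma dual_ext (b : LieAlgebra.Basis ι H) {f g : Module.Dual ℂ H}
    (hfg : ∀ i, f (b.h' i) = g (b.h' i)) : f = g := by
  let v := (Module.Basis.span b.linInd).map
    (LinearEquiv.ofEq _ _ b.coe_cartan_eq_span).symm
  have hv (i : ι) : v i = b.h' i := Subtype.ext (by
    simp [v, LieAlgebra.Basis.h', Module.Basis.span_apply])
  exact v.ext fun i => (congrArg f (hv i)).trans ((hfg i).trans (congrArg g (hv i)).symm)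

/-- `ad h` acts diagonalizably for `h` in the Cartan subalgebra. -/
lemma span_eigenvectors_eq_top [Fintype ι] (b : LieAlgebra.Basis ι H) (y : H) :
    Submodule.span ℂ {x : 𝔤 | ∃ c : ℂ, ⁅(y : 𝔤), x⁆ = c • x} = ⊤ := by
  refine span_eq_top_of_lieSpan_eq_top b.span_ef ?_ ?_
  · rintro - (⟨i, rfl⟩ | ⟨i, rfl⟩)
    · exact Submodule.subset_span ⟨_, (b.baseSupp_apply_smul_e i y).symm⟩
    · refine Submodule.subset_span ⟨-b.baseSupp i y, ?_⟩
      rw [neg_smul, eq_neg_iff_add_eq_zero, b.baseSupp_apply_smul_f i y]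
      exact add_neg_cancel _
  · rintro x ⟨c, hc⟩ y ⟨d, hd⟩
    exact Submodule.subset_span ⟨_, lie_lie_eq_smul hc hd⟩

/-- An element on which all simple roots take the value `1` has centralizer `H`. -/
lemma mem_cartan_of_lie_eq_zero [Fintype ι] (b : LieAlgebra.Basis ι H) {r : H}
    (hr : ∀ i, b.baseSupp i r = 1) {y : 𝔤} (hy : ⁅(r : 𝔤), y⁆ = 0) : y ∈ H := by
  -- On the subalgebra generated by vectors of eigenvalue `c`, all eigenvalues are positive
  -- multiples of `c`. With `c = ±1` this keeps the two nilpotent parts out of the kernel of `ad r`.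
  have hpos {s : Set 𝔤} {c : ℂ} (hc : ∀ x ∈ s, ⁅(r : 𝔤), x⁆ = c • x) {x : 𝔤}
      (hx : x ∈ LieSubalgebra.lieSpan ℂ 𝔤 s) :
      x ∈ Submodule.span ℂ {x : 𝔤 | ∃ n : ℕ, ⁅(r : 𝔤), x⁆ = ((n + 1 : ℕ) * c) • x} := by
    refine mem_span_of_mem_lieSpan (s := s)
      (t := {x : 𝔤 | ∃ n : ℕ, ⁅(r : 𝔤), x⁆ = ((n + 1 : ℕ) * c) • x})
      (fun x hx => Submodule.subset_span ⟨0, by rw [hc x hx]; simp⟩) ?_ hx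
    rintro u ⟨n, hn⟩ v ⟨k, hk⟩
    refine Submodule.subset_span ⟨n + k + 1, ?_⟩
    rw [lie_lie_eq_smul hn hk]
    push_cast
    ring_nf
  have hab := b.isLieAbelian_cartan
  let s : Set 𝔤 := H ∪ {x : 𝔤 | ∃ c : ℂ, c ≠ 0 ∧ ⁅(r : 𝔤), x⁆ = c • x}
  have hs : y ∈ Submodule.span ℂ s := by
    have htop := b.iSup_cartan_borelLower_borelUpper_eq_top
    have hy' : y ∈ H.toLieSubmodule ⊔ b.borelLower ⊔ b.borelUpper := by
      have h1 : iSup ![H.toLieSubmodule, b.borelLower, b.borelUpper] =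
        H.toLieSubmodule ⊔ b.borelLower ⊔ b.borelUpper := by simp
      rw [← h1, htop]; exact LieSubmodule.mem_top y
    obtain ⟨z, hz, u, hu, rfl⟩ := (LieSubmodule.mem_sup _ _ _).mp hy'
    obtain ⟨h, hh, l, hl, rfl⟩ := (LieSubmodule.mem_sup _ _ _).mp hz
    refine add_mem (add_mem (Submodule.subset_span (Or.inl hh)) ?_) ?_
    · refine Submodule.span_mono (Set.subset_union_of_subset_right ?_ _)
        (hpos (s := Set.range b.f) (c := -1) ?_ hl)
      · rintro x ⟨n, hn⟩
        exact ⟨_, mul_ne_zero (Nat.cast_ne_zero.mpr n.succ_ne_zero) (by norm_num), hn⟩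
      · rintro - ⟨i, rfl⟩
        have := b.baseSupp_apply_smul_f i r
        rw [hr, one_smul] at this
        rw [neg_smul, one_smul]
        conv_rhs => rw [this]
        exact (neg_neg _).symm
    · refine Submodule.span_mono (Set.subset_union_of_subset_right ?_ _)
        (hpos (s := Set.range b.e) (c := 1) ?_ hu)
      · rintro x ⟨n, hn⟩
        exact ⟨_, mul_ne_zero (Nat.cast_ne_zero.mpr n.succ_ne_zero) (by norm_num), hn⟩
      · rintro - ⟨i, rfl⟩
        have := b.baseSupp_apply_smul_e i r
        rw [hr] at this
        exact this.symm
  have hHr {x : 𝔤} (hx : x ∈ H) : ⁅(r : 𝔤), x⁆ = 0 :=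
    congrArg Subtype.val (trivial_lie_zero H H r ⟨x, hx⟩)
  have hmem := mem_span_of_apply_eq_smul (f := (LieAlgebra.ad ℂ 𝔤 (r : 𝔤) : 𝔤 →ₗ[ℂ] 𝔤)) (s := s)
    (c := 0) ?_ hs (by rw [zero_smul]; exact hy)
  · refine (Submodule.span_le (p := H.toSubmodule)).mpr ?_ hmem
    rintro x ⟨hx | ⟨c, hc, hx⟩, h0⟩
    · exact hx
    · have h0' : ⁅(r : 𝔤), x⁆ = (0 : ℂ) • x := h0
      rw [hx, zero_smul] at h0'
      rw [(smul_eq_zero.mp h0').resolve_left hc]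
      exact zero_mem _
  · rintro x (hx | ⟨c, -, hx⟩)
    · exact ⟨0, by rw [zero_smul]; exact hHr hx⟩
    · exact ⟨c, hx⟩

lemma IsDiagramAutomorphism.map_mem (hπ : IsDiagramAutomorphism b π) {x : 𝔤} (hx : x ∈ H) :
    π x ∈ H := by
  obtain ⟨σ, -, hσ⟩ := hπ
  have hmem (i : ι) : b.h i ∈ H := (b.h' i).2
  rw [← LieSubalgebra.mem_toSubmodule, b.coe_cartan_eq_span] at hx
  induction hx using Submodule.span_induction with
  | mem x hx =>
    obtain ⟨i, rfl⟩ := hx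
    rw [← (b.sl2 i).lie_e_f, LieEquiv.map_lie, (hσ i).1, (hσ i).2, (b.sl2 (σ i)).lie_e_f]
    exact hmem _
  | zero => rw [map_zero]; exact zero_mem _
  | add u v _ _ hu hv => rw [map_add]; exact add_mem hu hv
  | smul c u _ hu => rw [map_smul]; exact H.smul_mem c hu

/-- All simple roots take the value `1` on `r`. Since `π` permutes the simple root vectors, the same
holds for `π r`, and the simple roots separate points of `H`. -/
lemma IsDiagramAutomorphism.exists_fixed_regular [Fintype ι] [LieAlgebra.IsSimple ℂ 𝔤]
    (hπ : IsDiagramAutomorphism b π) :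
    ∃ r : H, (∀ i, b.baseSupp i r = 1) ∧ π r = r := by
  obtain ⟨r, hr⟩ := exists_forall_apply_eq_of_linearIndependent b.linearIndependent_baseSupp
    (fun _ => (1 : ℂ))
  refine ⟨r, hr, ?_⟩
  let r' : H := ⟨π r, hπ.map_mem r.2⟩
  have h0 : ((r' - r : H) : 𝔤) = 0 := by
    refine eq_zero_of_baseSupp_eq_zero b fun k => ?_
    rw [map_sub, hr, sub_eq_zero]
    obtain ⟨σ, -, hσ⟩ := hπ
    have h1 := b.baseSupp_apply_smul_e (σ.symm k) r
    have h2 : π ⁅(r : 𝔤), b.e (σ.symm k)⁆ = π (b.e (σ.symm k)) := by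
      rw [hr, one_smul] at h1; exact congrArg π h1.symm
    rw [LieEquiv.map_lie, (hσ _).1, Equiv.apply_symm_apply] at h2
    have h3 : b.baseSupp k r' • b.e k = (1 : ℂ) • b.e k := by
      rw [b.baseSupp_apply_smul_e, one_smul]; exact h2
    exact smul_left_injective ℂ (b.sl2 k).e_ne_zero h3
  rw [AddSubgroupClass.coe_sub, sub_eq_zero] at h0
  exact h0

/-- The fixed point algebra of a diagram automorphism has trivial centralizer. -/
lemma IsDiagramAutomorphism.eq_zero_of_forall_fixed_lie [LieAlgebra.IsSimple ℂ 𝔤]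
    (hπ : IsDiagramAutomorphism b π) {y : 𝔤} (hy : ∀ x : 𝔤, π x = x → ⁅x, y⁆ = 0) : y = 0 := by
  have := Fintype.ofFinite ι
  obtain ⟨r, hr, hrπ⟩ := hπ.exists_fixed_regular
  -- Commuting with the fixed regular element puts `y` in `H`; commuting with the fixed orbit sums
  -- then makes every simple root vanish at `y`.
  have hyH := mem_cartan_of_lie_eq_zero b hr (hy r hrπ)
  refine eq_zero_of_baseSupp_eq_zero b (y := ⟨y, hyH⟩) fun i => ?_
  refine hπ.baseSupp_eq_zero hπ.orderOf_ne_zero (K := orderOf π.toLinearEquiv) ?_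
  rw [← lie_skew, hy _ (map_orbitSum rfl i), neg_zero]

end

end Diagram

end Toroidal
end

noncomputable section

namespace Toroidal

/-! ### Weights, integrality and labels of the generators `E_j`, `F_j`, `H_j`. -/

namespace Generators

variable {𝔤 : Type*} [LieRing 𝔤] [LieAlgebra ℂ 𝔤]
  {π : 𝔤 ≃ₗ⁅ℂ⁆ 𝔤} {ε : ℂ} {H : LieSubalgebra ℂ 𝔤} {ℓ : ℕ} (D : Generators π ε H ℓ)

lemma map_toAlg (h : fixedCartan π H) : π (toAlg h) = toAlg h := h.1.2

lemma toAlg_mem (h : fixedCartan π H) : toAlg h ∈ H := h.2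

lemma lie_toAlg_toAlg (D : Generators π ε H ℓ) (h h' : fixedCartan π H) :
    ⁅toAlg h, toAlg h'⁆ = 0 := by
  have := D.gen.isLieAbelian_cartan
  exact congrArg toAlg (trivial_lie_zero _ _ h h')

lemma lie_E (j : Fin (ℓ + 1)) (h : fixedCartan π H) : ⁅toAlg h, D.E j⁆ = D.ψ j h • D.E j := by
  refine Fin.cases ?_ (fun j => ?_) j
  · exact D.lie_E₀ h
  · exact (congrArg Subtype.val (D.gen.baseSupp_apply_smul_e j h)).symm

lemma lie_F_succ (j : Fin ℓ) (h : fixedCartan π H) :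
    ⁅toAlg h, D.F j.succ⁆ = -D.ψ j.succ h • D.F j.succ := by
  have := congrArg Subtype.val (D.gen.baseSupp_apply_smul_f j h)
  rw [neg_smul, eq_comm, neg_eq_iff_eq_neg]
  exact this

lemma lie_E_F_self (j : Fin (ℓ + 1)) : ⁅D.E j, D.F j⁆ = toAlg (D.h j) := by
  refine Fin.cases ?_ (fun j => ?_) j
  · exact D.lie_E₀_F₀
  · exact congrArg Subtype.val (D.gen.sl2 j).lie_e_f

lemma lie_E_F_ne {i j : Fin (ℓ + 1)} (hij : i ≠ j) : ⁅D.E i, D.F j⁆ = 0 := by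
  revert hij
  refine Fin.cases ?_ (fun i => ?_) i <;> refine Fin.cases ?_ (fun j => ?_) j <;> intro hij
  · exact absurd rfl hij
  · rw [← lie_skew, neg_eq_zero]; exact D.lie_f_E₀ j
  · exact D.lie_e_F₀ i
  · exact congrArg Subtype.val (D.gen.lie_e_f_ne i j fun h => hij (congrArg _ h))

lemma lie_h_E (j : Fin (ℓ + 1)) : ⁅toAlg (D.h j), D.E j⁆ = (2 : ℂ) • D.E j := by
  refine Fin.cases ?_ (fun j => ?_) j
  · exact D.lie_H₀_E₀
  · exact congrArg Subtype.val ((D.gen.sl2 j).lie_h_e_smul ℂ)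

lemma E_ne_zero (j : Fin (ℓ + 1)) : D.E j ≠ 0 := by
  refine Fin.cases ?_ (fun j => ?_) j
  · exact D.E₀_ne_zero
  · exact fun h => (D.gen.sl2 j).e_ne_zero (Subtype.ext h)

lemma ψ_h_self (j : Fin (ℓ + 1)) : D.ψ j (D.h j) = 2 :=
  smul_left_injective ℂ (D.E_ne_zero j) ((D.lie_E j _).symm.trans (D.lie_h_E j))

lemma map_E_succ (j : Fin ℓ) : π (D.E j.succ) = D.E j.succ := (D.gen.e j).2

lemma map_F_succ (j : Fin ℓ) : π (D.F j.succ) = D.F j.succ := (D.gen.f j).2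

/-- A functional on `𝔱` vanishing on `H₁, …, H_ℓ` is zero. -/
lemma dual_eq_zero (D : Generators π ε H ℓ) {f : Module.Dual ℂ (fixedCartan π H)}
    (hf : ∀ i : Fin ℓ, f (D.h i.succ) = 0) : f = 0 :=
  dual_ext D.gen fun i => hf i

lemma lie_eq_zero_of_forall (D : Generators π ε H ℓ) {y : 𝔤} (he : ∀ i : Fin ℓ, ⁅D.E i.succ, y⁆ = 0)
    (hf : ∀ i : Fin ℓ, ⁅D.F i.succ, y⁆ = 0) {x : 𝔤} (hx : π x = x) : ⁅x, y⁆ = 0 := by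
  have h : (⟨x, hx⟩ : fixedSub π) ∈ LieSubalgebra.lieSpan ℂ (fixedSub π)
      (Set.range D.gen.e ∪ Set.range D.gen.f) := D.gen.span_ef ▸ LieSubalgebra.mem_top _
  change ⁅((⟨x, hx⟩ : fixedSub π) : 𝔤), y⁆ = 0
  generalize (⟨x, hx⟩ : fixedSub π) = x' at h
  induction h using LieSubalgebra.lieSpan_induction with
  | mem x hx =>
    obtain ⟨i, rfl⟩ | ⟨i, rfl⟩ := hx
    · exact he i
    · exact hf i
  | zero => simp
  | add u v _ _ hu hv => simp [hu, hv]
  | smul c u _ hu => simp [hu]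
  | lie u v _ _ hu hv => simp [hu, hv]

/-- The elements of `𝔱` on which `ψ₁, …, ψ_ℓ` are integral act with integral eigenvalues on `𝔤`. -/
lemma isIntegral {ι : Type*} [Finite ι] {b : LieAlgebra.Basis ι H}
    (hπ : IsDiagramAutomorphism b π) {h : fixedCartan π H}
    (hh : ∀ j : Fin ℓ, ∃ n : ℤ, D.ψ j.succ h = n) : IsIntegral (toAlg h) := by
  have := Fintype.ofFinite ι
  have h1 : IsIntegral (h : fixedSub π) := by
    refine .of_lieSpan D.gen.span_ef ?_
    rintro - (⟨i, rfl⟩ | ⟨i, rfl⟩)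
    · obtain ⟨n, hn⟩ := hh i
      exact ⟨n, by rw [← hn]; exact (D.gen.baseSupp_apply_smul_e i h).symm⟩
    · obtain ⟨n, hn⟩ := hh i
      refine ⟨-n, Subtype.ext ?_⟩
      have := D.lie_F_succ i h
      rw [hn] at this
      push_cast
      exact this
  let y : H := ⟨toAlg h, toAlg_mem h⟩
  -- Integrality passes from `𝔤_[0]` to `𝔤` through the orbit sum of `b.e i`: it lies in `𝔤_[0]`,
  -- and has the same `ad h`-eigenvalue as `b.e i` because `π` fixes `h`.
  have h2 (i : ι) : ∃ n : ℤ, b.baseSupp i y = n := by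
    set K := orderOf π.toLinearEquiv with hK
    have he : ⁅toAlg h, b.e i⁆ = b.baseSupp i y • b.e i := (b.baseSupp_apply_smul_e i y).symm
    refine h1.exists_int (x := ⟨orbitSum b π K i, map_orbitSum hK.symm i⟩) ?_ (Subtype.ext ?_)
    · intro h0
      exact hπ.orbitSum_ne_zero hπ.orderOf_ne_zero i (congrArg Subtype.val h0)
    · change ⁅toAlg h, orbitSum b π K i⁆ = b.baseSupp i y • orbitSum b π K i
      rw [orbitSum, lie_sum, Finset.smul_sum]
      exact Finset.sum_congr rfl fun k _ => iterate_eq_smul (map_toAlg h) he k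
  refine .of_lieSpan b.span_ef ?_
  rintro - (⟨i, rfl⟩ | ⟨i, rfl⟩)
  · obtain ⟨n, hn⟩ := h2 i
    exact ⟨n, by rw [← hn]; exact (b.baseSupp_apply_smul_e i y).symm⟩
  · obtain ⟨n, hn⟩ := h2 i
    refine ⟨-n, ?_⟩
    have := b.baseSupp_apply_smul_f i y
    push_cast
    rw [neg_smul, ← hn, eq_neg_iff_add_eq_zero, this]
    exact add_neg_cancel _

/-- There are elements of `𝔱` on which `ψ₁, …, ψ_ℓ` take prescribed values. -/
lemma exists_ψ_eq (c : Fin ℓ → ℂ) : ∃ h : fixedCartan π H, ∀ j : Fin ℓ, D.ψ j.succ h = c j :=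
  exists_forall_apply_eq_of_linearIndependent D.gen.linearIndependent_baseSupp c

section Labels

variable {a : Fin (ℓ + 1) → ℕ}

/-- The functional `∑ a_j ψ_j` vanishes on `H₁, …, H_ℓ` by the corresponding rows of `A a = 0`, and
these elements span `𝔱`. -/
lemma sum_labels (ha : D.IsLabels a) (h : fixedCartan π H) : ∑ j, (a j : ℂ) * D.ψ j h = 0 := by
  have h0 : ∑ j, (a j : ℂ) • D.ψ j = 0 := by
    refine D.dual_eq_zero fun i => ?_
    have := congrFun ha.2.1 i.succ
    simpa [Matrix.mulVec, dotProduct, cartan, mul_comm] using this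
  simpa using congrArg (fun f => f h) h0

/-- If `h` is dual to `ψ_i` among `ψ₁, …, ψ_ℓ`, then `E₀` has an integral eigenvalue `n` under `h`,
and the label relation reads `a₀ n + a_i = 0`. So `a₀` divides every label, and the labels are
coprime. -/
lemma label_zero {ι : Type*} [Finite ι] {b : LieAlgebra.Basis ι H}
    (hπ : IsDiagramAutomorphism b π) (ha : D.IsLabels a) : a 0 = 1 := by
  have hdvd (i : Fin ℓ) : a 0 ∣ a i.succ := by
    obtain ⟨h, hh⟩ := D.exists_ψ_eq (Pi.single i 1)
    have hint := D.isIntegral hπ (h := h) fun j => by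
      rw [hh]
      by_cases hj : j = i
      · exact ⟨1, by subst hj; simp⟩
      · exact ⟨0, by simp [Pi.single_eq_of_ne hj]⟩
    obtain ⟨n, hn⟩ := hint.exists_int (D.E_ne_zero 0) (D.lie_E 0 h)
    have hsum := D.sum_labels ha h
    rw [Fin.sum_univ_succ, hn] at hsum
    simp only [hh] at hsum
    rw [Finset.sum_eq_single i (fun j _ hj => by simp [Pi.single_eq_of_ne hj]) (by simp)] at hsum
    simp only [Pi.single_eq_same, mul_one] at hsum
    have : (a 0 : ℤ) * n + a i.succ = 0 := by exact_mod_cast hsum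
    have h2 : (a 0 : ℤ) ∣ a i.succ := ⟨-n, by linarith⟩
    exact_mod_cast h2
  have : a 0 ∣ Finset.univ.gcd a := Finset.dvd_gcd fun j _ => by
    refine Fin.cases ?_ hdvd j
    exact dvd_rfl
  rw [ha.2.2] at this
  exact Nat.dvd_one.mp this

end Labels

/-! ### Positivity, and vectors killed by all the `E_j`. -/

section Killing

lemma form_toAlg_h {B : LinearMap.BilinForm ℂ 𝔤} (hI : B.lieInvariant 𝔤) (j : Fin (ℓ + 1))
    (h : fixedCartan π H) : B (toAlg h) (toAlg (D.h j)) = B (D.E j) (D.F j) * D.ψ j h := by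
  have h1 := hI (D.E j) (toAlg h) (D.F j)
  rw [D.lie_E_F_self, ← lie_skew, D.lie_E, map_neg, LinearMap.neg_apply, neg_inj, map_smul,
    LinearMap.smul_apply, smul_eq_mul] at h1
  rw [← h1, mul_comm]

/-- At this stage `F₀` is not known to be a weight vector for `𝔱`, so it may have to be replaced in
the triple. -/
lemma exists_isSl2Triple_h {ι : Type*} [Finite ι] (b : LieAlgebra.Basis ι H) (j : Fin (ℓ + 1)) :
    ∃ f, IsSl2Triple (toAlg (D.h j)) (D.E j) f := by
  have := Fintype.ofFinite ι
  exact exists_isSl2Triple (span_eigenvectors_eq_top b ⟨_, toAlg_mem (D.h j)⟩) (D.E_ne_zero j)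
    (D.lie_h_E j) (D.lie_E_F_self j)

variable [FiniteDimensional ℂ 𝔤]

lemma exists_nat_of_lie_E_eq_zero {ι : Type*} [Finite ι] (b : LieAlgebra.Basis ι H)
    {j : Fin (ℓ + 1)} {y : 𝔤} (hy : y ≠ 0)
    {c : ℂ} (hc : ⁅toAlg (D.h j), y⁆ = c • y) (hE : ⁅D.E j, y⁆ = 0) : ∃ n : ℕ, c = n := by
  obtain ⟨f, hf⟩ := D.exists_isSl2Triple_h b j
  exact IsSl2Triple.HasPrimitiveVectorWith.exists_nat (t := hf) (m := y) ⟨hy, hc, hE⟩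

/-- The numbers `⟨E_j, F_j⟩` are positive for the Killing form. -/
lemma killingForm_E_F_pos {ι : Type*} [Finite ι]
    {b : LieAlgebra.Basis ι H} (hπ : IsDiagramAutomorphism b π) (j : Fin (ℓ + 1)) :
    ∃ r : ℝ, 0 < r ∧ killingForm ℂ 𝔤 (D.E j) (D.F j) = r := by
  have hint : IsIntegral (toAlg (D.h j)) := by
    refine D.isIntegral hπ fun i => ?_
    refine Fin.cases ?_ (fun j => ?_) j
    -- For `j = 0`: since `[E₀, F_i] = 0`, the vector `F_i` is primitive for the triple of `E₀`, so
    -- `ψ_i(H₀)` is a nonpositive integer.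
    · obtain ⟨n, hn⟩ := D.exists_nat_of_lie_E_eq_zero b (j := 0) (y := D.F i.succ)
        (c := -D.ψ i.succ (D.h 0)) (fun h => (D.gen.sl2 i).f_ne_zero (Subtype.ext h))
        (D.lie_F_succ i _) (D.lie_E_F_ne (Fin.succ_ne_zero i).symm)
      exact ⟨-n, by push_cast; rw [← hn, neg_neg]⟩
    · exact ⟨D.gen.A i j, D.gen.baseSupp_apply_h' i j⟩
  obtain ⟨r, hr, h⟩ := hint.killingForm_self_pos (D.E_ne_zero j) (D.lie_h_E j)
  refine ⟨r / 2, by positivity, ?_⟩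
  -- By invariance the Killing form at `(H_j, H_j)` is twice its value at `(E_j, F_j)`, as `ψ_j(H_j)
  -- = 2`.
  have h2 := D.form_toAlg_h (LieModule.traceForm_lieInvariant ℂ 𝔤 𝔤) j (D.h j)
  rw [D.ψ_h_self, h] at h2
  push_cast
  rw [h2]
  ring

variable [LieAlgebra.IsSimple ℂ 𝔤] {ι : Type*} [Finite ι] {b : LieAlgebra.Basis ι H}

/-- The Killing form is nondegenerate on `𝔱`. -/
lemma eq_zero_of_killingForm_eq_zero (hπ : IsDiagramAutomorphism b π)
    {h : fixedCartan π H} (hh : ∀ h' : fixedCartan π H, killingForm ℂ 𝔤 (toAlg h) (toAlg h') = 0) :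
    h = 0 := by
  have := Fintype.ofFinite ι
  have := b.isCartanSubalgebra
  set K := orderOf π.toLinearEquiv with hK
  have hK0 : K ≠ 0 := hπ.orderOf_ne_zero
  have h1 (x : 𝔤) (hx : x ∈ H) : killingForm ℂ 𝔤 (toAlg h) x = 0 := by
    have hmem (k : ℕ) : π^[k] x ∈ H := by
      induction k with
      | zero => exact hx
      | succ k ih => rw [Function.iterate_succ_apply']; exact hπ.map_mem ih
    have hk (k : ℕ) : killingForm ℂ 𝔤 (toAlg h) (π^[k] x) = killingForm ℂ 𝔤 (toAlg h) x := by
      induction k with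
      | zero => rfl
      | succ k ih =>
        rw [Function.iterate_succ_apply', ← ih]
        conv_lhs => rw [← map_toAlg h]
        exact LieAlgebra.killingForm_of_equiv_apply π _ _
    have hfix : π (∑ k ∈ Finset.range K, π^[k] x) = ∑ k ∈ Finset.range K, π^[k] x := by
      have h := Finset.sum_range_succ (fun k => π^[k] x) K
      rw [Finset.sum_range_succ', iterate_eq_self hK.symm] at h
      rw [map_sum]
      simpa only [Function.iterate_succ_apply', Function.iterate_zero, id, add_left_inj] using h
    -- An arbitrary `x` in `H` is replaced by the sum of its iterates under `π`: this sum lies in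
    -- `𝔱`, and pairs with the fixed element `h` as `K x` does. Nondegeneracy on the Cartan
    -- subalgebra `H` then finishes.
    have h2 := hh ⟨⟨∑ k ∈ Finset.range K, π^[k] x, hfix⟩,
      show ∑ k ∈ Finset.range K, π^[k] x ∈ H from sum_mem fun k _ => hmem k⟩
    change killingForm ℂ 𝔤 (toAlg h) (∑ k ∈ Finset.range K, π^[k] x) = 0 at h2
    rw [map_sum, Finset.sum_congr rfl fun k _ => hk k, Finset.sum_const, Finset.card_range,
      ← Nat.cast_smul_eq_nsmul ℂ] at h2
    exact (smul_eq_zero.mp h2).resolve_left (Nat.cast_ne_zero.mpr hK0)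
  have h3 : (⟨toAlg h, toAlg_mem h⟩ : H.toSubmodule) ∈
      LinearMap.ker ((killingForm ℂ 𝔤).restrict H.toSubmodule) := by
    rw [LinearMap.mem_ker]
    ext x
    exact h1 x x.2
  rw [LieAlgebra.IsKilling.ker_restrict_eq_bot_of_isCartanSubalgebra, Submodule.mem_bot] at h3
  exact Subtype.ext (Subtype.ext (congrArg (Subtype.val : H.toSubmodule → 𝔤) h3))

/-- Through the Killing form `H_j / ⟨E_j, F_j⟩` represents `ψ_j`, so this is the dual of `∑ a_j ψ_j
= 0`. What matters later is that the coefficients are positive. -/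
lemma sum_labels_h {a : Fin (ℓ + 1) → ℕ} (hπ : IsDiagramAutomorphism b π) (ha : D.IsLabels a) :
    ∑ j, ((a j : ℂ) / killingForm ℂ 𝔤 (D.E j) (D.F j)) • D.h j = 0 := by
  refine eq_zero_of_killingForm_eq_zero hπ fun h => ?_
  rw [LieModule.traceForm_comm]
  have h1 : toAlg (∑ j, ((a j : ℂ) / killingForm ℂ 𝔤 (D.E j) (D.F j)) • D.h j) =
      ∑ j, ((a j : ℂ) / killingForm ℂ 𝔤 (D.E j) (D.F j)) • toAlg (D.h j) := by
    simp [toAlg]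
  rw [h1, map_sum, ← D.sum_labels ha h]
  refine Finset.sum_congr rfl fun j _ => ?_
  obtain ⟨r, hr, hj⟩ := D.killingForm_E_F_pos hπ j
  rw [map_smul, D.form_toAlg_h (LieModule.traceForm_lieInvariant ℂ 𝔤 𝔤), smul_eq_mul, hj]
  have : (r : ℂ) ≠ 0 := by exact_mod_cast hr.ne'
  field_simp

variable {a : Fin (ℓ + 1) → ℕ}

/-- An element of `𝔤` killed by all `E_j` is zero. -/
lemma eq_zero_of_forall_lie_E_eq_zero (hπ : IsDiagramAutomorphism b π) (ha : D.IsLabels a)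
    {y : 𝔤} (hy : ∀ j, ⁅D.E j, y⁆ = 0) : y = 0 := by
  by_contra hy0
  -- The common kernel of the `ad E_j` is stable under the abelian algebra `𝔱`, so if nonzero it
  -- contains a common eigenvector.
  let U : LieSubmodule ℂ (fixedCartan π H) 𝔤 :=
    { carrier := {x | ∀ j, ⁅D.E j, x⁆ = 0}
      add_mem' := fun {x y} hx hy j => by rw [lie_add, hx j, hy j, add_zero]
      zero_mem' := fun j => lie_zero _
      smul_mem' := fun c x hx j => by rw [lie_smul, hx j, smul_zero]
      lie_mem := fun {h x} hx j => by
        change ⁅D.E j, ⁅toAlg h, x⁆⁆ = 0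
        rw [leibniz_lie, hx j, lie_zero, add_zero, ← lie_skew (D.E j) (toAlg h), D.lie_E, neg_lie,
          smul_lie, hx j,
          smul_zero, neg_zero] }
  have hU : Nontrivial U := ⟨⟨y, hy⟩, 0, fun h => hy0 (congrArg Subtype.val h)⟩
  have := D.gen.isLieAbelian_cartan
  obtain ⟨χ, hχ⟩ :=
    LieModule.exists_nontrivial_weightSpace_of_isSolvable ℂ (fixedCartan π H) U
  obtain ⟨⟨⟨z, hz⟩, hzχ⟩, hz0⟩ := exists_ne (0 : LieModule.weightSpace U χ)
  have hz0' : z ≠ 0 := fun h => hz0 (Subtype.ext (Subtype.ext h))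
  have hzw (h : fixedCartan π H) : ⁅toAlg h, z⁆ = χ h • z :=
    congrArg (Subtype.val : U → 𝔤) ((LieModule.mem_weightSpace _ _).mp hzχ h)
  choose n hn using fun j => D.exists_nat_of_lie_E_eq_zero b hz0' (hzw (D.h j)) (hz j)
  choose r hr hEF using fun j => D.killingForm_E_F_pos hπ j
  have hsum : ∑ j, (a j : ℝ) / r j * n j = 0 := by
    have h := congrArg χ (D.sum_labels_h hπ ha)
    simp only [map_sum, map_smul, map_zero, smul_eq_mul, hn, hEF] at h
    exact_mod_cast h
  -- Nonnegative integers annihilated by a combination with positive coefficients: each `H_j` kills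
  -- `z`. Hence each `F_i` with `i ≥ 1` does too, and `z` is centralized by `𝔤_[0]`.
  have hn0 (j : Fin (ℓ + 1)) : n j = 0 := by
    have hpos (j : Fin (ℓ + 1)) : 0 < (a j : ℝ) / r j :=
      div_pos (by exact_mod_cast ha.1 j) (hr j)
    have h := (Finset.sum_eq_zero_iff_of_nonneg fun j _ =>
      mul_nonneg (hpos j).le (Nat.cast_nonneg _)).mp hsum j (Finset.mem_univ j)
    exact_mod_cast (mul_eq_zero.mp h).resolve_left (hpos j).ne'
  refine hz0' (hπ.eq_zero_of_forall_fixed_lie fun x hx =>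
    D.lie_eq_zero_of_forall (fun i => hz _) (fun i => ?_) hx)
  have ht : IsSl2Triple (toAlg (D.h i.succ)) (D.E i.succ) (D.F i.succ) := by
    have h := D.gen.sl2 i
    exact ⟨fun h0 => h.h_ne_zero (Subtype.ext h0), congrArg Subtype.val h.lie_e_f,
      congrArg Subtype.val h.lie_h_e_nsmul, congrArg Subtype.val h.lie_h_f_nsmul⟩
  have hP : ht.HasPrimitiveVectorWith z (0 : ℂ) :=
    ⟨hz0', by rw [hzw, hn, hn0, Nat.cast_zero], hz _⟩
  simpa using hP.pow_toEnd_f_eq_zero_of_eq_nat (n := 0) (by simp)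

/-- The difference of the two sides is killed by every `E_i`. The content is the case `j = 0`, where
the weight of `F₀` is not part of the data. It makes the data symmetric in the `E_j` and `F_j`, so
that statements in nonnegative degrees transfer to negative ones. -/
lemma lie_F (hπ : IsDiagramAutomorphism b π) (ha : D.IsLabels a) (j : Fin (ℓ + 1))
    (h : fixedCartan π H) : ⁅toAlg h, D.F j⁆ = -D.ψ j h • D.F j := by
  rw [neg_smul, eq_neg_iff_add_eq_zero]
  refine D.eq_zero_of_forall_lie_E_eq_zero hπ ha fun i => ?_
  rw [lie_add, lie_smul, leibniz_lie, ← lie_skew (D.E i) (toAlg h), D.lie_E, neg_lie,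
    smul_lie]
  rcases eq_or_ne i j with rfl | hij
  · rw [D.lie_E_F_self, lie_toAlg_toAlg D, add_zero, neg_add_cancel]
  · rw [D.lie_E_F_ne hij, lie_zero, smul_zero, smul_zero, neg_zero, add_zero, add_zero]

/-- Interchanging the roles of the `E_j` and `F_j`. -/
def symm (hπ : IsDiagramAutomorphism b π) (ha : D.IsLabels a) : Generators π ε⁻¹ H ℓ where
  gen := D.gen.symm
  E₀ := D.F₀
  F₀ := D.E₀
  H₀ := -D.H₀
  ψ₀ := -D.ψ₀
  E₀_ne_zero h := by
    have h1 := D.lie_H₀_E₀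
    rw [← D.lie_E₀_F₀, h, lie_zero, zero_lie] at h1
    exact D.E₀_ne_zero ((smul_eq_zero.mp h1.symm).resolve_left two_ne_zero)
  map_E₀ := D.map_F₀
  lie_E₀ := D.lie_F hπ ha 0
  lie_f_E₀ := D.lie_e_F₀
  map_F₀ := by rw [inv_inv]; exact D.map_E₀
  lie_e_F₀ := D.lie_f_E₀
  lie_E₀_F₀ := by rw [← lie_skew, D.lie_E₀_F₀]; rfl
  lie_H₀_E₀ := by
    have h := D.lie_F hπ ha 0 D.H₀
    have h2 : D.ψ 0 D.H₀ = 2 := D.ψ_h_self 0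
    rw [h2, neg_smul] at h
    change ⁅-toAlg D.H₀, D.F₀⁆ = (2 : ℂ) • D.F₀
    rw [neg_lie, neg_eq_iff_eq_neg]
    exact h

lemma symm_h (hπ : IsDiagramAutomorphism b π) (ha : D.IsLabels a) (j : Fin (ℓ + 1)) :
    (D.symm hπ ha).h j = -D.h j := by
  refine Fin.cases ?_ (fun j => ?_) j <;> rfl

lemma symm_ψ (hπ : IsDiagramAutomorphism b π) (ha : D.IsLabels a) (j : Fin (ℓ + 1)) :
    (D.symm hπ ha).ψ j = -D.ψ j := by
  refine Fin.cases ?_ (fun j => ?_) j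
  · rfl
  · exact congrFun D.gen.symm_baseSupp j

lemma isLabels_symm (hπ : IsDiagramAutomorphism b π) (ha : D.IsLabels a) :
    (D.symm hπ ha).IsLabels a := by
  refine ⟨ha.1, ?_, ha.2.2⟩
  have : (D.symm hπ ha).cartan = D.cartan := by
    ext i j
    simp [cartan, symm_h, symm_ψ]
  rw [this, ha.2.1]

end Killing

end Generators

end Toroidal
end

noncomputable section

namespace Toroidal

/-! ### The bigrading by `π` and an integral element, and the automorphism it defines. -/

section Grading

variable {𝔤 : Type*} [LieRing 𝔤] [LieAlgebra ℂ 𝔤]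

lemma map_lie_of_span_eq_top {L : Type*} [LieRing L] [LieAlgebra ℂ L] (T : 𝔤 →ₗ[ℂ] L) {s : Set 𝔤}
    (hs : Submodule.span ℂ s = ⊤) (hT : ∀ x ∈ s, ∀ y ∈ s, T ⁅x, y⁆ = ⁅T x, T y⁆) (x y : 𝔤) :
    T ⁅x, y⁆ = ⁅T x, T y⁆ := by
  have hx : x ∈ Submodule.span ℂ s := hs ▸ Submodule.mem_top
  have hy : y ∈ Submodule.span ℂ s := hs ▸ Submodule.mem_top
  induction hx using Submodule.span_induction with
  | zero => simp
  | add u u' _ _ h h' => simp only [add_lie, map_add, h, h']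
  | smul c u _ h => simp only [smul_lie, map_smul, h]
  | mem u hu =>
    induction hy using Submodule.span_induction with
    | zero => simp
    | add v v' _ _ h h' => simp only [lie_add, map_add, h, h']
    | smul c v _ h => simp only [lie_smul, map_smul, h]
    | mem v hv => exact hT u hu v hv

lemma lie_eigen {π : 𝔤 ≃ₗ⁅ℂ⁆ 𝔤} {ε : ℂ} (hε : ε ≠ 0) {p q : ℤ} {x y : 𝔤} (hx : π x = ε ^ p • x)
    (hy : π y = ε ^ q • y) : π ⁅x, y⁆ = ε ^ (p + q) • ⁅x, y⁆ := by
  rw [LieEquiv.map_lie, hx, hy, smul_lie, lie_smul, smul_smul, zpow_add₀ hε]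

/-- The vectors homogeneous both for an automorphism and for an integral element fixed by it span
the algebra. -/
lemma span_homogeneous_eq_top {π : 𝔤 ≃ₗ⁅ℂ⁆ 𝔤} {K : ℕ} (hK0 : K ≠ 0)
    (hK : orderOf π.toLinearEquiv = K) {ε : ℂ} (hε : IsPrimitiveRoot ε K) {r : 𝔤}
    (hr : IsIntegral r) (hπr : π r = r) :
    Submodule.span ℂ {x : 𝔤 | (∃ p : ℤ, π x = ε ^ p • x) ∧ ∃ n : ℤ, ⁅r, x⁆ = (n : ℂ) • x} = ⊤ := by
  rw [eq_top_iff, ← hr]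
  refine Submodule.span_le.mpr fun x ⟨n, hn⟩ => ?_
  have h := exists_zpow_smul_of_pow_eq_one hK0 hK hε
    (U := Module.End.eigenspace (LieAlgebra.ad ℂ 𝔤 r) n) (fun y hy => ?_)
    (x := x) (Module.End.mem_eigenspace_iff.mpr hn)
  · refine Submodule.span_mono (s := {y ∈ Module.End.eigenspace (LieAlgebra.ad ℂ 𝔤 r) (n : ℂ) |
      ∃ p : ℤ, π y = ε ^ p • y}) ?_ h
    exact fun y hy => ⟨hy.2, n, Module.End.mem_eigenspace_iff.mp hy.1⟩
  · have hy' : ⁅r, y⁆ = (n : ℂ) • y := Module.End.mem_eigenspace_iff.mp hy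
    refine Module.End.mem_eigenspace_iff.mpr ?_
    rw [LieAlgebra.ad_apply, ← map_smul, ← hy', LieEquiv.map_lie, hπr]

/-- Each coordinate functional is an eigenvector of the transpose of `f`, so only basis vectors with
eigenvalue `c` enter the expansion of `x`. -/
lemma eq_of_repr_ne_zero {V κ : Type*} [AddCommGroup V] [Module ℂ V] (v : Module.Basis κ ℂ V)
    {f : V →ₗ[ℂ] V} {χ : κ → ℂ} (hf : ∀ k, f (v k) = χ k • v k) {x : V} {c : ℂ} (hx : f x = c • x)
    {k : κ} (hk : v.repr x k ≠ 0) : χ k = c := by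
  have h : v.coord k ∘ₗ f = χ k • v.coord k := by
    refine v.ext fun j => ?_
    rw [LinearMap.comp_apply, hf j, map_smul, LinearMap.smul_apply]
    by_cases hj : j = k
    · rw [hj]
    · simp [Finsupp.single_eq_of_ne (Ne.symm hj)]
  have h2 := congrArg (fun g => g x) h
  simp only [LinearMap.comp_apply, hx, map_smul, LinearMap.smul_apply, smul_eq_mul,
    Module.Basis.coord_apply] at h2
  exact (mul_right_cancel₀ hk h2).symm

lemma apply_eq_smul_of_repr {V κ : Type*} [AddCommGroup V] [Module ℂ V] (v : Module.Basis κ ℂ V)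
    {T : V →ₗ[ℂ] V} {χ : κ → ℂ} (hT : ∀ k, T (v k) = χ k • v k) {x : V} {c : ℂ}
    (hx : ∀ k, v.repr x k ≠ 0 → χ k = c) : T x = c • x := by
  rw [← v.linearCombination_repr x, Finsupp.linearCombination_apply, Finsupp.sum, map_sum,
    Finset.smul_sum]
  refine Finset.sum_congr rfl fun k hk => ?_
  rw [map_smul, hT, hx k (Finsupp.mem_support_iff.mp hk), smul_comm]

/-- The automorphism acting by `w ^ (p * M + n)` on the vectors of degree `p` for `π` and of degree
`n` for `ad r`. -/
lemma exists_principal {π : 𝔤 ≃ₗ⁅ℂ⁆ 𝔤} {K : ℕ} (hK0 : K ≠ 0)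
    (hK : orderOf π.toLinearEquiv = K) {ε : ℂ} (hε : IsPrimitiveRoot ε K) {r : 𝔤}
    (hr : IsIntegral r) (hπr : π r = r) {M : ℕ} {w : ℂ} (hw0 : w ≠ 0) (hw : w ^ (K * M) = 1) :
    ∃ θ : 𝔤 ≃ₗ⁅ℂ⁆ 𝔤, ∀ (p n : ℤ) (x : 𝔤), π x = ε ^ p • x → ⁅r, x⁆ = (n : ℂ) • x →
      θ x = w ^ (p * M + n) • x := by
  have hε0 : ε ≠ 0 := hε.ne_zero hK0
  have htop := span_homogeneous_eq_top hK0 hK hε hr hπr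
  obtain ⟨t, hts, hspan, hli⟩ := exists_linearIndependent ℂ
    {x : 𝔤 | (∃ p : ℤ, π x = ε ^ p • x) ∧ ∃ n : ℤ, ⁅r, x⁆ = (n : ℂ) • x}
  let v : Module.Basis t ℂ 𝔤 := Module.Basis.mk hli (by rw [Subtype.range_coe, hspan, htop])
  have hv (k : t) : v k = k := by simp [v]
  choose q hq using fun k : t => (hts k.2).1
  choose d hd using fun k : t => (hts k.2).2
  -- The scalar depends on `p` only modulo `K`, because `u ^ (K * M) = 1`. Taking `u = w` and `u =
  -- w⁻¹` produces mutually inverse maps.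
  have hT (u : ℂ) (hu0 : u ≠ 0) (hu : u ^ (K * M) = 1) : ∃ T : 𝔤 →ₗ[ℂ] 𝔤, ∀ (p n : ℤ) (x : 𝔤),
      π x = ε ^ p • x → ⁅r, x⁆ = (n : ℂ) • x → T x = u ^ (p * M + n) • x := by
    refine ⟨v.constr ℂ fun k => u ^ (q k * M + d k) • v k, fun p n x hx hx' => ?_⟩
    refine apply_eq_smul_of_repr v (χ := fun k => u ^ (q k * M + d k))
      (fun k => v.constr_basis _ _ _) fun k hk => ?_
    have h1 : (d k : ℂ) = n := eq_of_repr_ne_zero v (f := (LieAlgebra.ad ℂ 𝔤 r : 𝔤 →ₗ[ℂ] 𝔤))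
      (χ := fun k => (d k : ℂ)) (fun k => by rw [hv]; exact hd k) hx' hk
    have h2 : ε ^ q k = ε ^ p := eq_of_repr_ne_zero v (f := (π : 𝔤 →ₗ[ℂ] 𝔤))
      (χ := fun k => ε ^ q k) (fun k => by rw [hv]; exact hq k) hx hk
    have h3 : (K : ℤ) ∣ q k - p := by
      rw [← hε.zpow_eq_one_iff_dvd, zpow_sub₀ hε0, h2, div_self (zpow_ne_zero _ hε0)]
    obtain ⟨e, he⟩ := h3
    rw [Int.cast_injective h1, show q k = p + K * e by linarith, add_mul, add_right_comm,
      zpow_add₀ hu0 (_ + _), mul_right_comm, zpow_mul, ← Nat.cast_mul, zpow_natCast, hu, one_zpow,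
      mul_one]
  obtain ⟨T, hTw⟩ := hT w hw0 hw
  obtain ⟨T', hTw'⟩ := hT w⁻¹ (inv_ne_zero hw0) (by rw [inv_pow, hw, inv_one])
  have hlie : ∀ x y, T ⁅x, y⁆ = ⁅T x, T y⁆ := by
    refine map_lie_of_span_eq_top T htop ?_
    rintro x ⟨⟨p, hp⟩, n, hn⟩ y ⟨⟨q, hq⟩, k, hk⟩
    rw [hTw _ _ _ hp hn, hTw _ _ _ hq hk, smul_lie, lie_smul, smul_smul, ← zpow_add₀ hw0]
    rw [hTw (p + q) (n + k) _ (lie_eigen hε0 hp hq)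
      (by rw [lie_lie_eq_smul hn hk]; push_cast; rfl)]
    congr 2
    ring
  have hinv : T' ∘ₗ T = LinearMap.id := by
    refine LinearMap.ext_on htop ?_
    rintro x ⟨⟨p, hp⟩, n, hn⟩
    rw [LinearMap.comp_apply, hTw _ _ _ hp hn, map_smul, hTw' _ _ _ hp hn, smul_smul, inv_zpow,
      mul_inv_cancel₀ (zpow_ne_zero _ hw0), one_smul]; rfl
  have hinv' : T ∘ₗ T' = LinearMap.id := by
    refine LinearMap.ext_on htop ?_
    rintro x ⟨⟨p, hp⟩, n, hn⟩
    rw [LinearMap.comp_apply, hTw' _ _ _ hp hn, map_smul, hTw _ _ _ hp hn, smul_smul, inv_zpow,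
      inv_mul_cancel₀ (zpow_ne_zero _ hw0), one_smul]; rfl
  exact ⟨{ T with
    map_lie' := fun {x y} => hlie x y
    invFun := T'
    left_inv := fun x => congrArg (fun f => f x) hinv
    right_inv := fun x => congrArg (fun f => f x) hinv' }, hTw⟩

end Grading

/-! ### Generation by the `E_j`, `F_j` in `ℤ`-graded form, and uniqueness of the principal
automorphism. -/

namespace Generators

variable {𝔤 : Type*} [LieRing 𝔤] [LieAlgebra ℂ 𝔤] {π : 𝔤 ≃ₗ⁅ℂ⁆ 𝔤}

/-- The Killing form against a vector is represented on an eigenspace of `π` by a vector of the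
opposite eigenspace. -/
lemma exists_killingForm_eq {K : ℕ} (hK0 : K ≠ 0) (hK : orderOf π.toLinearEquiv = K) {ε : ℂ}
    (hε : IsPrimitiveRoot ε K) (y : 𝔤) (p : ℤ) :
    ∃ y' : 𝔤, π y' = ε ^ (-p) • y' ∧
      ∀ x, π x = ε ^ p • x → killingForm ℂ 𝔤 y' x = killingForm ℂ 𝔤 y x := by
  have hε0 : ε ≠ 0 := hε.ne_zero hK0
  have hεK : (ε ^ p) ^ K = 1 := by
    rw [← zpow_natCast, ← zpow_mul, mul_comm, zpow_mul, zpow_natCast, hε.pow_eq_one, one_zpow]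
  have hεp : ε ^ p ≠ 0 := zpow_ne_zero _ hε0
  -- The average of the `g k` is the projection of `y` to the `ε ^ (-p)`-eigenspace; each `g k`
  -- pairs with `x` exactly as `y` does.
  let g (k : ℕ) : 𝔤 := (ε ^ p) ^ k • π^[k] y
  have hg (k : ℕ) : g (k + 1) = ε ^ p • π (g k) := by
    simp only [g, map_smul, smul_smul, Function.iterate_succ_apply', pow_succ']
  refine ⟨(K : ℂ)⁻¹ • ∑ k ∈ Finset.range K, g k, ?_, fun x hx => ?_⟩
  · have h := Finset.sum_range_succ g K
    rw [Finset.sum_range_succ', show g K = g 0 by simp [g, hεK, iterate_eq_self hK],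
      add_left_inj] at h
    rw [map_smul, smul_comm, zpow_neg, map_sum]
    simp only [hg, ← Finset.smul_sum] at h
    rw [← h, inv_smul_smul₀ hεp]
  · have hk (k : ℕ) : killingForm ℂ 𝔤 (g k) x = killingForm ℂ 𝔤 y x := by
      induction k with
      | zero => simp [g]
      | succ k ih =>
        rw [← ih, hg, map_smul, LinearMap.smul_apply, ← map_smul, ← hx]
        exact LieAlgebra.killingForm_of_equiv_apply π _ _
    rw [map_smul, LinearMap.smul_apply, map_sum, LinearMap.sum_apply,
      Finset.sum_congr rfl fun k _ => hk k, Finset.sum_const, Finset.card_range,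
      ← Nat.cast_smul_eq_nsmul ℂ, smul_smul, inv_mul_cancel₀ (by exact_mod_cast hK0), one_smul]

variable [FiniteDimensional ℂ 𝔤] {ε : ℂ} {H : LieSubalgebra ℂ 𝔤} {ℓ : ℕ} (D : Generators π ε H ℓ)

/-- A nonzero subspace stable under `𝔤_[0]` contains a nonzero vector killed by `E₁, …, E_ℓ`. -/
lemma exists_forall_lie_E_succ_eq_zero {U : Submodule ℂ 𝔤} (hU0 : U ≠ ⊥)
    (hU : ∀ x : 𝔤, π x = x → ∀ u ∈ U, ⁅x, u⁆ ∈ U) :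
    ∃ u ∈ U, u ≠ 0 ∧ ∀ i : Fin ℓ, ⁅D.E i.succ, u⁆ = 0 := by
  obtain ⟨r, hr⟩ := D.exists_ψ_eq (fun _ => 1)
  have hmap : ∀ u ∈ U, LieAlgebra.ad ℂ 𝔤 (toAlg r) u ∈ U := hU _ (map_toAlg r)
  let f : Module.End ℂ U := LinearMap.restrict (LieAlgebra.ad ℂ 𝔤 (toAlg r) : 𝔤 →ₗ[ℂ] 𝔤) hmap
  have : Nontrivial U := Submodule.nontrivial_iff_ne_bot.mpr hU0
  have hne : {c : ℂ | f.HasEigenvalue c}.Nonempty := Module.End.exists_eigenvalue f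
  -- An eigenvalue of maximal real part: each `E_i` with `i ≥ 1` would raise it by `1`.
  obtain ⟨c, hc, hmax⟩ := Set.exists_max_image {c : ℂ | f.HasEigenvalue c} Complex.re
    (Module.End.finite_hasEigenvalue f) hne
  obtain ⟨u, hu, hu0⟩ := hc.exists_hasEigenvector
  have hu' : ⁅toAlg r, (u : 𝔤)⁆ = c • (u : 𝔤) :=
    congrArg Subtype.val (Module.End.mem_eigenspace_iff.mp hu)
  refine ⟨u, u.2, fun h => hu0 (Subtype.ext h), fun i => ?_⟩
  by_contra hne
  have h1 : ⁅toAlg r, ⁅D.E i.succ, (u : 𝔤)⁆⁆ = (1 + c) • ⁅D.E i.succ, (u : 𝔤)⁆ :=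
    lie_lie_eq_smul (by rw [D.lie_E, hr]) hu'
  have h2 : f.HasEigenvalue (1 + c) := by
    refine Module.End.hasEigenvalue_of_hasEigenvector
      (x := ⟨⁅D.E i.succ, (u : 𝔤)⁆, hU _ (D.map_E_succ i) u u.2⟩) ⟨?_, ?_⟩
    · exact Module.End.mem_eigenspace_iff.mpr (Subtype.ext h1)
    · exact fun h => hne (congrArg Subtype.val h)
  have := hmax _ h2
  simp at this
  linarith

variable [LieAlgebra.IsSimple ℂ 𝔤]
  {ι : Type*} [Finite ι] {b : LieAlgebra.Basis ι H} {a : Fin (ℓ + 1) → ℕ} {K : ℕ}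

/-- If `S (n + 1)` were smaller than `𝔤_[n+1]`, its annihilator in `𝔤_[-(n+1)]` under the Killing
form would be nonzero and `𝔤_[0]`-stable, hence contain `u ≠ 0` killed by `E₁, …, E_ℓ`. As `[E₀, S
n] ⊆ S (n + 1)` and `S n = 𝔤_[n]` by induction, `[E₀, u]` is orthogonal to `𝔤_[n]`, hence zero: a
nonzero vector killed by all the `E_j`. The family `S` need not be assumed periodic in its index. -/
lemma mem_of_graded_nonneg (hπ : IsDiagramAutomorphism b π) (ha : D.IsLabels a) (hK0 : K ≠ 0)
    (hK : orderOf π.toLinearEquiv = K) (hε : IsPrimitiveRoot ε K) {S : ℤ → Submodule ℂ 𝔤}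
    (hS : ∀ j, ∀ x ∈ S j, π x = ε ^ j • x)
    (hlie : ∀ i j, ∀ x ∈ S i, ∀ y ∈ S j, ⁅x, y⁆ ∈ S (i + j)) (h0 : ∀ x, π x = x → x ∈ S 0)
    (hE : D.E 0 ∈ S 1) (n : ℕ) {x : 𝔤} (hx : π x = ε ^ (n : ℤ) • x) : x ∈ S n := by
  have hε0 : ε ≠ 0 := hε.ne_zero hK0
  have hκ := LieAlgebra.IsKilling.killingForm_nondegenerate ℂ 𝔤
  have hinv (x y z : 𝔤) : killingForm ℂ 𝔤 ⁅x, y⁆ z = -killingForm ℂ 𝔤 y ⁅x, z⁆ :=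
    LieModule.traceForm_apply_lie_apply' ℂ 𝔤 𝔤 x y z
  induction n generalizing x with
  | zero => exact h0 x (by simpa using hx)
  | succ n ih =>
    by_contra hxS
    obtain ⟨φ, hφx, hφS⟩ := Submodule.exists_dual_map_eq_bot_of_notMem hxS inferInstance
    let y := ((killingForm ℂ 𝔤).toDual hκ).symm φ
    have hy (z : 𝔤) : killingForm ℂ 𝔤 y z = φ z :=
      LinearMap.BilinForm.apply_toDual_symm_apply (hB := hκ) φ z
    obtain ⟨y', hy'π, hy'⟩ := exists_killingForm_eq hK0 hK hε y ((n + 1 : ℕ) : ℤ)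
    let U : Submodule ℂ 𝔤 :=
      { carrier := {u | π u = ε ^ (-((n + 1 : ℕ) : ℤ)) • u ∧
          ∀ s ∈ S ((n + 1 : ℕ) : ℤ), killingForm ℂ 𝔤 u s = 0}
        add_mem' := fun {u v} hu hv => ⟨by rw [map_add, hu.1, hv.1, smul_add], fun s hs => by
          rw [map_add, LinearMap.add_apply, hu.2 s hs, hv.2 s hs, add_zero]⟩
        zero_mem' := ⟨by simp, fun s _ => by simp⟩
        smul_mem' := fun c u hu => ⟨by rw [map_smul, hu.1, smul_comm], fun s hs => by
          rw [map_smul, LinearMap.smul_apply, hu.2 s hs, smul_zero]⟩ }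
    have hyU : y' ∈ U := ⟨hy'π, fun s hs => by
      rw [hy' s (hS _ s hs), hy]
      have : φ s ∈ Submodule.map φ (S ((n + 1 : ℕ) : ℤ)) := ⟨s, hs, rfl⟩
      rwa [hφS, Submodule.mem_bot] at this⟩
    have hy'0 : y' ≠ 0 := by
      rintro rfl
      have := hy' x hx
      rw [hy, map_zero, LinearMap.zero_apply] at this
      exact hφx this.symm
    obtain ⟨u, hu, hu0, huE⟩ := D.exists_forall_lie_E_succ_eq_zero (U := U)
      (fun h => hy'0 (by rw [h] at hyU; exact hyU)) (fun z hz u hu => by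
        refine ⟨by rw [LieEquiv.map_lie, hz, hu.1, lie_smul], fun s hs => ?_⟩
        rw [hinv, hu.2 _ (by simpa using hlie 0 _ z (h0 z hz) s hs), neg_zero])
    refine hu0 (D.eq_zero_of_forall_lie_E_eq_zero hπ ha (Fin.cases ?_ huE))
    have hz : π ⁅D.E 0, u⁆ = ε ^ (-(n : ℤ)) • ⁅D.E 0, u⁆ := by
      rw [lie_eigen hε0 (p := 1) (hS 1 _ hE) hu.1]
      congr 2
      push_cast
      ring
    refine LinearMap.separatingLeft_iff_ker_eq_bot.mp hκ.1 |>.le (LinearMap.mem_ker.mpr ?_)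
    ext z
    rw [LinearMap.zero_apply, LieModule.traceForm_comm]
    obtain ⟨z', hz'π, hz'⟩ := exists_killingForm_eq hK0 hK hε z (-(n : ℤ))
    rw [← hz' _ hz, LieModule.traceForm_comm]
    rw [neg_neg] at hz'π
    have h1 := hlie 1 n _ hE _ (ih hz'π)
    exact (hinv _ _ _).trans (by
      rw [hu.2 _ (by convert h1 using 2; push_cast; ring), neg_zero])

/-- The Lie algebra graded by the eigenspaces of `π` is generated by `E_j, F_j`. -/
lemma mem_of_graded (hπ : IsDiagramAutomorphism b π) (ha : D.IsLabels a) (hK0 : K ≠ 0)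
    (hK : orderOf π.toLinearEquiv = K) (hε : IsPrimitiveRoot ε K) {S : ℤ → Submodule ℂ 𝔤}
    (hS : ∀ j, ∀ x ∈ S j, π x = ε ^ j • x)
    (hlie : ∀ i j, ∀ x ∈ S i, ∀ y ∈ S j, ⁅x, y⁆ ∈ S (i + j))
    (hE : ∀ i : Fin ℓ, D.E i.succ ∈ S 0) (hF : ∀ i : Fin ℓ, D.F i.succ ∈ S 0)
    (hE0 : D.E 0 ∈ S 1) (hF0 : D.F 0 ∈ S (-1)) {j : ℤ} {x : 𝔤} (hx : π x = ε ^ j • x) :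
    x ∈ S j := by
  have h0 : ∀ x, π x = x → x ∈ S 0 := fun x hx => by
    have h : (⟨x, hx⟩ : fixedSub π) ∈ LieSubalgebra.lieSpan ℂ (fixedSub π)
        (Set.range D.gen.e ∪ Set.range D.gen.f) := D.gen.span_ef ▸ LieSubalgebra.mem_top _
    change ((⟨x, hx⟩ : fixedSub π) : 𝔤) ∈ S 0
    generalize (⟨x, hx⟩ : fixedSub π) = x' at h
    induction h using LieSubalgebra.lieSpan_induction with
    | mem x hx =>
      obtain ⟨i, rfl⟩ | ⟨i, rfl⟩ := hx
      · exact hE i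
      · exact hF i
    | zero => exact zero_mem _
    | add u v _ _ hu hv => exact add_mem hu hv
    | smul c u _ hu => exact Submodule.smul_mem _ c hu
    | lie u v _ _ hu hv => simpa using hlie 0 0 _ hu _ hv
  obtain ⟨n, rfl | rfl⟩ := j.eq_nat_or_neg
  · exact D.mem_of_graded_nonneg hπ ha hK0 hK hε hS hlie h0 hE0 n hx
  · refine (D.symm hπ ha).mem_of_graded_nonneg hπ (D.isLabels_symm hπ ha) hK0 hK hε.inv
      (S := fun j => S (-j)) (fun j x hx => ?_) (fun i j x hx y hy => ?_) h0 hF0 n ?_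
    · rw [hS _ x hx, inv_zpow']
    · rw [neg_add]; exact hlie _ _ x hx y hy
    · rw [hx, inv_zpow']

/-- A principal automorphism is determined by its values on the `H_j` and `E_j`. -/
lemma IsPrincipal.eq (hπ : IsDiagramAutomorphism b π) (ha : D.IsLabels a) (hK0 : K ≠ 0)
    (hK : orderOf π.toLinearEquiv = K) (hε : IsPrimitiveRoot ε K) {w : ℂ}
    {θ θ' : 𝔤 ≃ₗ⁅ℂ⁆ 𝔤} (hθ : D.IsPrincipal w θ) (hθ' : D.IsPrincipal w θ') : θ' = θ := by
  let η : 𝔤 ≃ₗ⁅ℂ⁆ 𝔤 := θ'.trans θ.symm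
  have hη (x : 𝔤) : η x = x ↔ θ' x = θ x := by
    change θ.symm (θ' x) = x ↔ _
    constructor
    · intro h; rw [← h, LieEquiv.apply_symm_apply, h]
    · intro h; rw [h, LieEquiv.symm_apply_apply]
  have hE (j : Fin (ℓ + 1)) : η (D.E j) = D.E j := by rw [hη, (hθ' j).2, (hθ j).2]
  have hH (j : Fin (ℓ + 1)) : η (toAlg (D.h j)) = toAlg (D.h j) := by
    rw [hη, (hθ' j).1, (hθ j).1]
  have hF (j : Fin (ℓ + 1)) : η (D.F j) = D.F j := by
    rw [← sub_eq_zero]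
    refine D.eq_zero_of_forall_lie_E_eq_zero hπ ha fun i => ?_
    rw [lie_sub, sub_eq_zero]
    conv_lhs => rw [← hE i]
    rw [← LieEquiv.map_lie]
    rcases eq_or_ne i j with rfl | hij
    · rw [D.lie_E_F_self, hH]
    · rw [D.lie_E_F_ne hij, map_zero]
  -- The fixed vectors of `η` in each `𝔤_[j]`; they contain the generators, so they exhaust `𝔤_[j]`.
  let S (j : ℤ) : Submodule ℂ 𝔤 :=
    { carrier := {x | π x = ε ^ j • x ∧ η x = x}
      add_mem' := fun {x y} hx hy =>
        ⟨by rw [map_add, hx.1, hy.1, smul_add], by rw [map_add, hx.2, hy.2]⟩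
      zero_mem' := ⟨by simp, by simp⟩
      smul_mem' := fun c x hx =>
        ⟨by rw [map_smul, hx.1, smul_comm], by rw [map_smul, hx.2]⟩ }
  have hmem (j : ℤ) (x : 𝔤) (hx : π x = ε ^ j • x) : x ∈ S j :=
    D.mem_of_graded hπ ha hK0 hK hε (S := S) (fun j x hx => hx.1)
      (fun i j x hx y hy => ⟨lie_eigen (hε.ne_zero hK0) hx.1 hy.1, by
        rw [LieEquiv.map_lie, hx.2, hy.2]⟩)
      (fun i => ⟨by simpa using D.map_E_succ i, hE _⟩)
      (fun i => ⟨by simpa using D.map_F_succ i, hF _⟩)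
      ⟨by rw [zpow_one]; exact D.map_E₀, hE 0⟩ ⟨by rw [zpow_neg_one]; exact D.map_F₀, hF 0⟩ hx
  have hspan (x : 𝔤) : x ∈ Submodule.span ℂ {y ∈ (⊤ : Submodule ℂ 𝔤) | ∃ p : ℤ, π y = ε ^ p • y} :=
    exists_zpow_smul_of_pow_eq_one hK0 hK hε (fun _ _ => Submodule.mem_top) Submodule.mem_top
  ext x
  rw [← hη]
  induction hspan x using Submodule.span_induction with
  | mem x hx => exact (hmem _ x hx.2.choose_spec).2
  | zero => exact map_zero _
  | add u v _ _ hu hv => rw [map_add, hu, hv]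
  | smul c u _ hu => rw [map_smul, hu]

end Generators

end Toroidal
end

noncomputable section

namespace Toroidal

/-! ### Rescaling the exponents of `t`, on Laurent polynomials and on centres. -/

section Shift

variable {N : ℕ}

/-- The linear map `t^{r₀} t^r ↦ t^{r₀ M + n} t^r`. -/
def shiftMap (N M : ℕ) (n : ℤ) : LaurentRing N →ₗ[ℂ] LaurentRing N :=
  (AddMonoidAlgebra.basis (Expo N) ℂ).constr ℂ fun e => mono (e.1 * M + n, e.2)

/-- The left inverse of `shiftMap` which kills the monomials outside its image. -/
def unshiftMap (N M : ℕ) (n : ℤ) : LaurentRing N →ₗ[ℂ] LaurentRing N :=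
  (AddMonoidAlgebra.basis (Expo N) ℂ).constr ℂ fun e =>
    if (M : ℤ) ∣ e.1 - n then mono ((e.1 - n) / M, e.2) else 0

lemma shiftMap_mono (M : ℕ) (n : ℤ) (e : Expo N) :
    shiftMap N M n (mono e) = mono (e.1 * M + n, e.2) := by
  have := (AddMonoidAlgebra.basis (Expo N) ℂ).constr_basis ℂ
    (fun e : Expo N => (mono (e.1 * M + n, e.2) : LaurentRing N)) e
  simpa [AddMonoidAlgebra.basis_apply, shiftMap] using this

lemma unshiftMap_mono (M : ℕ) (n : ℤ) (e : Expo N) :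
    unshiftMap N M n (mono e) =
      if (M : ℤ) ∣ e.1 - n then mono ((e.1 - n) / M, e.2) else 0 := by
  have := (AddMonoidAlgebra.basis (Expo N) ℂ).constr_basis ℂ
    (fun e : Expo N => if (M : ℤ) ∣ e.1 - n then
      (mono ((e.1 - n) / M, e.2) : LaurentRing N) else 0) e
  simpa only [AddMonoidAlgebra.basis_apply, unshiftMap] using this

lemma laurent_ext {V : Type*} [AddCommGroup V] [Module ℂ V] {f g : LaurentRing N →ₗ[ℂ] V}
    (h : ∀ e, f (mono e) = g (mono e)) : f = g :=
  (AddMonoidAlgebra.basis (Expo N) ℂ).ext fun e => by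
    simpa [AddMonoidAlgebra.basis_apply] using h e

lemma unshiftMap_comp_shiftMap {M : ℕ} (hM : M ≠ 0) (n : ℤ) :
    unshiftMap N M n ∘ₗ shiftMap N M n = LinearMap.id := by
  refine laurent_ext fun e => ?_
  have hM' : (M : ℤ) ≠ 0 := by exact_mod_cast hM
  rw [LinearMap.comp_apply, shiftMap_mono, unshiftMap_mono, LinearMap.id_apply,
    add_sub_cancel_right, if_pos (dvd_mul_left _ _), Int.mul_ediv_cancel _ hM']

variable {K M : ℕ}

/-- The coefficient of `k₀` is preserved because `r₀ M / (K M) = r₀ / K`; this is why the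
denominators in the two cocycles are the orders `K` and `K M`. -/
lemma map_exactForms_le (hM : M ≠ 0) : exactForms K N ≤
    (exactForms (K * M) N).comap (LinearMap.compLeft (shiftMap N M 0) (Fin (N + 1))) := by
  refine Submodule.span_le.mpr ?_
  rintro - ⟨e, rfl⟩
  refine Submodule.subset_span ⟨(e.1 * M, e.2), ?_⟩
  have hM' : (M : ℂ) ≠ 0 := by exact_mod_cast hM
  ext1 i
  simp only [LinearMap.compLeft_apply, Function.comp_apply, map_smul, shiftMap_mono, add_zero]
  congr 1
  refine Fin.cases ?_ (fun i => ?_) i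
  · simp only [weight, Fin.cons_zero]
    push_cast
    rw [mul_div_mul_right _ _ hM']
  · simp [weight]

/-- Needed for injectivity on centres: it lets the left inverse `unshiftMap` descend to the
quotients. Relations in degrees not divisible by `M` go to zero. -/
lemma map_exactForms_le' (hM : M ≠ 0) : exactForms (K * M) N ≤
    (exactForms K N).comap (LinearMap.compLeft (unshiftMap N M 0) (Fin (N + 1))) := by
  refine Submodule.span_le.mpr ?_
  rintro - ⟨e, rfl⟩
  have hM' : (M : ℂ) ≠ 0 := by exact_mod_cast hM
  change (LinearMap.compLeft (unshiftMap N M 0) (Fin (N + 1))) _ ∈ exactForms K N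
  by_cases hd : (M : ℤ) ∣ e.1
  · obtain ⟨q, hq⟩ := hd
    have hM'' : (M : ℤ) ≠ 0 := by exact_mod_cast hM
    refine Submodule.subset_span ⟨(q, e.2), ?_⟩
    ext1 i
    simp only [LinearMap.compLeft_apply, Function.comp_apply, map_smul, unshiftMap_mono, sub_zero,
      hq, dvd_mul_right, if_true, Int.mul_ediv_cancel_left _ hM'']
    congr 1
    refine Fin.cases ?_ (fun i => ?_) i
    · simp only [weight, Fin.cons_zero, hq]
      push_cast
      rw [mul_comm (K : ℂ), mul_div_mul_left _ _ hM']
    · simp [weight]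
  · convert zero_mem (exactForms K N)
    ext1 i
    simp only [LinearMap.compLeft_apply, Function.comp_apply, map_smul, unshiftMap_mono, sub_zero,
      hd, if_false, smul_zero, Pi.zero_apply]

/-- The linear map of centres `t^{r₀} t^r k_i ↦ t^{r₀ M} t^r k_i`. -/
def centerMap (N K : ℕ) {M : ℕ} (hM : M ≠ 0) : Center K N →ₗ[ℂ] Center (K * M) N :=
  Submodule.mapQ _ _ _ (map_exactForms_le hM)

lemma centerMap_mkQ (hM : M ≠ 0) (i : Fin (N + 1)) (e : Expo N) :
    centerMap N K hM ((exactForms K N).mkQ (Pi.single i (mono e))) =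
      (exactForms (K * M) N).mkQ (Pi.single i (mono (e.1 * M, e.2))) := by
  rw [centerMap, Submodule.mkQ_apply, Submodule.mapQ_apply, Submodule.mkQ_apply]
  congr 1
  ext1 j
  rw [LinearMap.compLeft_apply, Function.comp_apply]
  by_cases hj : j = i
  · subst hj
    rw [Pi.single_eq_same, Pi.single_eq_same, shiftMap_mono, add_zero]
  · rw [Pi.single_eq_of_ne hj, Pi.single_eq_of_ne hj, map_zero]

lemma centerMap_injective (hM : M ≠ 0) : Function.Injective (centerMap N K hM) := by
  refine Function.LeftInverse.injective
    (g := Submodule.mapQ _ _ _ (map_exactForms_le' (K := K) (N := N) hM)) fun c => ?_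
  obtain ⟨c, rfl⟩ := Submodule.Quotient.mk_surjective _ c
  rw [centerMap, Submodule.mapQ_apply, Submodule.mapQ_apply]
  congr 1
  ext1 i
  exact congrArg (fun f => f (c i)) (unshiftMap_comp_shiftMap hM 0)

end Shift

/-! ### The homomorphism of toroidal algebras and its effect on twisted subalgebras. -/

section Hom

variable {𝔤 : Type*} [LieRing 𝔤] [LieAlgebra ℂ 𝔤]

/-- The regrading `x t^{r₀} t^r ↦ x t^{r₀ M + n} t^r`, for `x` of degree `n`. -/
lemma exists_regrading [FiniteDimensional ℂ 𝔤] (N : ℕ) {M : ℕ} (hM : M ≠ 0) {r : 𝔤}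
    (hr : IsIntegral r) :
    ∃ T : LaurentRing N ⊗[ℂ] 𝔤 →ₗ[ℂ] LaurentRing N ⊗[ℂ] 𝔤, Function.Injective T ∧
      ∀ (n : ℤ) (x : 𝔤) (e : Expo N), ⁅r, x⁆ = (n : ℂ) • x →
        T (mono e ⊗ₜ x) = mono (e.1 * M + n, e.2) ⊗ₜ x := by
  obtain ⟨t, hts, hspan, hli⟩ := exists_linearIndependent ℂ {x : 𝔤 | ∃ n : ℤ, ⁅r, x⁆ = (n : ℂ) • x}
  let v : Module.Basis t ℂ 𝔤 := Module.Basis.mk hli (by rw [Subtype.range_coe, hspan, hr])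
  have hv (k : t) : v k = k := by simp [v]
  choose d hd using fun k : t => hts k.2
  have : Fintype t := FiniteDimensional.fintypeBasisIndex v
  let P (k : t) : 𝔤 →ₗ[ℂ] 𝔤 := (v.coord k).smulRight (v k)
  have hP (k : t) (x : 𝔤) : P k x = v.repr x k • v k := rfl
  -- Each vector `v k` of an eigenbasis has its own degree `d k`, and its coefficient is moved by `S
  -- (d k)`. With `S` the shifts this is the regrading; with the unshifts, a left inverse.
  let T (S : ℤ → LaurentRing N →ₗ[ℂ] LaurentRing N) :
      LaurentRing N ⊗[ℂ] 𝔤 →ₗ[ℂ] LaurentRing N ⊗[ℂ] 𝔤 :=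
    ∑ k, TensorProduct.map (S (d k)) (P k)
  have hT (S : ℤ → LaurentRing N →ₗ[ℂ] LaurentRing N) (a : LaurentRing N) {x : 𝔤} {n : ℤ}
      (hx : ⁅r, x⁆ = (n : ℂ) • x) : T S (a ⊗ₜ x) = S n a ⊗ₜ x := by
    have h1 (k : t) : S (d k) a ⊗ₜ[ℂ] P k x = S n a ⊗ₜ (v.repr x k • v k) := by
      rw [hP]
      by_cases hk : v.repr x k = 0
      · rw [hk, zero_smul, TensorProduct.tmul_zero, TensorProduct.tmul_zero]
      · have := eq_of_repr_ne_zero v (f := (LieAlgebra.ad ℂ 𝔤 r : 𝔤 →ₗ[ℂ] 𝔤))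
          (χ := fun k => (d k : ℂ)) (fun k => by rw [hv]; exact hd k) hx hk
        rw [Int.cast_injective this]
    simp only [T, LinearMap.sum_apply, TensorProduct.map_tmul, h1]
    rw [← TensorProduct.tmul_sum, v.sum_repr]
  refine ⟨T (shiftMap N M), ?_, fun n x e hx => by rw [hT _ _ hx, shiftMap_mono]⟩
  have hinv : T (unshiftMap N M) ∘ₗ T (shiftMap N M) = LinearMap.id := by
    refine TensorProduct.ext' fun a x => ?_
    have hx : x ∈ Submodule.span ℂ {x : 𝔤 | ∃ n : ℤ, ⁅r, x⁆ = (n : ℂ) • x} :=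
      hr ▸ Submodule.mem_top
    induction hx using Submodule.span_induction with
    | mem x hx =>
      obtain ⟨n, hn⟩ := hx
      rw [LinearMap.comp_apply, hT _ _ hn, hT _ _ hn, ← LinearMap.comp_apply,
        unshiftMap_comp_shiftMap hM]; rfl
    | zero => rw [TensorProduct.tmul_zero, map_zero, map_zero]
    | add u v _ _ hu hv => rw [TensorProduct.tmul_add, map_add, map_add, hu, hv]
    | smul c u _ hu => rw [TensorProduct.tmul_smul, map_smul, map_smul, hu]
  exact Function.LeftInverse.injective (g := T (unshiftMap N M))
    fun u => congrArg (fun f => f u) hinv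

variable {N : ℕ} {B : LinearMap.BilinForm ℂ 𝔤} {hI : B.lieInvariant 𝔤} {hS : B.IsSymm}

lemma lie_mk_central {m : ℕ} (u : Tor m N B hI hS) (c : Center m N) :
    ⁅u, (⟨0, c⟩ : Tor m N B hI hS)⁆ = 0 :=
  Tor.ext (lie_zero (L := LaurentRing N ⊗[ℂ] 𝔤) u.loop) (by simp)

lemma mk_central_lie {m : ℕ} (u : Tor m N B hI hS) (c : Center m N) :
    ⁅(⟨0, c⟩ : Tor m N B hI hS), u⁆ = 0 :=
  Tor.ext (zero_lie (L := LaurentRing N ⊗[ℂ] 𝔤) u.loop) (by simp)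

/-- The linear map `x ↦ x t^{r₀} t^r`. -/
def rootMap (m : ℕ) (B : LinearMap.BilinForm ℂ 𝔤) (hI : B.lieInvariant 𝔤) (hS : B.IsSymm) (r₀ : ℤ)
    (r : Fin N → ℤ) : 𝔤 →ₗ[ℂ] Tor m N B hI hS where
  toFun x := root m x r₀ r
  map_add' x y := Tor.ext (TensorProduct.tmul_add _ _ _) (by simp [root])
  map_smul' c x := Tor.ext (TensorProduct.tmul_smul _ _ _) (by simp [root])

lemma rootMap_apply (m : ℕ) (x : 𝔤) (r₀ : ℤ) (r : Fin N → ℤ) :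
    rootMap m B hI hS r₀ r x = root m x r₀ r := rfl

lemma span_root_union_central {r : 𝔤} (hr : IsIntegral r) (m : ℕ) :
    Submodule.span ℂ ({z : Tor m N B hI hS |
      ∃ (n : ℤ) (x : 𝔤) (s₀ : ℤ) (s : Fin N → ℤ), ⁅r, x⁆ = (n : ℂ) • x ∧ z = root m x s₀ s} ∪
      {z | ∃ c, z = ⟨0, c⟩}) = ⊤ := by
  rw [eq_top_iff]
  rintro ⟨l, c⟩ -
  set S := Submodule.span ℂ ({z : Tor m N B hI hS |
      ∃ (n : ℤ) (x : 𝔤) (s₀ : ℤ) (s : Fin N → ℤ), ⁅r, x⁆ = (n : ℂ) • x ∧ z = root m x s₀ s} ∪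
      {z | ∃ c, z = ⟨0, c⟩})
  let j : LaurentRing N ⊗[ℂ] 𝔤 →ₗ[ℂ] Tor m N B hI hS :=
    { toFun := fun l => ⟨l, 0⟩
      map_add' := fun u v => Tor.ext rfl (by simp)
      map_smul' := fun c v => Tor.ext rfl (by simp) }
  have hj : j l ∈ S := by
    induction l using TensorProduct.induction_on with
    | zero => rw [map_zero]; exact zero_mem _
    | add u v hu hv => rw [map_add]; exact add_mem hu hv
    | tmul a x =>
      have ha : a ∈ Submodule.span ℂ (Set.range (AddMonoidAlgebra.basis (Expo N) ℂ)) :=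
        (AddMonoidAlgebra.basis (Expo N) ℂ).span_eq ▸ Submodule.mem_top
      induction ha using Submodule.span_induction with
      | zero => rw [TensorProduct.zero_tmul, map_zero]; exact zero_mem _
      | add u v _ _ hu hv => rw [TensorProduct.add_tmul, map_add]; exact add_mem hu hv
      | smul c u _ hu =>
        rw [← TensorProduct.smul_tmul', map_smul]; exact Submodule.smul_mem _ c hu
      | mem a ha =>
        obtain ⟨e, rfl⟩ := ha
        rw [AddMonoidAlgebra.basis_apply]
        have hx : x ∈ Submodule.span ℂ {x : 𝔤 | ∃ n : ℤ, ⁅r, x⁆ = (n : ℂ) • x} :=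
          hr ▸ Submodule.mem_top
        induction hx using Submodule.span_induction with
        | zero => rw [TensorProduct.tmul_zero, map_zero]; exact zero_mem _
        | add u v _ _ hu hv => rw [TensorProduct.tmul_add, map_add]; exact add_mem hu hv
        | smul c u _ hu => rw [TensorProduct.tmul_smul, map_smul]; exact Submodule.smul_mem _ c hu
        | mem x hx =>
          obtain ⟨n, hn⟩ := hx
          exact Submodule.subset_span (Or.inl ⟨n, x, e.1, e.2, hn, rfl⟩)
  have : (⟨l, c⟩ : Tor m N B hI hS) = j l + ⟨0, c⟩ := Tor.ext (by simp [j]) (by simp [j])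
  rw [this]
  exact add_mem hj (Submodule.subset_span (Or.inr ⟨c, rfl⟩))

lemma form_lie_eigen (hI : B.lieInvariant 𝔤) {r x y : 𝔤} {c : ℂ} (hx : ⁅r, x⁆ = c • x) :
    B r ⁅x, y⁆ = c * B x y := by
  have h := hI x r y
  rw [← lie_skew, hx, map_neg, LinearMap.neg_apply, neg_inj, map_smul, LinearMap.smul_apply,
    smul_eq_mul] at h
  exact h.symm

lemma form_eq_zero (hI : B.lieInvariant 𝔤) {r x y : 𝔤} {c d : ℂ} (hx : ⁅r, x⁆ = c • x)
    (hy : ⁅r, y⁆ = d • y) (h : c + d ≠ 0) : B x y = 0 := by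
  have h1 := hI r x y
  rw [hx, hy, map_smul, map_smul, LinearMap.smul_apply, smul_eq_mul, smul_eq_mul,
    eq_neg_iff_add_eq_zero, ← add_mul] at h1
  exact (mul_eq_zero.mp h1).resolve_left h

/-- The homomorphism of toroidal Lie algebras
`x t^{r₀} t^r ↦ x t^{r₀ M + n} t^r + (⟨r, x⟩ / m) t^{r₀ M} t^r k₀`, for `x` of degree `n`. -/
lemma exists_toroidalHom [FiniteDimensional ℂ 𝔤] (N K : ℕ) {M : ℕ} (hK : K ≠ 0) (hM : M ≠ 0) {r : 𝔤}
    (hr : IsIntegral r) (hI : B.lieInvariant 𝔤) (hS : B.IsSymm) :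
    ∃ T : Tor K N B hI hS →ₗ⁅ℂ⁆ Tor (K * M) N B hI hS, Function.Injective T ∧
      (∀ (n : ℤ) (x : 𝔤) (s₀ : ℤ) (s : Fin N → ℤ), ⁅r, x⁆ = (n : ℂ) • x →
        T (root K x s₀ s) = root (K * M) x (s₀ * M + n) s +
          (B r x / (K * M : ℕ)) • cen (K * M) (s₀ * M) s 0) ∧
      ∀ s₀ s i, T (cen K s₀ s i) = cen (K * M) (s₀ * M) s i := by
  obtain ⟨T₀, hT₀, hT₀r⟩ := exists_regrading (𝔤 := 𝔤) N hM hr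
  let Q : LaurentRing N →ₗ[ℂ] Center (K * M) N :=
    (exactForms (K * M) N).mkQ ∘ₗ LinearMap.single ℂ (fun _ => LaurentRing N) 0 ∘ₗ shiftMap N M 0
  let c : LaurentRing N ⊗[ℂ] 𝔤 →ₗ[ℂ] Center (K * M) N :=
    (TensorProduct.rid ℂ _).toLinearMap ∘ₗ TensorProduct.map Q (((K * M : ℕ) : ℂ)⁻¹ • B r)
  have hc (e : Expo N) (x : 𝔤) : c (mono e ⊗ₜ x) = (B r x / (K * M : ℕ)) •
      (exactForms (K * M) N).mkQ (Pi.single 0 (mono (e.1 * M, e.2))) := by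
    simp only [c, LinearMap.comp_apply, TensorProduct.map_tmul, LinearEquiv.coe_coe,
      TensorProduct.rid_tmul, LinearMap.smul_apply, smul_eq_mul, Q, shiftMap_mono, add_zero,
      LinearMap.single_apply, div_eq_inv_mul]
  let T : Tor K N B hI hS →ₗ[ℂ] Tor (K * M) N B hI hS :=
    { toFun := fun u => ⟨T₀ u.loop, c u.loop + centerMap N K hM u.central⟩
      map_add' := fun u v => Tor.ext (map_add T₀ _ _) (by
        simp only [Tor.loop_add, Tor.central_add, map_add]; exact add_add_add_comm _ _ _ _)
      map_smul' := fun z v => Tor.ext (map_smul T₀ _ _) (by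
        simp only [Tor.loop_smul, Tor.central_smul, map_smul, RingHom.id_apply, smul_add]) }
  have hTroot (n : ℤ) (x : 𝔤) (s₀ : ℤ) (s : Fin N → ℤ) (hx : ⁅r, x⁆ = (n : ℂ) • x) :
      T (root K x s₀ s) = root (K * M) x (s₀ * M + n) s +
          (B r x / (K * M : ℕ)) • cen (K * M) (s₀ * M) s 0 := by
    refine Tor.ext ?_ ?_
    · simp [T, root, cen, hT₀r _ _ _ hx]
    · simp [T, root, cen, hc]
  have hTcen (s₀ : ℤ) (s : Fin N → ℤ) (i) : T (cen K s₀ s i) = cen (K * M) (s₀ * M) s i := by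
    refine Tor.ext ?_ ?_
    · simp [T, cen]
    · simp only [T, cen, LinearMap.coe_mk, AddHom.coe_mk, map_zero, zero_add]
      exact centerMap_mkQ hM i (s₀, s)
  have hTcentral (z : Center K N) : T ⟨0, z⟩ = ⟨0, centerMap N K hM z⟩ :=
    Tor.ext (by simp [T]) (by simp [T])
  have hinj : Function.Injective T := by
    rw [← LinearMap.ker_eq_bot, LinearMap.ker_eq_bot']
    rintro ⟨l, z⟩ h
    have h1 : T₀ l = 0 := congrArg Tor.loop h
    have hl : l = 0 := hT₀ (by rw [h1, map_zero])
    subst hl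
    have h2 : centerMap N K hM z = 0 := by
      rw [hTcentral] at h; exact congrArg Tor.central h
    have hz : z = 0 := centerMap_injective hM (by rw [h2, map_zero])
    subst hz; rfl
  have hlie : ∀ u v, T ⁅u, v⁆ = ⁅T u, T v⁆ := by
    refine map_lie_of_span_eq_top T (span_root_union_central hr K) ?_
    rintro u (⟨n, x, p₀, p, hx, rfl⟩ | ⟨z, rfl⟩) v (⟨k, y, q₀, q, hy, rfl⟩ | ⟨z', rfl⟩)
    · have hxy : ⁅r, ⁅x, y⁆⁆ = ((n + k : ℤ) : ℂ) • ⁅x, y⁆ := by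
        rw [lie_lie_eq_smul hx hy]; push_cast; rfl
      have hcl (s₀ : ℤ) (s : Fin N → ℤ) (u : Tor (K * M) N B hI hS) (i) :
        ⁅u, (cen (K * M) s₀ s i : Tor (K * M) N B hI hS)⁆ = 0 := lie_mk_central u _
      have hlc (s₀ : ℤ) (s : Fin N → ℤ) (u : Tor (K * M) N B hI hS) (i) :
        ⁅(cen (K * M) s₀ s i : Tor (K * M) N B hI hS), u⁆ = 0 := mk_central_lie u _
      rw [root_lie_root, map_add, hTroot _ _ _ _ hxy, hTroot _ _ _ _ hx, hTroot _ _ _ _ hy,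
        lie_add, lie_smul, hcl, add_lie, smul_lie, hlc, smul_zero, smul_zero, add_zero, add_zero,
        root_lie_root, form_lie_eigen hI hx, map_smul, map_sum]
      simp only [map_smul, hTcen]
      have hexp : (p₀ + q₀) * M + (n + k) = p₀ * M + n + (q₀ * M + k) := by ring
      rw [hexp, add_assoc]
      congr 1
      -- If `n + k ≠ 0`, then `⟨x, y⟩ = 0` and no central term appears. Otherwise the exponents of
      -- `t` agree, and the `k₀` coefficients match by `p₀ / K + n / (K M) = (p₀ M + n) / (K M)`.
      by_cases hnk : n + k = 0
      · have hexp' : p₀ * M + n + (q₀ * M + k) = (p₀ + q₀) * M := by linarith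
        rw [hexp', mul_comm (n : ℂ), mul_div_assoc, mul_smul, ← smul_add]
        congr 1
        rw [Fin.sum_univ_succ, Fin.sum_univ_succ, ← add_assoc, ← add_smul]
        congr 2
        have hK' : (K : ℂ) ≠ 0 := by exact_mod_cast hK
        have hM' : (M : ℂ) ≠ 0 := by exact_mod_cast hM
        simp only [weight, Fin.cons_zero]
        push_cast
        field_simp
        ring
      · have h0 : B x y = 0 := form_eq_zero hI hx hy (by exact_mod_cast hnk)
        simp [h0]
    · rw [lie_mk_central, hTcentral, lie_mk_central, map_zero]
    · rw [mk_central_lie, hTcentral, mk_central_lie, map_zero]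
    · rw [lie_mk_central, hTcentral, hTcentral, lie_mk_central, map_zero]
  exact ⟨{ T with map_lie' := fun {u v} => hlie u v }, hinj, hTroot, hTcen⟩

/-- The homomorphism of `exists_toroidalHom` carries the twisted algebra of `π` onto that of the
principal automorphism. -/
lemma map_twisted [FiniteDimensional ℂ 𝔤] {K M : ℕ} (hK0 : K ≠ 0) {π θ : 𝔤 ≃ₗ⁅ℂ⁆ 𝔤}
    (hK : orderOf π.toLinearEquiv = K) {ε : ℂ} (hε : IsPrimitiveRoot ε K) {r : 𝔤}
    (hr : IsIntegral r) (hπr : π r = r) (hB : ∀ x y, B (π x) (π y) = B x y) (hM : M ≠ 0)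
    {w : ℂ} (hw : IsPrimitiveRoot w (K * M))
    (hθ : ∀ (p n : ℤ) (x : 𝔤), π x = ε ^ p • x → ⁅r, x⁆ = (n : ℂ) • x →
      θ x = w ^ (p * M + n) • x)
    {T : Tor K N B hI hS →ₗ⁅ℂ⁆ Tor (K * M) N B hI hS}
    (hTroot : ∀ (n : ℤ) (x : 𝔤) (s₀ : ℤ) (s : Fin N → ℤ), ⁅r, x⁆ = (n : ℂ) • x →
      T (root K x s₀ s) = root (K * M) x (s₀ * M + n) s +
        (B r x / (K * M : ℕ)) • cen (K * M) (s₀ * M) s 0)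
    (hTcen : ∀ s₀ s i, T (cen K s₀ s i) = cen (K * M) (s₀ * M) s i) :
    (twisted K N B hI hS π ε).map T = twisted (K * M) N B hI hS θ w := by
  have hε0 : ε ≠ 0 := hε.ne_zero hK0
  have hw0 : w ≠ 0 := hw.ne_zero (mul_ne_zero hK0 hM)
  have htop := span_homogeneous_eq_top hK0 hK hε hr hπr
  -- As `r` is fixed by `π`, it pairs nontrivially only with `𝔤_[0]`. So a nonzero correction term
  -- has exponent divisible by `K M`, and lies in the twisted algebra.
  have hform (x : 𝔤) (p : ℤ) (hx : π x = ε ^ p • x) (h : B r x ≠ 0) : (K : ℤ) ∣ p := by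
    rw [← hε.zpow_eq_one_iff_dvd]
    have h1 := hB r x
    rw [hπr, hx, map_smul, smul_eq_mul] at h1
    exact mul_right_cancel₀ h (h1.trans (one_mul _).symm)
  have hdvd {p : ℤ} (h : (K : ℤ) ∣ p) : ((K * M : ℕ) : ℤ) ∣ p * M := by
    push_cast; exact mul_dvd_mul_right h _
  refine le_antisymm ?_ ?_
  · rw [twisted, LieSubalgebra.map_lieSpan, LieSubalgebra.lieSpan_le]
    rintro - ⟨z, ⟨x, s₀, s, hx, rfl⟩ | ⟨s₀, s, i, hs, rfl⟩, rfl⟩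
    · have hmem := mem_span_of_apply_eq_smul (f := (π : 𝔤 →ₗ[ℂ] 𝔤))
        (s := {x : 𝔤 | (∃ p : ℤ, π x = ε ^ p • x) ∧ ∃ n : ℤ, ⁅r, x⁆ = (n : ℂ) • x})
        (fun v hv => ⟨_, hv.1.choose_spec⟩) (htop ▸ Submodule.mem_top) hx
      change T (rootMap K B hI hS s₀ s x) ∈ _
      clear hx
      induction hmem using Submodule.span_induction with
      | zero => rw [map_zero, map_zero]; exact zero_mem _
      | add u v _ _ hu hv => rw [map_add, map_add]; exact add_mem hu hv
      | smul c u _ hu => rw [map_smul, map_smul]; exact LieSubalgebra.smul_mem _ c hu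
      | mem x hx =>
        obtain ⟨⟨-, n, hn⟩, hx⟩ := hx
        have hx' : π x = ε ^ s₀ • x := hx
        rw [rootMap_apply, hTroot n x s₀ s hn]
        refine add_mem (LieSubalgebra.subset_lieSpan (Or.inl ⟨_, _, _, hθ _ _ _ hx' hn, rfl⟩)) ?_
        by_cases h0 : B r x = 0
        · rw [h0, zero_div, zero_smul]; exact zero_mem _
        · exact LieSubalgebra.smul_mem _ _ (LieSubalgebra.subset_lieSpan
            (Or.inr ⟨_, _, _, hdvd (hform x s₀ hx' h0), rfl⟩))
    · change T (cen K s₀ s i) ∈ twisted (K * M) N B hI hS θ w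
      rw [hTcen]
      exact LieSubalgebra.subset_lieSpan (Or.inr ⟨_, _, _, hdvd hs, rfl⟩)
  · rw [twisted, LieSubalgebra.lieSpan_le]
    have hcen (s₀ : ℤ) (s i) (h : (K : ℤ) ∣ s₀) : cen (K * M) (s₀ * M) s i ∈
        (twisted K N B hI hS π ε).map T :=
      ⟨cen K s₀ s i, LieSubalgebra.subset_lieSpan (Or.inr ⟨_, _, _, h, rfl⟩), hTcen _ _ _⟩
    rintro z (⟨x, s₀, s, hx, rfl⟩ | ⟨s₀, s, i, ⟨q, hq⟩, rfl⟩)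
    · have hmem := mem_span_of_apply_eq_smul (f := (θ : 𝔤 →ₗ[ℂ] 𝔤))
        (s := {x : 𝔤 | (∃ p : ℤ, π x = ε ^ p • x) ∧ ∃ n : ℤ, ⁅r, x⁆ = (n : ℂ) • x})
        (fun v ⟨⟨p, hp⟩, n, hn⟩ => ⟨_, hθ p n v hp hn⟩) (htop ▸ Submodule.mem_top) hx
      change rootMap (K * M) B hI hS s₀ s x ∈ _
      clear hx
      induction hmem using Submodule.span_induction with
      | zero => rw [map_zero]; exact zero_mem _
      | add u v _ _ hu hv => rw [map_add]; exact add_mem hu hv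
      | smul c u _ hu => rw [map_smul]; exact LieSubalgebra.smul_mem _ c hu
      | mem x hx =>
        obtain ⟨⟨⟨p, hp⟩, n, hn⟩, hx⟩ := hx
        by_cases hx0 : x = 0
        · rw [hx0, map_zero]; exact zero_mem _
        have h1 : θ x = w ^ s₀ • x := hx
        rw [hθ p n x hp hn] at h1
        have h2 : ((K * M : ℕ) : ℤ) ∣ s₀ - (p * M + n) := by
          rw [← hw.zpow_eq_one_iff_dvd, zpow_sub₀ hw0, smul_left_injective ℂ hx0 h1,
            div_self (zpow_ne_zero _ hw0)]
        obtain ⟨q, hq⟩ := h2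
        -- Comparing the two eigenvalues of `θ` on `x` gives `s₀` modulo `K M`. The multiple of `K
        -- M` is absorbed into `p`, which matters only modulo `K`.
        have hs₀ : s₀ = (p + K * q) * M + n := by push_cast at hq; linarith
        have hpq : π x = ε ^ (p + K * q) • x := by
          rw [zpow_add₀ hε0, zpow_mul, zpow_natCast, hε.pow_eq_one, one_zpow, mul_one, hp]
        have h3 := hTroot n x (p + K * q) s hn
        rw [rootMap_apply, hs₀, ← sub_eq_iff_eq_add.mpr h3]
        refine sub_mem
          ⟨_, LieSubalgebra.subset_lieSpan (Or.inl ⟨x, p + K * q, s, hpq, rfl⟩), rfl⟩ ?_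
        by_cases h0 : B r x = 0
        · rw [h0, zero_div, zero_smul]; exact zero_mem _
        · exact LieSubalgebra.smul_mem _ _ (hcen _ _ _ (hform x _ hpq h0))
    · have : s₀ = (K * q) * M := by push_cast at hq; linarith
      rw [this]
      exact hcen _ _ _ (dvd_mul_right _ _)

lemma exists_equiv_of_map_eq {L L' : Type*} [LieRing L] [LieAlgebra ℂ L] [LieRing L']
    [LieAlgebra ℂ L'] {S : LieSubalgebra ℂ L} {S' : LieSubalgebra ℂ L'} {T : L →ₗ⁅ℂ⁆ L'}
    (hT : Function.Injective T) (h : S.map T = S') :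
    ∃ φ : S ≃ₗ⁅ℂ⁆ S', ∀ x ∈ S, Sends φ x (T x) := by
  subst h
  exact ⟨S.equivMapOfInjective T hT, fun x hx => ⟨hx, rfl⟩⟩

end Hom

end Toroidal
end

noncomputable section

namespace Toroidal

/-! ### The affine algebra as a twisted algebra, and the lengths of the `ψ_j`. -/

section

variable {𝔤 : Type*} [LieRing 𝔤] [LieAlgebra ℂ 𝔤] {B : LinearMap.BilinForm ℂ 𝔤}
  {hI : B.lieInvariant 𝔤} {hS : B.IsSymm}

/-- In one variable the only relation in degree `r₀` is `(r₀ / m) t^{r₀} k₀ = 0`. This is the source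
of the Kronecker delta in the affine case. -/
lemma cen_eq_zero {m : ℕ} (hm : m ≠ 0) {r₀ : ℤ} (hr : r₀ ≠ 0) (r : Fin 0 → ℤ) (i : Fin 1) :
    (cen m r₀ r i : Tor m 0 B hI hS) = 0 := by
  refine Tor.ext rfl ?_
  have hc : (r₀ : ℂ) / m ≠ 0 := div_ne_zero (by exact_mod_cast hr) (by exact_mod_cast hm)
  have h : (Pi.single i (mono (r₀, r)) : Omega 0) =
      ((r₀ : ℂ) / m)⁻¹ • fun j => weight m (r₀, r) j • mono (r₀, r) := by
    ext1 j
    rw [Fin.fin_one_eq_zero i, Fin.fin_one_eq_zero j, Pi.single_eq_same, Pi.smul_apply]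
    simp only [weight, Fin.cons_zero]
    rw [smul_smul, inv_mul_cancel₀ hc, one_smul]
  change (exactForms m 0).mkQ (Pi.single i (mono (r₀, r))) = 0
  rw [Submodule.mkQ_apply, Submodule.Quotient.mk_eq_zero, h]
  exact Submodule.smul_mem _ _ (Submodule.subset_span ⟨(r₀, r), rfl⟩)

namespace Generators

variable [FiniteDimensional ℂ 𝔤] [LieAlgebra.IsSimple ℂ 𝔤]
  {π : 𝔤 ≃ₗ⁅ℂ⁆ 𝔤} {ε : ℂ} {H : LieSubalgebra ℂ 𝔤} {ℓ : ℕ} (D : Generators π ε H ℓ)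
  {ι : Type*} [Finite ι] {b : LieAlgebra.Basis ι H} {a : Fin (ℓ + 1) → ℕ} {K : ℕ}

/-- The affine algebra is the twisted loop algebra of `π`, extended by `C`. -/
lemma affine_eq_twisted (hπ : IsDiagramAutomorphism b π) (ha : D.IsLabels a) (hK0 : K ≠ 0)
    (hK : orderOf π.toLinearEquiv = K) (hε : IsPrimitiveRoot ε K) :
    D.affine K B hI hS = twisted K 0 B hI hS π ε := by
  have hε0 : ε ≠ 0 := hε.ne_zero hK0
  refine le_antisymm ?_ ?_
  · rw [affine, LieSubalgebra.lieSpan_le]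
    rintro z (((⟨i, rfl⟩ | ⟨i, rfl⟩) | ⟨i, rfl⟩) | rfl | rfl | rfl | rfl)
    · exact LieSubalgebra.subset_lieSpan (Or.inl ⟨_, _, _, by simpa using D.map_E_succ i, rfl⟩)
    · exact LieSubalgebra.subset_lieSpan (Or.inl ⟨_, _, _, by simpa using D.map_F_succ i, rfl⟩)
    · exact LieSubalgebra.subset_lieSpan (Or.inl ⟨_, _, _,
        by rw [zpow_zero, one_smul]; exact map_toAlg _, rfl⟩)
    · exact LieSubalgebra.subset_lieSpan (Or.inl ⟨_, _, _, by rw [zpow_one]; exact D.map_E₀, rfl⟩)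
    · exact LieSubalgebra.subset_lieSpan (Or.inl ⟨_, _, _,
        by rw [zpow_neg_one]; exact D.map_F₀, rfl⟩)
    · exact LieSubalgebra.subset_lieSpan (Or.inl ⟨_, _, _,
        by rw [zpow_zero, one_smul]; exact map_toAlg _, rfl⟩)
    · exact LieSubalgebra.subset_lieSpan (Or.inr ⟨_, _, _, dvd_zero _, rfl⟩)
  · have hcen (r₀ : ℤ) (r : Fin 0 → ℤ) (i) : cen K r₀ r i ∈ D.affine K B hI hS := by
      by_cases hr : r₀ = 0
      · subst hr
        rw [Subsingleton.elim r 0, Fin.fin_one_eq_zero i]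
        exact LieSubalgebra.subset_lieSpan (Or.inr (by simp))
      · rw [cen_eq_zero hK0 hr]; exact zero_mem _
    -- The `x` in `𝔤_[j]` with `x t^j` in `G`. Closure under brackets holds because all central
    -- terms already lie in `G`.
    let S (j : ℤ) : Submodule ℂ 𝔤 :=
      LinearMap.eqLocus (π : 𝔤 →ₗ[ℂ] 𝔤) (ε ^ j • LinearMap.id) ⊓
        (D.affine K B hI hS).toSubmodule.comap (rootMap K B hI hS j 0)
    have hmem (j : ℤ) (x : 𝔤) (hx : π x = ε ^ j • x) : x ∈ S j := by
      refine D.mem_of_graded hπ ha hK0 hK hε (S := S) (fun j x hx => hx.1) ?_ ?_ ?_ ?_ ?_ hx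
      · rintro i j x ⟨hx, hx'⟩ y ⟨hy, hy'⟩
        refine ⟨lie_eigen hε0 hx hy, ?_⟩
        have h1 : ⁅rootMap K B hI hS i 0 x, rootMap K B hI hS j 0 y⁆ ∈ D.affine K B hI hS :=
          LieSubalgebra.lie_mem _ hx' hy'
        rw [rootMap_apply, rootMap_apply, root_lie_root, add_zero] at h1
        refine (Submodule.add_mem_iff_left (D.affine K B hI hS).toSubmodule ?_).mp h1
        exact Submodule.smul_mem _ _ (Submodule.sum_mem _ fun k _ =>
          Submodule.smul_mem _ _ (hcen _ _ _))
      · exact fun i => ⟨by simpa using D.map_E_succ i,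
          LieSubalgebra.subset_lieSpan (Or.inl (Or.inl (Or.inl ⟨i, rfl⟩)))⟩
      · exact fun i => ⟨by simpa using D.map_F_succ i,
          LieSubalgebra.subset_lieSpan (Or.inl (Or.inl (Or.inr ⟨i, rfl⟩)))⟩
      · exact ⟨by rw [zpow_one]; exact D.map_E₀,
          LieSubalgebra.subset_lieSpan (Or.inr (Or.inl rfl))⟩
      · exact ⟨by rw [zpow_neg_one]; exact D.map_F₀,
          LieSubalgebra.subset_lieSpan (Or.inr (Or.inr (Or.inl rfl)))⟩
    rw [twisted, LieSubalgebra.lieSpan_le]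
    rintro z (⟨x, s₀, s, hx, rfl⟩ | ⟨s₀, s, i, -, rfl⟩)
    · rw [Subsingleton.elim s 0]
      exact (hmem s₀ x hx).2
    · exact hcen _ _ _

/-- The form represents `ψ_j` by a multiple of `H_j`. -/
lemma exists_represents (hB : B.Nondegenerate) (hI : B.lieInvariant 𝔤)
    (hπ : IsDiagramAutomorphism b π) (j : Fin (ℓ + 1)) :
    ∃ ν : fixedCartan π H, (∀ h, B (toAlg ν) (toAlg h) = D.ψ j h) ∧ D.ψ j ν ≠ 0 ∧
      2 * (D.ψ j ν)⁻¹ = B (D.E j) (D.F j) := by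
  obtain ⟨c, rfl⟩ := exists_eq_smul_killingForm hI
  obtain ⟨r, hr, hEF⟩ := D.killingForm_E_F_pos hπ j
  have hc : c ≠ 0 := by
    rintro rfl
    have h := hB.1 (D.E j) (fun y => by simp)
    exact D.E_ne_zero j h
  have hEF' : (c • killingForm ℂ 𝔤) (D.E j) (D.F j) ≠ 0 := by
    simp only [LinearMap.smul_apply, hEF, smul_eq_mul]
    exact mul_ne_zero hc (by exact_mod_cast hr.ne')
  set e := (c • killingForm ℂ 𝔤) (D.E j) (D.F j) with he
  have hψ : D.ψ j (e⁻¹ • D.h j) = e⁻¹ * 2 := by rw [map_smul, D.ψ_h_self, smul_eq_mul]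
  -- With `e = ⟨E_j, F_j⟩` this gives `⟨ψ_j, ψ_j⟩ = 2 / e`, so the constant `2 / ⟨ψ_j, ψ_j⟩` is `e`.
  refine ⟨e⁻¹ • D.h j, fun h => ?_, ?_, ?_⟩
  · have h1 := D.form_toAlg_h hI j h
    rw [← he] at h1
    have h2 : (c • killingForm ℂ 𝔤) (toAlg (D.h j)) (toAlg h) = e * D.ψ j h := by
      rw [← h1, LinearMap.smul_apply, LinearMap.smul_apply, LinearMap.smul_apply,
        LinearMap.smul_apply, LieModule.traceForm_comm]
    change (c • killingForm ℂ 𝔤) (e⁻¹ • toAlg (D.h j)) (toAlg h) = _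
    rw [map_smul, LinearMap.smul_apply, h2, smul_eq_mul, inv_mul_cancel_left₀ hEF']
  · rw [hψ]; exact mul_ne_zero (inv_ne_zero hEF') two_ne_zero
  · rw [hψ, mul_inv, inv_inv]; field_simp

end Generators

end

end Toroidal

end

noncomputable section

namespace Toroidal

/-! ### Isomorphisms of twisted algebras, the order of `θ`, and orthogonality to `𝔱`. -/

section

variable {𝔤 : Type*} [LieRing 𝔤] [LieAlgebra ℂ 𝔤] {B : LinearMap.BilinForm ℂ 𝔤}
  {hI : B.lieInvariant 𝔤} {hS : B.IsSymm}

/-- The isomorphism of twisted toroidal algebras attached to an integral grading element. -/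
lemma exists_twistedEquiv [FiniteDimensional ℂ 𝔤] (N : ℕ) {K M : ℕ} (hK0 : K ≠ 0) {π θ : 𝔤 ≃ₗ⁅ℂ⁆ 𝔤}
    (hK : orderOf π.toLinearEquiv = K) {ε : ℂ} (hε : IsPrimitiveRoot ε K) {r : 𝔤}
    (hr : IsIntegral r) (hπr : π r = r) (hB : ∀ x y, B (π x) (π y) = B x y) (hM : M ≠ 0)
    {w : ℂ} (hw : IsPrimitiveRoot w (K * M))
    (hθ : ∀ (p n : ℤ) (x : 𝔤), π x = ε ^ p • x → ⁅r, x⁆ = (n : ℂ) • x →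
      θ x = w ^ (p * M + n) • x) :
    ∃ Φ : twisted K N B hI hS π ε ≃ₗ⁅ℂ⁆ twisted (K * M) N B hI hS θ w,
      (∀ (n : ℤ) (x : 𝔤) (s₀ : ℤ) (s : Fin N → ℤ), π x = ε ^ s₀ • x → ⁅r, x⁆ = (n : ℂ) • x →
        Sends Φ (root K x s₀ s) (root (K * M) x (s₀ * M + n) s +
          (B r x / (K * M : ℕ)) • cen (K * M) (s₀ * M) s 0)) ∧
      ∀ s₀ s i, (K : ℤ) ∣ s₀ → Sends Φ (cen K s₀ s i) (cen (K * M) (s₀ * M) s i) := by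
  obtain ⟨T, hTinj, hTroot, hTcen⟩ := exists_toroidalHom N K hK0 hM hr hI hS
  obtain ⟨Φ, hΦ⟩ := exists_equiv_of_map_eq hTinj
    (map_twisted hK0 hK hε hr hπr hB hM hw hθ hTroot hTcen)
  refine ⟨Φ, fun n x s₀ s hx hn => ?_, fun s₀ s i hs => ?_⟩
  · rw [← hTroot n x s₀ s hn]
    exact hΦ _ (LieSubalgebra.subset_lieSpan (Or.inl ⟨_, _, _, hx, rfl⟩))
  · rw [← hTcen s₀ s i]
    exact hΦ _ (LieSubalgebra.subset_lieSpan (Or.inr ⟨_, _, _, hs, rfl⟩))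

/-- The order of an automorphism of the form `w ^ (p M + n)` on the part of bidegree `(p, n)`. -/
lemma orderOf_eq_of_bigraded {K m M : ℕ} (hK0 : K ≠ 0) {π θ : 𝔤 ≃ₗ⁅ℂ⁆ 𝔤}
    (hK : orderOf π.toLinearEquiv = K) {ε : ℂ} (hε : IsPrimitiveRoot ε K) {r : 𝔤}
    (hr : IsIntegral r) (hπr : π r = r) {w : ℂ} (hw : IsPrimitiveRoot w m)
    (hθ : ∀ (p n : ℤ) (x : 𝔤), π x = ε ^ p • x → ⁅r, x⁆ = (n : ℂ) • x →
      θ x = w ^ (p * M + n) • x) {e : 𝔤} (he0 : e ≠ 0) (he : θ e = w • e) :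
    orderOf θ.toLinearEquiv = m := by
  have hpow (k : ℕ) {x : 𝔤} {c : ℂ} (hx : θ x = c • x) :
      (θ.toLinearEquiv ^ k) x = c ^ k • x := by
    rw [toLinearEquiv_pow_apply]
    induction k with
    | zero => simp
    | succ k ih => rw [Function.iterate_succ_apply', ih, map_smul, hx, smul_smul, ← pow_succ]
  refine Nat.dvd_antisymm (orderOf_dvd_of_pow_eq_one ?_) (hw.dvd_of_pow_eq_one _ ?_)
  · refine LinearEquiv.toLinearMap_injective
      (LinearMap.ext_on (span_homogeneous_eq_top hK0 hK hε hr hπr) ?_)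
    rintro x ⟨⟨p, hp⟩, n, hn⟩
    change (θ.toLinearEquiv ^ m) x = x
    rw [hpow m (hθ p n x hp hn), ← zpow_natCast, ← zpow_mul, mul_comm, zpow_mul, zpow_natCast,
      hw.pow_eq_one, one_zpow, one_smul]
  · have h := hpow (orderOf θ.toLinearEquiv) he
    rw [pow_orderOf_eq_one] at h
    exact smul_left_injective ℂ he0 (h.symm.trans (one_smul ℂ e).symm)

namespace Generators

variable {π : 𝔤 ≃ₗ⁅ℂ⁆ 𝔤} {ε : ℂ} {H : LieSubalgebra ℂ 𝔤} {ℓ : ℕ} (D : Generators π ε H ℓ)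
  {ι : Type*} [Finite ι] {b : LieAlgebra.Basis ι H} {a : Fin (ℓ + 1) → ℕ} {K : ℕ}

lemma form_toAlg_E (hI : B.lieInvariant 𝔤) (h : fixedCartan π H) (j : Fin (ℓ + 1)) :
    B (toAlg h) (D.E j) = 0 := by
  refine form_eq_zero hI (r := toAlg (D.h j)) (c := 0) (d := 2) ?_ (D.lie_h_E j) (by norm_num)
  rw [lie_toAlg_toAlg D, zero_smul]

lemma form_toAlg_F [FiniteDimensional ℂ 𝔤] [LieAlgebra.IsSimple ℂ 𝔤]
    (hI : B.lieInvariant 𝔤) (hπ : IsDiagramAutomorphism b π) (ha : D.IsLabels a)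
    (h : fixedCartan π H) (j : Fin (ℓ + 1)) : B (toAlg h) (D.F j) = 0 := by
  refine form_eq_zero hI (r := toAlg (D.h j)) (c := 0) (d := -D.ψ j (D.h j)) ?_
    (D.lie_F hπ ha j _) (by rw [D.ψ_h_self]; norm_num)
  rw [lie_toAlg_toAlg D, zero_smul]

variable {D}

/-- Weight spaces of nonzero weight are orthogonal to `𝔱`, which has weight zero; so real root
vectors receive no central correction. -/
lemma IsRealRootVector.form_toAlg (hI : B.lieInvariant 𝔤) {α : Module.Dual ℂ (fixedCartan π H)}
    {p : ℤ} {x : 𝔤} (hx : D.IsRealRootVector α p x) (h : fixedCartan π H) :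
    B (toAlg h) x = 0 := by
  obtain ⟨k, hk⟩ : ∃ k, α k ≠ 0 := by
    by_contra! hα
    exact hx.1 (LinearMap.ext hα)
  refine form_eq_zero hI (r := toAlg k) (c := 0) (d := α k) ?_ (hx.2.2.2 k) (by rwa [zero_add])
  rw [lie_toAlg_toAlg D, zero_smul]

lemma IsRealRootVector.lie_map {α : Module.Dual ℂ (fixedCartan π H)}
    {p : ℤ} {x : 𝔤} (hx : D.IsRealRootVector α p x) {ω : 𝔤 ≃ₗ⁅ℂ⁆ 𝔤}
    (hω : ∀ h : fixedCartan π H, ω (toAlg h) = -toAlg h) (h : fixedCartan π H) :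
    ⁅toAlg h, ω x⁆ = -α h • ω x := by
  have h1 := congrArg ω (hx.2.2.2 h)
  rw [LieEquiv.map_lie, hω, neg_lie, map_smul] at h1
  rw [neg_smul, ← h1, neg_neg]

end Generators

end

end Toroidal

end

/-! ### The main theorem. -/

open Toroidal in
theorem proposition4p12 {𝔤 : Type*} [LieRing 𝔤] [LieAlgebra ℂ 𝔤] [FiniteDimensional ℂ 𝔤]
    [LieAlgebra.IsSimple ℂ 𝔤]
    (B : LinearMap.BilinForm ℂ 𝔤) (hI : B.lieInvariant 𝔤) (hS : B.IsSymm) (hB : B.Nondegenerate)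
    {ι : Type*} [Finite ι] {H : LieSubalgebra ℂ 𝔤} (b : LieAlgebra.Basis ι H)
    (π : 𝔤 ≃ₗ⁅ℂ⁆ 𝔤) (hπ : Toroidal.IsDiagramAutomorphism b π)
    (K : ℕ) (hK : orderOf π.toLinearEquiv = K) (ε : ℂ) (hε : IsPrimitiveRoot ε K)
    {ℓ : ℕ} (D : Toroidal.Generators π ε H ℓ)
    (a : Fin (ℓ + 1) → ℕ) (ha : D.IsLabels a)
    (M m : ℕ) (hM : M = ∑ j, a j) (hm : m = K * M)
    (w : ℂ) (hw : IsPrimitiveRoot w m) :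
    ∃ θ : 𝔤 ≃ₗ⁅ℂ⁆ 𝔤,
      -- `θ` is the unique automorphism with `θ H_j = H_j`, `θ E_j = w E_j`, and has order `m`
      (D.IsPrincipal w θ ∧ ∀ θ', D.IsPrincipal w θ' → θ' = θ) ∧
      orderOf θ.toLinearEquiv = m ∧
      -- the degree shifts
      ∃ shift : Module.Dual ℂ (Toroidal.fixedCartan π H) → ℤ,
        (∀ α β p q x y, D.IsRealRootVector α p x → D.IsRealRootVector β q y →
          B x y ≠ 0 → shift α + shift β = 0) ∧
        -- the isomorphism of affine Lie algebras
        (∃ φ : D.affine K B hI hS ≃ₗ⁅ℂ⁆ Toroidal.twisted m 0 B hI hS θ w,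
          (∀ i : Fin ℓ, Toroidal.Sends φ
            (Toroidal.root K (D.E i.succ) 0 0) (Toroidal.root m (D.E i.succ) 1 0)) ∧
          (∀ i : Fin ℓ, Toroidal.Sends φ
            (Toroidal.root K (D.F i.succ) 0 0) (Toroidal.root m (D.F i.succ) (-1) 0)) ∧
          Toroidal.Sends φ (Toroidal.root K (D.E 0) 1 0) (Toroidal.root m (D.E 0) 1 0) ∧
          Toroidal.Sends φ (Toroidal.root K (D.F 0) (-1) 0) (Toroidal.root m (D.F 0) (-1) 0) ∧
          -- `ν` represents `ψ_j` through the form, so that `ψ_j ν = ⟨ψ_j, ψ_j⟩`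
          (∀ i : Fin ℓ, ∃ ν : Toroidal.fixedCartan π H,
            (∀ h, B (Toroidal.toAlg ν) (Toroidal.toAlg h) = D.ψ i.succ h) ∧ D.ψ i.succ ν ≠ 0 ∧
            Toroidal.Sends φ (Toroidal.root K (Toroidal.toAlg (D.h i.succ)) 0 0)
              (Toroidal.root m (Toroidal.toAlg (D.h i.succ)) 0 0 +
                (2 * (D.ψ i.succ ν)⁻¹ * (m : ℂ)⁻¹) • Toroidal.cen m 0 0 0)) ∧
          (∃ ν : Toroidal.fixedCartan π H,
            (∀ h, B (Toroidal.toAlg ν) (Toroidal.toAlg h) = D.ψ 0 h) ∧ D.ψ 0 ν ≠ 0 ∧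
            Toroidal.Sends φ (Toroidal.root K (Toroidal.toAlg (D.h 0)) 0 0 +
                (B (D.E 0) (D.F 0) / K) • Toroidal.cen K 0 0 0)
              (Toroidal.root m (Toroidal.toAlg (D.h 0)) 0 0 +
                (2 * (D.ψ 0 ν)⁻¹ * (m : ℂ)⁻¹) • Toroidal.cen m 0 0 0)) ∧
          Toroidal.Sends φ (Toroidal.cen K 0 0 0) (Toroidal.cen m 0 0 0) ∧
          (∀ α r₀ x, D.IsRealRootVector α r₀ x →
            Toroidal.Sends φ (Toroidal.root K x r₀ 0)
              (Toroidal.root m x (r₀ * M + shift α) 0)) ∧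
          (∀ ω : 𝔤 ≃ₗ⁅ℂ⁆ 𝔤,
            (∀ h : Toroidal.fixedCartan π H, ω (Toroidal.toAlg h) = -Toroidal.toAlg h) →
            ∀ α p x r₀, D.IsRealRootVector α p x → π ⁅x, ω x⁆ = ε ^ r₀ • ⁅x, ω x⁆ →
              Toroidal.Sends φ (Toroidal.root K ⁅x, ω x⁆ r₀ 0)
                (Toroidal.root m ⁅x, ω x⁆ (r₀ * M) 0 +
                  (if r₀ = 0 then B x (ω x) * shift α / m else 0) • Toroidal.cen m 0 0 0)) ∧
          (∀ α β r₀ s₀ x y, D.IsRealRootVector α r₀ x → D.IsRealRootVector β s₀ y →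
            B x y = 0 → Toroidal.Sends φ (Toroidal.root K ⁅x, y⁆ (r₀ + s₀) 0)
              (Toroidal.root m ⁅x, y⁆ ((r₀ + s₀) * M + shift α + shift β) 0))) ∧
        -- the isomorphism of toroidal Lie algebras
        ∀ N : ℕ, ∃ Φ : Toroidal.twisted K N B hI hS π ε ≃ₗ⁅ℂ⁆ Toroidal.twisted m N B hI hS θ w,
          (∀ α r₀ r x, D.IsRealRootVector α r₀ x →
            Toroidal.Sends Φ (Toroidal.root K x r₀ r)
              (Toroidal.root m x (r₀ * M + shift α) r)) ∧
          (∀ ω : 𝔤 ≃ₗ⁅ℂ⁆ 𝔤,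
            (∀ h : Toroidal.fixedCartan π H, ω (Toroidal.toAlg h) = -Toroidal.toAlg h) →
            ∀ α p x r₀ r, D.IsRealRootVector α p x → π ⁅x, ω x⁆ = ε ^ r₀ • ⁅x, ω x⁆ →
              Toroidal.Sends Φ (Toroidal.root K ⁅x, ω x⁆ r₀ r)
                (Toroidal.root m ⁅x, ω x⁆ (r₀ * M) r +
                  (B x (ω x) * shift α / m) • Toroidal.cen m (r₀ * M) r 0)) ∧
          (∀ r₀ r i, (K : ℤ) ∣ r₀ →
            Toroidal.Sends Φ (Toroidal.cen K r₀ r i) (Toroidal.cen m (r₀ * M) r i)) ∧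
          (∀ α β r₀ s₀ r x y, D.IsRealRootVector α r₀ x → D.IsRealRootVector β s₀ y →
            B x y = 0 → Toroidal.Sends Φ (Toroidal.root K ⁅x, y⁆ (r₀ + s₀) r)
              (Toroidal.root m ⁅x, y⁆ ((r₀ + s₀) * M + shift α + shift β) r)) := by
  have hK0 : K ≠ 0 := hK ▸ hπ.orderOf_ne_zero
  have hM0 : M ≠ 0 := by
    rw [hM]
    exact (Finset.sum_pos (fun j _ => ha.1 j) Finset.univ_nonempty).ne'
  subst hm
  have hw0 : w ≠ 0 := hw.ne_zero (mul_ne_zero hK0 hM0)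
  have hKc : (K : ℂ) ≠ 0 := Nat.cast_ne_zero.mpr hK0
  have hMc : (M : ℂ) ≠ 0 := Nat.cast_ne_zero.mpr hM0
  obtain ⟨ρ, hρ⟩ := D.exists_ψ_eq fun _ => 1
  have hr : IsIntegral (toAlg ρ) := D.isIntegral hπ fun j => ⟨1, by rw [hρ, Int.cast_one]⟩
  have hπr : π (toAlg ρ) = toAlg ρ := Generators.map_toAlg ρ
  -- As `a₀ = 1`, the label relation at `ρ` reads `ψ₀(ρ) + (M - 1) = 0`.
  have hρ0 : D.ψ 0 ρ = ((1 - M : ℤ) : ℂ) := by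
    have h := D.sum_labels ha ρ
    rw [Fin.sum_univ_succ, D.label_zero hπ ha] at h
    rw [Fin.sum_univ_succ, D.label_zero hπ ha] at hM
    simp only [hρ, mul_one] at h
    rw [hM]
    push_cast at h ⊢
    linear_combination h
  obtain ⟨θ, hθ⟩ := exists_principal hK0 hK hε hr hπr hw0 hw.pow_eq_one
  have hE (i : Fin ℓ) : ⁅toAlg ρ, D.E i.succ⁆ = ((1 : ℤ) : ℂ) • D.E i.succ := by
    rw [D.lie_E, hρ, Int.cast_one]
  have hE0 : ⁅toAlg ρ, D.E 0⁆ = ((1 - M : ℤ) : ℂ) • D.E 0 := by rw [D.lie_E, hρ0]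
  have hF (i : Fin ℓ) : ⁅toAlg ρ, D.F i.succ⁆ = ((-1 : ℤ) : ℂ) • D.F i.succ := by
    rw [D.lie_F_succ, hρ, Int.cast_neg, Int.cast_one]
  have hF0 : ⁅toAlg ρ, D.F 0⁆ = ((M - 1 : ℤ) : ℂ) • D.F 0 := by
    rw [D.lie_F hπ ha, hρ0, ← Int.cast_neg, neg_sub]
  have hh (h : fixedCartan π H) : ⁅toAlg ρ, toAlg h⁆ = ((0 : ℤ) : ℂ) • toAlg h := by
    rw [Generators.lie_toAlg_toAlg D, Int.cast_zero, zero_smul]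
  have hπ0 {x : 𝔤} (hx : π x = x) : π x = ε ^ (0 : ℤ) • x := by rw [hx, zpow_zero, one_smul]
  have hπE0 : π (D.E 0) = ε ^ (1 : ℤ) • D.E 0 := by rw [zpow_one]; exact D.map_E₀
  have hπF0 : π (D.F 0) = ε ^ (-1 : ℤ) • D.F 0 := by rw [zpow_neg_one]; exact D.map_F₀
  have hθE0 : θ (D.E 0) = w • D.E 0 := by
    rw [hθ _ _ _ hπE0 hE0, one_mul, add_sub_cancel, zpow_one]
  have hprin : D.IsPrincipal w θ := by
    refine fun j => ⟨?_, ?_⟩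
    · rw [hθ _ _ _ (hπ0 (Generators.map_toAlg _)) (hh _), zero_mul, zero_add, zpow_zero, one_smul]
    · refine Fin.cases hθE0 (fun j => ?_) j
      rw [hθ _ _ _ (hπ0 (D.map_E_succ j)) (hE j), zero_mul, zero_add, zpow_one]
  classical
  -- The shift is `α(ρ)`, an integer whenever a real root vector of weight `α` exists; the value `0`
  -- elsewhere is never used.
  let shift (α : Module.Dual ℂ (fixedCartan π H)) : ℤ :=
    if h : ∃ n : ℤ, α ρ = n then h.choose else 0
  have hshift {α p x} (hx : D.IsRealRootVector α p x) :
      ⁅toAlg ρ, x⁆ = (shift α : ℂ) • x := by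
    have h := hr.exists_int hx.2.1 (hx.2.2.2 ρ)
    rw [hx.2.2.2 ρ, h.choose_spec]
    simp only [shift, dif_pos h]
  have key (N : ℕ) := exists_twistedEquiv (B := B) (hI := hI) (hS := hS) N hK0 hK hε hr hπr
    (bilinForm_map_map hI π) hM0 hw hθ
  have hBω {ω : 𝔤 ≃ₗ⁅ℂ⁆ 𝔤} (hω : ∀ h : fixedCartan π H, ω (toAlg h) = -toAlg h) {α p x}
      (hx : D.IsRealRootVector α p x) :
      ⁅toAlg ρ, ⁅x, ω x⁆⁆ = ((0 : ℤ) : ℂ) • ⁅x, ω x⁆ ∧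
        B (toAlg ρ) ⁅x, ω x⁆ = B x (ω x) * shift α := by
    refine ⟨?_, by rw [form_lie_eigen hI (hshift hx), mul_comm]⟩
    rw [leibniz_lie, hx.2.2.2, hx.lie_map hω, smul_lie, lie_smul, ← add_smul, add_neg_cancel,
      Int.cast_zero]
  have hlie {α β p q x y} (hx : D.IsRealRootVector α p x) (hy : D.IsRealRootVector β q y) :
      ⁅toAlg ρ, ⁅x, y⁆⁆ = ((shift α + shift β : ℤ) : ℂ) • ⁅x, y⁆ := by
    rw [leibniz_lie, hshift hx, hshift hy, smul_lie, lie_smul, ← add_smul, Int.cast_add]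
  have hε0 : ε ≠ 0 := hε.ne_zero hK0
  refine ⟨θ, ⟨hprin, fun θ' h => Generators.IsPrincipal.eq D hπ ha hK0 hK hε hprin h⟩,
    orderOf_eq_of_bigraded hK0 hK hε hr hπr hw hθ (D.E_ne_zero 0) hθE0, shift,
    fun α β p q x y hx hy hxy => ?_, ?_, fun N => ?_⟩
  · by_contra hne
    exact hxy (form_eq_zero hI (hshift hx) (hshift hy) (by exact_mod_cast hne))
  · rw [D.affine_eq_twisted hπ ha hK0 hK hε]
    obtain ⟨φ, hφ, hφc⟩ := key 0
    have hφC : Sends φ (cen K 0 0 0) (cen (K * M) 0 0 0) := by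
      simpa using hφc 0 0 0 (dvd_zero _)
    refine ⟨φ, fun i => ?_, fun i => ?_, ?_, ?_, fun i => ?_, ?_, hφC, fun α r₀ x hx => ?_,
      fun ω hω α p x r₀ hx hxr => ?_, fun α β r₀ s₀ x y hx hy hxy => ?_⟩
    · simpa [D.form_toAlg_E hI] using hφ _ _ _ 0 (hπ0 (D.map_E_succ i)) (hE i)
    · simpa [D.form_toAlg_F hI hπ ha] using hφ _ _ _ 0 (hπ0 (D.map_F_succ i)) (hF i)
    · simpa [D.form_toAlg_E hI] using hφ _ _ _ 0 hπE0 hE0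
    · have h := hφ _ _ _ 0 hπF0 hF0
      rw [show (-1 : ℤ) * M + (M - 1) = -1 by ring] at h
      simpa [D.form_toAlg_F hI hπ ha] using h
    · obtain ⟨ν, h1, h2, h3⟩ := D.exists_represents hB hI hπ i.succ
      refine ⟨ν, h1, h2, ?_⟩
      have h := hφ _ _ _ 0 (hπ0 (Generators.map_toAlg (D.h i.succ))) (hh _)
      rw [D.form_toAlg_h hI, hρ, mul_one, zero_mul, zero_add, div_eq_mul_inv, ← h3] at h
      exact h
    · obtain ⟨ν, h1, h2, h3⟩ := D.exists_represents hB hI hπ 0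
      refine ⟨ν, h1, h2, ?_⟩
      obtain ⟨m1, e1⟩ := hφ _ _ _ 0 (hπ0 (Generators.map_toAlg (D.h 0))) (hh _)
      obtain ⟨m2, e2⟩ := hφC
      rw [D.form_toAlg_h hI, hρ0, zero_mul, zero_add] at e1
      refine ⟨add_mem m1 (LieSubalgebra.smul_mem _ _ m2), ?_⟩
      have h : (⟨_, add_mem m1 (LieSubalgebra.smul_mem _ (B (D.E 0) (D.F 0) / K) m2)⟩ :
          twisted K 0 B hI hS π ε) = ⟨_, m1⟩ + (B (D.E 0) (D.F 0) / K) • ⟨_, m2⟩ := rfl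
      rw [h, map_add, map_smul, Submodule.coe_add, Submodule.coe_smul, e1, e2, add_assoc,
        ← add_smul, h3]
      -- The coefficient is `e (1 - M) / (K M) + e / K = e / (K M)` with `e = ⟨E₀, F₀⟩`: adding `(e
      -- / K) C` to `H₀` compensates for `ψ₀(ρ)` being `1 - M` instead of `1`.
      congr 2
      push_cast
      field_simp
      ring
    · simpa [hx.form_toAlg hI] using hφ _ _ _ 0 hx.2.2.1 (hshift hx)
    · obtain ⟨h1, h2⟩ := hBω hω hx
      have h := hφ _ _ _ 0 hxr h1
      rw [h2, add_zero] at h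
      by_cases h0 : r₀ = 0
      · subst h0
        simpa using h
      · rw [cen_eq_zero (mul_ne_zero hK0 hM0)
          (mul_ne_zero h0 (by exact_mod_cast hM0)), smul_zero] at h
        rwa [if_neg h0, zero_smul]
    · have h := hφ _ _ _ 0 (lie_eigen hε0 hx.2.2.1 hy.2.2.1) (hlie hx hy)
      -- The correction for `[x, y]` is proportional to `⟨ρ, [x, y]⟩ = N(α) ⟨x, y⟩`, which is zero
      -- here.
      rw [form_lie_eigen hI (hshift hx), hxy, mul_zero, zero_div, zero_smul, add_zero,
        ← add_assoc] at h
      exact h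
  · obtain ⟨Φ, hΦ, hΦc⟩ := key N
    refine ⟨Φ, fun α r₀ r x hx => ?_, fun ω hω α p x r₀ r hx hxr => ?_, hΦc,
      fun α β r₀ s₀ r x y hx hy hxy => ?_⟩
    · simpa [hx.form_toAlg hI] using hΦ _ _ _ r hx.2.2.1 (hshift hx)
    · obtain ⟨h1, h2⟩ := hBω hω hx
      have h := hΦ _ _ _ r hxr h1
      rwa [h2, add_zero] at h
    · have h := hΦ _ _ _ r (lie_eigen hε0 hx.2.2.1 hy.2.2.1) (hlie hx hy)
      rw [form_lie_eigen hI (hshift hx), hxy, mul_zero, zero_div, zero_smul, add_zero,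
        ← add_assoc] at h
      exact h
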